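/- Let $n\ge 2$. Put $D_0=\{x\in\mathbb R^n:|x|\le 1\}$ and $D_j=\{2^{j-1}<|x|\le 2^j\}$ for $j\ge 1$, and \[ \|f\|_{B}=\sum_{j\ge 0}2^{j/2}\|f\|_{L^2(D_j)},\qquad \|f\|_{B^*}=\sup_{j\ge 0}2^{-j/2}\|f\|_{L^2(D_j)},\qquad ⦀V⦀=\sum_{j\ge 0}2^j\|V\|_{L^\infty(D_j)} . \] $B$ and $B^*$ are the spaces of (classes of) measurable functions $\mathbb R^n\to\mathbb C$ for which the respective norm is finite. For $\lambda>0$, a Schwartz function $f$ and $x\in\mathbb R^n$ let \[ P_\lambda f(x)=\lim_{\varepsilon\to 0^+}\frac{1}{(2\pi)^{n/2}}\int_{|\lambda^2-|\xi|^2|>\varepsilon}\frac{e^{ix\cdot\xi}}{\lambda^2-|\xi|^2}\,\widehat f(\xi)\,d\xi,\qquad \widehat f(\xi)=\frac1{(2\pi)^{n/2}}\int_{\mathbb R^n} e^{-ix\cdot\xi}f(x)\,dx , \] and for $f\in C^\infty(\mathbb S^{n-1})$ (complex valued) let $E_\lambda f(x)=\int_{\mathbb S^{n-1}}e^{-i\lambda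 x\cdot\theta}f(\theta)\,d\sigma(\theta)$, with $\sigma$ the surface measure. Call $C_n>0$ admissible if $\|P_\lambda f\|_{B^*}\le \frac{C_n}{\lambda}\|f\|_B$ for all $\lambda>0$ and all Schwartz functions $f$. Given $C_n$ and $V\in L^\infty(\mathbb R^n)$ (complex valued) with $⦀V⦀<\infty$, put $\lambda_V=C_n⦀V⦀$. Then: (1) For every $\lambda>0$ the limit that defines $P_\lambda f(x)$ exists for all Schwartz functions $f$ and all $x$, and $P_\lambda$ has a unique extension to a bounded linear operator $P_\lambda:B\to B^*$. (2) For every admissible $C_n$, every such $V$ and every $\lambda>\lambda_V$, the operator $\mathrm{Id}-P_\lambda\circ V$ (where $V$ denotes multiplication by $V$, from $B^*$ to $B$) has a bounded inverse in $B^*$, and for every $f\in C^\infty(\mathbb S^{n-1})$ the functions $u=E_\lambda f$, $v=(\mathrm{Id}-P_\lambda\circ V)^{-1}[P_\lambda(Vu)]$ and $w=u+v$ belong to $B^*$, and $w$ solves $(\Delta+\lambda^2-V)w=0$ in $\mathbb R^n$ in the sense of distributions. (3) There exist an admissible $C_n$ and a constant $C>0$, both depending only on $n$, such that for every $\delta>0$,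 every such $V$, every $\lambda\ge\lambda_V+\delta$ and every $f\in C^\infty(\mathbb S^{n-1})$ \[ \|v\|_{B^*}\le \frac{C\lambda_V}{\lambda}\,\|u\|_{B^*}. \] Moreover, for an arbitrary admissible $C_n$, every $\delta>0$ and every $M$, the same inequality holds for all such $V$ with $⦀V⦀\le M$, all $\lambda\ge\lambda_V+\delta$ and all $f\in C^\infty(\mathbb S^{n-1})$, with a constant $C>0$ that depends only on $n$, $C_n$, $\delta$ and $M$. -/

import Mathlib

open MeasureTheory Filter Topology Set
open scoped ENNReal Manifold ContDiff SchwartzMap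

noncomputable section

namespace StationaryStates

/-- The Euclidean space `ℝⁿ`. -/
abbrev Space (n : ℕ) : Type := EuclideanSpace ℝ (Fin n)

/-- `D₀ = {|x| ≤ 1}` and `D_j = {2^(j-1) < |x| ≤ 2^j}` for `j ≥ 1`. -/
def shell (n : ℕ) : ℕ → Set (Space n)
  | 0 => {x | ‖x‖ ≤ 1}
  | j + 1 => {x | (2 : ℝ) ^ j < ‖x‖ ∧ ‖x‖ ≤ (2 : ℝ) ^ (j + 1)}

/-- The `L^p(D_j)` seminorm of `f`. -/
def shellNorm {n : ℕ} (p : ℝ≥0∞) (f : Space n → ℂ) (j : ℕ) : ℝ≥0∞ :=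
  eLpNorm f p (volume.restrict (shell n j))

/-- `⦀V⦀ = ∑_j 2^j ‖V‖_{L^∞(D_j)}`, with values in `[0,∞]`. -/
def tripleNorm {n : ℕ} (V : Space n → ℂ) : ℝ≥0∞ :=
  ∑' j : ℕ, (2 : ℝ≥0∞) ^ j * shellNorm ⊤ V j

/-- `‖f‖_B = ∑_j 2^(j/2) ‖f‖_{L²(D_j)}`, with values in `[0,∞]`. -/
def bENorm {n : ℕ} (f : Space n → ℂ) : ℝ≥0∞ :=
  ∑' j : ℕ, (2 : ℝ≥0∞) ^ ((j : ℝ) / 2) * shellNorm 2 f j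

/-- `‖f‖_{B*} = sup_j 2^(-j/2) ‖f‖_{L²(D_j)}`, with values in `[0,∞]`. -/
def bStarENorm {n : ℕ} (f : Space n → ℂ) : ℝ≥0∞ :=
  ⨆ j : ℕ, (2 : ℝ≥0∞) ^ (-((j : ℝ) / 2)) * shellNorm 2 f j

section NormLemmas

variable {n : ℕ}

lemma shellNorm_congr {p : ℝ≥0∞} {f g : Space n → ℂ} (h : f =ᵐ[volume] g) (j : ℕ) :
    shellNorm p f j = shellNorm p g j :=
  eLpNorm_congr_ae (ae_restrict_of_ae h)

lemma bENorm_congr {f g : Space n → ℂ} (h : f =ᵐ[volume] g) : bENorm f = bENorm g := by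
  simp only [bENorm, shellNorm_congr h]

lemma bStarENorm_congr {f g : Space n → ℂ} (h : f =ᵐ[volume] g) :
    bStarENorm f = bStarENorm g := by
  simp only [bStarENorm, shellNorm_congr h]

lemma shellNorm_add_le {f g : Space n → ℂ} (hf : AEStronglyMeasurable f volume)
    (hg : AEStronglyMeasurable g volume) (j : ℕ) :
    shellNorm 2 (f + g) j ≤ shellNorm 2 f j + shellNorm 2 g j :=
  eLpNorm_add_le hf.restrict hg.restrict (by norm_num)

lemma shellNorm_smul (c : ℂ) (f : Space n → ℂ) (j : ℕ) :
    shellNorm 2 (c • f) j = ‖c‖ₑ * shellNorm 2 f j :=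
  eLpNorm_const_smul c f 2 _

lemma bENorm_add_le {f g : Space n → ℂ} (hf : AEStronglyMeasurable f volume)
    (hg : AEStronglyMeasurable g volume) : bENorm (f + g) ≤ bENorm f + bENorm g := by
  unfold bENorm
  rw [← ENNReal.tsum_add]
  refine ENNReal.tsum_le_tsum fun j => ?_
  rw [← mul_add]
  gcongr
  exact shellNorm_add_le hf hg j

lemma bENorm_smul (c : ℂ) (f : Space n → ℂ) : bENorm (c • f) = ‖c‖ₑ * bENorm f := by
  unfold bENorm
  rw [← ENNReal.tsum_mul_left]
  refine tsum_congr fun j => ?_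
  rw [shellNorm_smul]
  ring

lemma bStarENorm_add_le {f g : Space n → ℂ} (hf : AEStronglyMeasurable f volume)
    (hg : AEStronglyMeasurable g volume) :
    bStarENorm (f + g) ≤ bStarENorm f + bStarENorm g := by
  refine iSup_le fun j => ?_
  refine (mul_le_mul_right (shellNorm_add_le hf hg j) _).trans ?_
  rw [mul_add]
  exact add_le_add
    (le_iSup (fun j : ℕ => (2 : ℝ≥0∞) ^ (-((j : ℝ) / 2)) * shellNorm 2 f j) j)
    (le_iSup (fun j : ℕ => (2 : ℝ≥0∞) ^ (-((j : ℝ) / 2)) * shellNorm 2 g j) j)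

lemma bStarENorm_smul (c : ℂ) (f : Space n → ℂ) :
    bStarENorm (c • f) = ‖c‖ₑ * bStarENorm f := by
  unfold bStarENorm
  rw [ENNReal.mul_iSup]
  refine iSup_congr fun j => ?_
  rw [shellNorm_smul]
  ring

lemma two_rpow_ne_zero (s : ℝ) : (2 : ℝ≥0∞) ^ s ≠ 0 := by
  simp [ENNReal.rpow_eq_zero_iff]

lemma two_rpow_ne_top (s : ℝ) : (2 : ℝ≥0∞) ^ s ≠ ⊤ := by
  exact ENNReal.rpow_ne_top_of_ne_zero (by norm_num) (by norm_num)

lemma iUnion_shell : (⋃ j, shell n j) = univ := by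
  refine eq_univ_of_forall fun x => mem_iUnion.2 ?_
  have hex : ∃ j : ℕ, ‖x‖ ≤ (2 : ℝ) ^ j := by
    obtain ⟨j, hj⟩ := pow_unbounded_of_one_lt ‖x‖ (one_lt_two (α := ℝ))
    exact ⟨j, hj.le⟩
  classical
  have hspec := Nat.find_spec hex
  have hmin := fun m => Nat.find_min (m := m) hex
  cases hj : Nat.find hex with
  | zero => exact ⟨0, by simpa [shell, hj] using hspec⟩
  | succ j =>
    refine ⟨j + 1, ?_, by simpa [hj] using hspec⟩
    exact not_le.1 (hmin j (by omega))

lemma ae_eq_zero_of_shellNorm {f : Space n → ℂ} (hf : AEStronglyMeasurable f volume)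
    (h : ∀ j, shellNorm 2 f j = 0) : f =ᵐ[volume] 0 := by
  have h1 : ∀ j, ∀ᵐ x ∂(volume.restrict (shell n j)), f x = 0 := fun j =>
    (eLpNorm_eq_zero_iff hf.restrict (by norm_num)).1 (h j)
  have h2 := (ae_restrict_iUnion_iff (μ := (volume : Measure (Space n))) (shell n)
    (fun x => f x = 0)).2 h1
  rw [iUnion_shell, Measure.restrict_univ] at h2
  exact h2

lemma ae_eq_zero_of_bENorm {f : Space n → ℂ} (hf : AEStronglyMeasurable f volume)
    (h : bENorm f = 0) : f =ᵐ[volume] 0 := by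
  refine ae_eq_zero_of_shellNorm hf fun j => ?_
  have := ENNReal.tsum_eq_zero.1 h j
  exact (mul_eq_zero.1 this).resolve_left (two_rpow_ne_zero _)

lemma ae_eq_zero_of_bStarENorm {f : Space n → ℂ} (hf : AEStronglyMeasurable f volume)
    (h : bStarENorm f = 0) : f =ᵐ[volume] 0 := by
  refine ae_eq_zero_of_shellNorm hf fun j => ?_
  have := ENNReal.iSup_eq_zero.1 h j
  exact (mul_eq_zero.1 this).resolve_left (two_rpow_ne_zero _)

lemma bENorm_zero : bENorm (0 : Space n → ℂ) = 0 := by simp [bENorm, shellNorm]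

lemma bStarENorm_zero : bStarENorm (0 : Space n → ℂ) = 0 := by simp [bStarENorm, shellNorm]

end NormLemmas

/-- The space `B(ℝⁿ)`, of classes modulo equality almost everywhere. -/
def B (n : ℕ) : Submodule ℂ (Space n →ₘ[volume] ℂ) where
  carrier := {f | bENorm (f : Space n → ℂ) < ⊤}
  zero_mem' := by
    change bENorm _ < ⊤
    rw [bENorm_congr AEEqFun.coeFn_zero, bENorm_zero]
    exact ENNReal.zero_lt_top
  add_mem' {f g} hf hg := by
    change bENorm _ < ⊤
    rw [bENorm_congr (AEEqFun.coeFn_add f g)]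
    exact (bENorm_add_le f.aestronglyMeasurable g.aestronglyMeasurable).trans_lt
      (ENNReal.add_lt_top.2 ⟨hf, hg⟩)
  smul_mem' c f hf := by
    change bENorm _ < ⊤
    rw [bENorm_congr (AEEqFun.coeFn_smul c f), bENorm_smul]
    exact ENNReal.mul_lt_top enorm_lt_top hf

/-- The space `B*(ℝⁿ)`, of classes modulo equality almost everywhere. -/
def BStar (n : ℕ) : Submodule ℂ (Space n →ₘ[volume] ℂ) where
  carrier := {f | bStarENorm (f : Space n → ℂ) < ⊤}
  zero_mem' := by
    change bStarENorm _ < ⊤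
    rw [bStarENorm_congr AEEqFun.coeFn_zero, bStarENorm_zero]
    exact ENNReal.zero_lt_top
  add_mem' {f g} hf hg := by
    change bStarENorm _ < ⊤
    rw [bStarENorm_congr (AEEqFun.coeFn_add f g)]
    exact (bStarENorm_add_le f.aestronglyMeasurable g.aestronglyMeasurable).trans_lt
      (ENNReal.add_lt_top.2 ⟨hf, hg⟩)
  smul_mem' c f hf := by
    change bStarENorm _ < ⊤
    rw [bStarENorm_congr (AEEqFun.coeFn_smul c f), bStarENorm_smul]
    exact ENNReal.mul_lt_top enorm_lt_top hf

section Instances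

variable {n : ℕ}

lemma mem_B {f : Space n →ₘ[volume] ℂ} : f ∈ B n ↔ bENorm (f : Space n → ℂ) < ⊤ := Iff.rfl

lemma mem_BStar {f : Space n →ₘ[volume] ℂ} :
    f ∈ BStar n ↔ bStarENorm (f : Space n → ℂ) < ⊤ := Iff.rfl

/-- An element of `B` as a function (a representative). -/
instance : CoeFun (B n) (fun _ => Space n → ℂ) := ⟨fun f => ((f : Space n →ₘ[volume] ℂ) : _ → ℂ)⟩

/-- An element of `B*` as a function (a representative). -/
instance : CoeFun (BStar n) (fun _ => Space n → ℂ) :=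
  ⟨fun f => ((f : Space n →ₘ[volume] ℂ) : _ → ℂ)⟩

instance : Norm (B n) := ⟨fun f => (bENorm (f : Space n → ℂ)).toReal⟩

instance : Norm (BStar n) := ⟨fun f => (bStarENorm (f : Space n → ℂ)).toReal⟩

lemma B.norm_def (f : B n) : ‖f‖ = (bENorm (f : Space n → ℂ)).toReal := rfl

lemma BStar.norm_def (f : BStar n) : ‖f‖ = (bStarENorm (f : Space n → ℂ)).toReal := rfl

lemma B.core : NormedSpace.Core ℂ (B n) where
  norm_nonneg _ := ENNReal.toReal_nonneg
  norm_smul c f := by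
    rw [B.norm_def, B.norm_def]
    have : bENorm ((c • f : B n) : Space n → ℂ) = ‖c‖ₑ * bENorm (f : Space n → ℂ) := by
      rw [← bENorm_smul]
      exact bENorm_congr (AEEqFun.coeFn_smul c (f : Space n →ₘ[volume] ℂ))
    rw [this, ENNReal.toReal_mul, toReal_enorm]
  norm_triangle f g := by
    rw [B.norm_def, B.norm_def, B.norm_def, ← ENNReal.toReal_add (mem_B.1 f.2).ne (mem_B.1 g.2).ne]
    refine ENNReal.toReal_mono (ENNReal.add_lt_top.2 ⟨mem_B.1 f.2, mem_B.1 g.2⟩).ne ?_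
    rw [show bENorm ((f + g : B n) : Space n → ℂ) = bENorm ((f : Space n → ℂ) + (g : Space n → ℂ)) from
      bENorm_congr (AEEqFun.coeFn_add (f : Space n →ₘ[volume] ℂ) g)]
    exact bENorm_add_le f.1.aestronglyMeasurable g.1.aestronglyMeasurable
  norm_eq_zero_iff f := by
    rw [B.norm_def, ENNReal.toReal_eq_zero_iff]
    constructor
    · rintro (h | h)
      · exact Subtype.ext (AEEqFun.ext ((ae_eq_zero_of_bENorm f.1.aestronglyMeasurable h).trans
          AEEqFun.coeFn_zero.symm))
      · exact absurd h (mem_B.1 f.2).ne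
    · rintro rfl
      left
      exact (bENorm_congr AEEqFun.coeFn_zero).trans bENorm_zero

lemma BStar.core : NormedSpace.Core ℂ (BStar n) where
  norm_nonneg _ := ENNReal.toReal_nonneg
  norm_smul c f := by
    rw [BStar.norm_def, BStar.norm_def]
    have : bStarENorm ((c • f : BStar n) : Space n → ℂ) =
        ‖c‖ₑ * bStarENorm (f : Space n → ℂ) := by
      rw [← bStarENorm_smul]
      exact bStarENorm_congr (AEEqFun.coeFn_smul c (f : Space n →ₘ[volume] ℂ))
    rw [this, ENNReal.toReal_mul, toReal_enorm]
  norm_triangle f g := by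
    rw [BStar.norm_def, BStar.norm_def, BStar.norm_def, ← ENNReal.toReal_add (mem_BStar.1 f.2).ne (mem_BStar.1 g.2).ne]
    refine ENNReal.toReal_mono (ENNReal.add_lt_top.2 ⟨mem_BStar.1 f.2, mem_BStar.1 g.2⟩).ne ?_
    rw [show bStarENorm ((f + g : BStar n) : Space n → ℂ) =
        bStarENorm ((f : Space n → ℂ) + (g : Space n → ℂ)) from
      bStarENorm_congr (AEEqFun.coeFn_add (f : Space n →ₘ[volume] ℂ) g)]
    exact bStarENorm_add_le f.1.aestronglyMeasurable g.1.aestronglyMeasurable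
  norm_eq_zero_iff f := by
    rw [BStar.norm_def, ENNReal.toReal_eq_zero_iff]
    constructor
    · rintro (h | h)
      · exact Subtype.ext (AEEqFun.ext
          ((ae_eq_zero_of_bStarENorm f.1.aestronglyMeasurable h).trans
          AEEqFun.coeFn_zero.symm))
      · exact absurd h (mem_BStar.1 f.2).ne
    · rintro rfl
      left
      exact (bStarENorm_congr AEEqFun.coeFn_zero).trans bStarENorm_zero

instance : NormedAddCommGroup (B n) := NormedAddCommGroup.ofCore B.core

instance : NormedSpace ℂ (B n) := NormedSpace.ofCore B.core

instance : NormedAddCommGroup (BStar n) := NormedAddCommGroup.ofCore BStar.core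

instance : NormedSpace ℂ (BStar n) := NormedSpace.ofCore BStar.core

end Instances

section Multiplication

variable {n : ℕ}

lemma bENorm_mul_le (V u : Space n → ℂ) (hu : AEStronglyMeasurable u volume) :
    bENorm (V * u) ≤ tripleNorm V * bStarENorm u := by
  unfold bENorm tripleNorm
  rw [← ENNReal.tsum_mul_right]
  refine ENNReal.tsum_le_tsum fun j => ?_
  have h1 : shellNorm 2 (V * u) j ≤ shellNorm ⊤ V j * shellNorm 2 u j :=
    eLpNorm_smul_le_eLpNorm_top_mul_eLpNorm (φ := V) (f := u) 2 hu.restrict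
  have h2 : (2 : ℝ≥0∞) ^ (-((j : ℝ) / 2)) * shellNorm 2 u j ≤ bStarENorm u :=
    le_iSup (fun j : ℕ => (2 : ℝ≥0∞) ^ (-((j : ℝ) / 2)) * shellNorm 2 u j) j
  have h3 : (2 : ℝ≥0∞) ^ ((j : ℝ) / 2) = 2 ^ j * 2 ^ (-((j : ℝ) / 2)) := by
    rw [← ENNReal.rpow_natCast, ← ENNReal.rpow_add _ _ (by norm_num) (by norm_num)]
    congr 1
    ring
  calc (2 : ℝ≥0∞) ^ ((j : ℝ) / 2) * shellNorm 2 (V * u) j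
      ≤ (2 : ℝ≥0∞) ^ ((j : ℝ) / 2) * (shellNorm ⊤ V j * shellNorm 2 u j) := by gcongr
    _ = 2 ^ j * shellNorm ⊤ V j * (2 ^ (-((j : ℝ) / 2)) * shellNorm 2 u j) := by
      rw [h3]; ring
    _ ≤ 2 ^ j * shellNorm ⊤ V j * bStarENorm u := by gcongr

/-- The class of `V u`. -/
def mulClass (V : Space n → ℂ) (hV : MemLp V ⊤ volume) (u : Space n →ₘ[volume] ℂ) :
    Space n →ₘ[volume] ℂ :=
  AEEqFun.mk V hV.1 * u

lemma coeFn_mulClass (V : Space n → ℂ) (hV : MemLp V ⊤ volume) (u : Space n →ₘ[volume] ℂ) :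
    (mulClass V hV u : Space n → ℂ) =ᵐ[volume] V * (u : Space n → ℂ) :=
  (AEEqFun.coeFn_mul _ _).trans ((AEEqFun.coeFn_mk V hV.1).mul (ae_eq_refl _))

lemma bENorm_mulClass_le (V : Space n → ℂ) (hV : MemLp V ⊤ volume)
    (u : Space n →ₘ[volume] ℂ) :
    bENorm (mulClass V hV u : Space n → ℂ) ≤ tripleNorm V * bStarENorm (u : Space n → ℂ) := by
  rw [bENorm_congr (coeFn_mulClass V hV u)]
  exact bENorm_mul_le V u u.aestronglyMeasurable

lemma mulClass_add (V : Space n → ℂ) (hV : MemLp V ⊤ volume) (u v : Space n →ₘ[volume] ℂ) :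
    mulClass V hV (u + v) = mulClass V hV u + mulClass V hV v := by
  apply AEEqFun.ext
  filter_upwards [coeFn_mulClass V hV (u + v), AEEqFun.coeFn_add u v,
    AEEqFun.coeFn_add (mulClass V hV u) (mulClass V hV v), coeFn_mulClass V hV u,
    coeFn_mulClass V hV v] with x h1 h2 h3 h4 h5
  simp only [Pi.mul_apply, Pi.add_apply] at h1 h2 h3 h4 h5
  rw [h1, h2, h3, h4, h5, mul_add]

lemma mulClass_smul (V : Space n → ℂ) (hV : MemLp V ⊤ volume) (c : ℂ)
    (u : Space n →ₘ[volume] ℂ) : mulClass V hV (c • u) = c • mulClass V hV u := by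
  apply AEEqFun.ext
  filter_upwards [coeFn_mulClass V hV (c • u), AEEqFun.coeFn_smul c u,
    AEEqFun.coeFn_smul c (mulClass V hV u), coeFn_mulClass V hV u] with x h1 h2 h3 h4
  simp only [Pi.mul_apply, Pi.smul_apply] at h1 h2 h3 h4
  rw [h1, h2, h3, h4, smul_eq_mul, smul_eq_mul]
  ring

/-- Multiplication by `V` as a linear map from `B*` to `B`. -/
def multLin (V : Space n → ℂ) (hV : MemLp V ⊤ volume) (hV' : tripleNorm V < ⊤) :
    BStar n →ₗ[ℂ] B n where
  toFun u := ⟨mulClass V hV u, mem_B.2 ((bENorm_mulClass_le V hV u).trans_lt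
    (ENNReal.mul_lt_top hV' (mem_BStar.1 u.2)))⟩
  map_add' u v := Subtype.ext (mulClass_add V hV u v)
  map_smul' c u := Subtype.ext (mulClass_smul V hV c u)

lemma norm_multLin_le (V : Space n → ℂ) (hV : MemLp V ⊤ volume) (hV' : tripleNorm V < ⊤)
    (u : BStar n) : ‖multLin V hV hV' u‖ ≤ (tripleNorm V).toReal * ‖u‖ := by
  rw [B.norm_def, BStar.norm_def, ← ENNReal.toReal_mul]
  exact ENNReal.toReal_mono (ENNReal.mul_lt_top hV' (mem_BStar.1 u.2)).ne
    (bENorm_mulClass_le V hV u)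

/-- The operator `u ∈ B* ↦ V u ∈ B` of multiplication by a potential `V ∈ L^∞` such that
`⦀V⦀ < ∞`. -/
def multOp (V : Space n → ℂ) (hV : MemLp V ⊤ volume) (hV' : tripleNorm V < ⊤) :
    BStar n →L[ℂ] B n :=
  LinearMap.mkContinuous (multLin V hV hV') (tripleNorm V).toReal (norm_multLin_le V hV hV')

lemma multOp_apply (V : Space n → ℂ) (hV : MemLp V ⊤ volume) (hV' : tripleNorm V < ⊤)
    (u : BStar n) : (multOp V hV hV' u : Space n → ℂ) =ᵐ[volume] V * (u : Space n → ℂ) :=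
  coeFn_mulClass V hV u

end Multiplication

section Resolvent

variable {n : ℕ}

/-- The unitary Fourier transform `(2π)^(-n/2) ∫ e^(-i x·ξ) f(x) dx`. -/
def fourierTransform (f : Space n → ℂ) (ξ : Space n) : ℂ :=
  ((2 * Real.pi) ^ (-((n : ℝ) / 2)) : ℝ) *
    ∫ x, Complex.exp (-Complex.I * (inner ℝ x ξ : ℝ)) * f x

/-- The truncated integral
`(2π)^(-n/2) ∫_{|lam² - |ξ|²| > ε} e^(i x·ξ) (lam² - |ξ|²)⁻¹ f^(ξ) dξ`. -/
def truncatedIntegral (lam : ℝ) (f : Space n → ℂ) (x : Space n) (ε : ℝ) : ℂ :=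
  ((2 * Real.pi) ^ (-((n : ℝ) / 2)) : ℝ) *
    ∫ ξ in {ξ : Space n | ε < |lam ^ 2 - ‖ξ‖ ^ 2|},
      Complex.exp (Complex.I * (inner ℝ x ξ : ℝ)) / ((lam ^ 2 - ‖ξ‖ ^ 2 : ℝ) : ℂ) *
        fourierTransform f ξ

/-- `P_lam f (x)` for a Schwartz function `f`: the principal value integral, that is, the limit
of the truncated integrals as `ε → 0⁺`. -/
def principalValue (lam : ℝ) (f : Space n → ℂ) (x : Space n) : ℂ :=
  limUnder (𝓝[>] (0 : ℝ)) (truncatedIntegral lam f x)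

/-- `P : B → B*` is a bounded linear extension of the principal value operator from the Schwartz
functions (all of which lie in `B`, and for which the principal value exists everywhere). -/
def IsResolventExtension (lam : ℝ) (P : B n →L[ℂ] BStar n) : Prop :=
  ∀ φ : 𝓢(Space n, ℂ),
    (∀ x, Tendsto (truncatedIntegral lam φ x) (𝓝[>] 0) (𝓝 (principalValue lam φ x))) ∧
    ∃ b : B n, (b : Space n → ℂ) =ᵐ[volume] φ ∧
      (P b : Space n → ℂ) =ᵐ[volume] principalValue lam φ

open Classical in
/-- The operator `P_lam : B → B*`, the bounded extension of the principal value operator (`0` if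
there were none). -/
def resolventOp (n : ℕ) (lam : ℝ) : B n →L[ℂ] BStar n :=
  if h : ∃ P : B n →L[ℂ] BStar n, IsResolventExtension lam P then h.choose else 0

/-- `K` is an admissible constant in the inequality `‖P_lam f‖_{B*} ≤ (K / lam) ‖f‖_B` for all
Schwartz functions `f` and all `lam > 0`. -/
def IsResolventConstant (n : ℕ) (K : ℝ) : Prop :=
  0 < K ∧ ∀ lam : ℝ, 0 < lam → ∀ φ : 𝓢(Space n, ℂ),
    bStarENorm (principalValue lam φ) ≤ ENNReal.ofReal (K / lam) * bENorm φ

end Resolvent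

section Waves

variable {n : ℕ}

/-- `f ∈ C^∞(S^(n-1))`, complex valued. -/
def IsSmoothOnSphere (hn : 2 ≤ n) (f : Metric.sphere (0 : Space n) 1 → ℂ) : Prop :=
  haveI : Fact (Module.finrank ℝ (Space n) = (n - 1) + 1) :=
    ⟨by rw [finrank_euclideanSpace_fin]; omega⟩
  ContMDiff (𝓡 (n - 1)) 𝓘(ℝ, ℂ) ∞ f

/-- The Herglotz wave `E_lam f (x) = ∫_{S^(n-1)} e^(-i lam x·θ) f(θ) dσ(θ)`. -/
def herglotz (lam : ℝ) (f : Metric.sphere (0 : Space n) 1 → ℂ) (x : Space n) : ℂ :=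
  ∫ θ : Metric.sphere (0 : Space n) 1,
    Complex.exp (-Complex.I * ((lam * inner ℝ x (θ : Space n) : ℝ) : ℂ)) * f θ
      ∂((volume : Measure (Space n)).toSphere)

/-- `(Δ + lam² - V) w = 0` in `ℝⁿ`, in the sense of distributions. -/
def SolvesHelmholtz (V : Space n → ℂ) (lam : ℝ) (w : Space n → ℂ) : Prop :=
  ∀ φ : Space n → ℂ, ContDiff ℝ ∞ φ → HasCompactSupport φ →
    ∫ x, w x * (Laplacian.laplacian φ x + (lam : ℂ) ^ 2 * φ x - V x * φ x) = 0

/-- `Id - P_lam ∘ V`, as a bounded operator in `B*`. -/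
def idSubResolventMul (V : Space n → ℂ) (hV : MemLp V ⊤ volume) (hV' : tripleNorm V < ⊤)
    (lam : ℝ) : BStar n →L[ℂ] BStar n :=
  1 - (resolventOp n lam).comp (multOp V hV hV')

/-- `(Id - P_lam ∘ V)⁻¹ [P_lam (V u)]`; the inverse is taken in the ring of bounded operators in
`B*`. -/
def correction (V : Space n → ℂ) (hV : MemLp V ⊤ volume) (hV' : tripleNorm V < ⊤)
    (lam : ℝ) (u : BStar n) : BStar n :=
  Ring.inverse (idSubResolventMul V hV hV' lam) (resolventOp n lam (multOp V hV hV' u))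

end Waves

end StationaryStates

end

noncomputable section

namespace StationaryStates

/-! ### The norms of B and B*, their duality pairing, and completeness of B*. -/

section Spaces

variable {n : ℕ}

/-! The heart is the bound of P_λ from B to B* with norm O(1/λ), uniform in the truncation ε. It is
proved on the Fourier side by reduction to one dimension. Since ∑ ξ_i²/|ξ|² = 1, the truncated
multiplier 1/(λ² - |ξ|²) splits into n pieces, the i-th weighted by ξ_i²/|ξ|². With the other
coordinates frozen at norm ρ < λ, the i-th piece is a function of s = ξ_i with poles at ±μ, μ² = λ²
- ρ². Partial fractions turn it into (μ/λ²) · μ/(μ² - s²) minus an integrable term of mass O(1/λ):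
the weight supplies the factor that compensates the merging of the poles as μ → 0. The Fourier
transform of the truncated μ/(μ² - s²) is bounded by an absolute constant because the sine integral
is (`norm_integral_exp_mul_pv_le`, `hasKernelBound_resolvent`).

A bounded convolution kernel in x_i pairs L¹ with L¹. Together with Plancherel in the other
variables, this bounds each piece on the mixed norm L¹ in x_i, L² in the rest, which Cauchy-Schwarz
on each shell dominates by √2 times the norm of B (`lintegral_slice_le_bENorm`,
`norm_integral_multiplier_le`). Duality (`bStarENorm_le_of_integral`) gives the B* bound, and Fatou
lets ε → 0.

The limit itself exists because, near the sphere |ξ| = λ, the integrand G can be compared with the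
function H that agrees with it there and is homogeneous of degree 2 - n. In the variable u = λ² -
|ξ|² the kernel 1/u is odd and annihilates H, while G - H = O(|u|)
(`exists_tendsto_integral_resolventWeight`). Density of the Schwartz functions in B then yields the
unique extension.

The same reduction, applied to the indicator of the annulus |λ² - |ξ|²| < ε, gives a bound O(ε/λ).
Division by ε and ε → 0 produce the trace theorem for the Fourier transform on the sphere, whose
dual says that Herglotz waves lie in B*.

The rest is perturbation theory. For λ > λ_V the operator P_λ V has norm below 1 on the Banach space
B*, so the Neumann series inverts Id - P_λ V. The correction satisfies v = P_λ V(u + v), which gives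
both the equation for w, because (Δ + λ²)P_λ is the identity on B, and the estimate ‖v‖(λ - λ_V) ≤
λ_V‖u‖. -/

lemma measurableSet_shell (j : ℕ) : MeasurableSet (shell n j) := by
  cases j with
  | zero => exact measurableSet_le measurable_norm measurable_const
  | succ j =>
    exact (measurableSet_lt measurable_const measurable_norm).inter
      (measurableSet_le measurable_norm measurable_const)

lemma norm_le_of_mem_shell {j : ℕ} {x : Space n} (hx : x ∈ shell n j) : ‖x‖ ≤ 2 ^ j := by
  cases j with
  | zero => simpa [shell] using hx
  | succ j => exact hx.2

lemma eLpNorm_two_eq {α : Type*} [MeasurableSpace α] (μ : Measure α) (f : α → ℂ) :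
    eLpNorm f 2 μ = (∫⁻ x, ‖f x‖ₑ ^ 2 ∂μ) ^ (1 / 2 : ℝ) := by
  rw [eLpNorm_eq_lintegral_rpow_enorm_toReal (by norm_num) (by norm_num)]
  simp

lemma eLpNorm_two_sq {α : Type*} [MeasurableSpace α] (μ : Measure α) (f : α → ℂ) :
    eLpNorm f 2 μ ^ 2 = ∫⁻ x, ‖f x‖ₑ ^ 2 ∂μ := by
  rw [eLpNorm_two_eq, ← ENNReal.rpow_natCast, ← ENNReal.rpow_mul]
  simp

lemma lintegral_mul_le_eLpNorm {α : Type*} [MeasurableSpace α] {μ : Measure α} {f g : α → ℂ}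
    (hf : AEStronglyMeasurable f μ) (hg : AEStronglyMeasurable g μ) :
    ∫⁻ x, ‖f x‖ₑ * ‖g x‖ₑ ∂μ ≤ eLpNorm f 2 μ * eLpNorm g 2 μ := by
  have := ENNReal.lintegral_mul_le_Lp_mul_Lq μ Real.HolderConjugate.two_two hf.enorm hg.enorm
  rw [eLpNorm_two_eq, eLpNorm_two_eq]
  simpa using this

lemma shellNorm_le_eLpNorm (f : Space n → ℂ) (j : ℕ) :
    shellNorm 2 f j ≤ eLpNorm f 2 volume :=
  eLpNorm_mono_measure _ Measure.restrict_le_self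

lemma mul_shellNorm_le_bENorm (f : Space n → ℂ) (j : ℕ) :
    (2 : ℝ≥0∞) ^ ((j : ℝ) / 2) * shellNorm 2 f j ≤ bENorm f :=
  ENNReal.le_tsum (f := fun j : ℕ => (2 : ℝ≥0∞) ^ ((j : ℝ) / 2) * shellNorm 2 f j) j

lemma two_rpow_mul_neg (s : ℝ) : (2 : ℝ≥0∞) ^ s * 2 ^ (-s) = 1 := by
  rw [← ENNReal.rpow_add _ _ (by norm_num) (by norm_num), add_neg_cancel, ENNReal.rpow_zero]

lemma shellNorm_le_mul_bStarENorm (f : Space n → ℂ) (j : ℕ) :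
    shellNorm 2 f j ≤ (2 : ℝ≥0∞) ^ ((j : ℝ) / 2) * bStarENorm f := by
  calc shellNorm 2 f j
      = (2 : ℝ≥0∞) ^ ((j : ℝ) / 2) * (2 ^ (-((j : ℝ) / 2)) * shellNorm 2 f j) := by
        rw [← mul_assoc, two_rpow_mul_neg, one_mul]
    _ ≤ _ := by
        gcongr
        exact le_iSup (fun j : ℕ => (2 : ℝ≥0∞) ^ (-((j : ℝ) / 2)) * shellNorm 2 f j) j

lemma bStarENorm_le_of_shellNorm_le {f : Space n → ℂ} {A : ℝ≥0∞}
    (h : ∀ j : ℕ, shellNorm 2 f j ≤ (2 : ℝ≥0∞) ^ ((j : ℝ) / 2) * A) : bStarENorm f ≤ A := by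
  refine iSup_le fun j => ?_
  calc (2 : ℝ≥0∞) ^ (-((j : ℝ) / 2)) * shellNorm 2 f j
      ≤ (2 : ℝ≥0∞) ^ (-((j : ℝ) / 2)) * ((2 : ℝ≥0∞) ^ ((j : ℝ) / 2) * A) := by
        gcongr; exact h j
    _ = A := by rw [← mul_assoc, mul_comm (2 ^ _), two_rpow_mul_neg, one_mul]

lemma one_le_two_rpow (j : ℕ) : (1 : ℝ≥0∞) ≤ 2 ^ ((j : ℝ) / 2) := by
  simpa using ENNReal.rpow_le_rpow_of_exponent_le (x := 2) (y := 0) (z := (j : ℝ) / 2)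
    (by norm_num) (by positivity)

lemma bStarENorm_le_eLpNorm (f : Space n → ℂ) : bStarENorm f ≤ eLpNorm f 2 volume :=
  bStarENorm_le_of_shellNorm_le fun j => (shellNorm_le_eLpNorm f j).trans
    (le_mul_of_one_le_left zero_le (one_le_two_rpow j))

/-- The duality pairing between `B*` and `B`. -/
lemma lintegral_mul_le_bStarENorm_mul_bENorm {u f : Space n → ℂ}
    (hu : AEStronglyMeasurable u volume) (hf : AEStronglyMeasurable f volume) :
    ∫⁻ x, ‖u x‖ₑ * ‖f x‖ₑ ≤ bStarENorm u * bENorm f := by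
  calc ∫⁻ x, ‖u x‖ₑ * ‖f x‖ₑ = ∫⁻ x in ⋃ j, shell n j, ‖u x‖ₑ * ‖f x‖ₑ := by
        rw [iUnion_shell, Measure.restrict_univ]
    _ ≤ ∑' j, ∫⁻ x in shell n j, ‖u x‖ₑ * ‖f x‖ₑ := lintegral_iUnion_le _ _
    _ ≤ ∑' j : ℕ, bStarENorm u * ((2 : ℝ≥0∞) ^ ((j : ℝ) / 2) * shellNorm 2 f j) := by
        refine ENNReal.tsum_le_tsum fun j => ?_
        refine (lintegral_mul_le_eLpNorm hu.restrict hf.restrict).trans ?_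
        calc shellNorm 2 u j * shellNorm 2 f j
            ≤ ((2 : ℝ≥0∞) ^ ((j : ℝ) / 2) * bStarENorm u) * shellNorm 2 f j := by
              gcongr; exact shellNorm_le_mul_bStarENorm u j
          _ = _ := by ring
    _ = _ := by rw [ENNReal.tsum_mul_left]; rfl

lemma shellNorm_eq_zero {f : Space n → ℂ} {j : ℕ} (h : ∀ x ∈ shell n j, f x = 0) :
    shellNorm 2 f j = 0 := by
  rw [shellNorm, eLpNorm_congr_ae (g := 0) ?_, eLpNorm_zero]
  exact (ae_restrict_iff' (measurableSet_shell j)).2 (ae_of_all _ h)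

lemma lt_norm_of_mem_shell {J j : ℕ} (hj : J < j) {x : Space n} (hx : x ∈ shell n j) :
    2 ^ J < ‖x‖ := by
  obtain ⟨k, rfl⟩ : ∃ k, j = k + 1 := ⟨j - 1, by omega⟩
  exact lt_of_le_of_lt (pow_le_pow_right₀ one_le_two (by omega)) hx.1

/-- On functions supported in a ball, the norm of `B` is controlled by the norm of `L²`. -/
lemma bENorm_le_of_support (J : ℕ) {f : Space n → ℂ} (h : ∀ x, 2 ^ J < ‖x‖ → f x = 0) :
    bENorm f ≤ (∑ j ∈ Finset.range (J + 1), (2 : ℝ≥0∞) ^ ((j : ℝ) / 2)) * eLpNorm f 2 volume := by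
  unfold bENorm
  rw [tsum_eq_sum (s := Finset.range (J + 1)), Finset.sum_mul]
  · gcongr with j hj
    exact shellNorm_le_eLpNorm f j
  · intro j hj
    rw [shellNorm_eq_zero fun x hx => h x (lt_norm_of_mem_shell (by simpa using hj) hx), mul_zero]

lemma sum_two_rpow_ne_top (J : ℕ) :
    ∑ j ∈ Finset.range (J + 1), (2 : ℝ≥0∞) ^ ((j : ℝ) / 2) ≠ ⊤ :=
  ENNReal.sum_ne_top.2 fun _ _ => two_rpow_ne_top _

/-- This is what allows inversion by a Neumann series. A rapidly Cauchy sequence is Cauchy in L² of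
every shell, hence converges almost everywhere; Fatou on each shell then transfers the Cauchy
estimates to the limit. -/
instance : CompleteSpace (BStar n) := by
  have key : ∀ (c : ℕ) (f g : BStar n), shellNorm 2 ((f : Space n → ℂ) - (g : Space n → ℂ)) c ≤
      (2 : ℝ≥0∞) ^ ((c : ℝ) / 2) * ENNReal.ofReal ‖f - g‖ := by
    intro c f g
    refine (shellNorm_le_mul_bStarENorm _ c).trans ?_
    rw [BStar.norm_def, ENNReal.ofReal_toReal (mem_BStar.1 (f - g).2).ne]
    gcongr
    exact (bStarENorm_congr (AEEqFun.coeFn_sub (f : Space n →ₘ[volume] ℂ) g)).ge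
  have hB : ∀ N : ℕ, (0 : ℝ) < (1 / 2) ^ N := fun N => by positivity
  refine Metric.complete_of_convergent_controlled_sequences (fun N => (1 / 2) ^ N) hB fun u hu => ?_
  have hu' : ∀ c N i k : ℕ, N ≤ i → N ≤ k → shellNorm 2 ((u i : Space n → ℂ) - (u k : Space n → ℂ)) c ≤
      (2 : ℝ≥0∞) ^ ((c : ℝ) / 2) * (1 / 2) ^ N := by
    intro c N i k hi hk
    refine (key c (u i) (u k)).trans ?_
    gcongr
    have := (hu N i k hi hk).le
    rw [dist_eq_norm] at this
    calc ENNReal.ofReal ‖u i - u k‖ ≤ ENNReal.ofReal ((1 / 2) ^ N) := ENNReal.ofReal_le_ofReal this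
      _ = (1 / 2) ^ N := by
        rw [ENNReal.ofReal_pow (by norm_num), ENNReal.ofReal_div_of_pos (by norm_num)]
        simp
  have hlim : ∀ c, ∀ᵐ x ∂(volume.restrict (shell n c)),
      ∃ l, Tendsto (fun i => (u i : Space n → ℂ) x) atTop (𝓝 l) := by
    intro c
    -- The exponent c/2 + 1 instead of c/2 only serves to make the Cauchy estimates strict.
    refine Lp.ae_tendsto_of_cauchy_eLpNorm (p := 2)
      (B := fun N => (2 : ℝ≥0∞) ^ ((c : ℝ) / 2 + 1) * (1 / 2) ^ N)
      (fun i => (u i).1.aestronglyMeasurable.restrict) (by norm_num) ?_ ?_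
    · rw [ENNReal.tsum_mul_left]
      refine ENNReal.mul_ne_top (two_rpow_ne_top _) ?_
      simp [ENNReal.tsum_geometric]
    · intro N i k hi hk
      refine lt_of_le_of_lt (hu' c N i k hi hk) ?_
      refine (ENNReal.mul_lt_mul_iff_left (by simp) (by simp)).2 ?_
      exact ENNReal.rpow_lt_rpow_of_exponent_lt (by norm_num) (by norm_num) (by norm_num)
  have hlim' : ∀ᵐ x ∂(volume : Measure (Space n)),
      ∃ l, Tendsto (fun i => (u i : Space n → ℂ) x) atTop (𝓝 l) := by
    have := (ae_restrict_iUnion_iff (μ := (volume : Measure (Space n))) (shell n) _).2 hlim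
    rwa [iUnion_shell, Measure.restrict_univ] at this
  obtain ⟨w, hw, hwlim⟩ := exists_stronglyMeasurable_limit_of_tendsto_ae
    (fun i => (u i).1.aestronglyMeasurable) hlim'
  have hest : ∀ N, bStarENorm (w - (u N : Space n → ℂ)) ≤ (1 / 2) ^ N := by
    intro N
    refine bStarENorm_le_of_shellNorm_le fun c => ?_
    refine Lp.eLpNorm_le_of_ae_tendsto (u := atTop) (f := fun i => (u i : Space n → ℂ) - (u N : Space n → ℂ))
      ?_ (fun i => ((u i).1.aestronglyMeasurable.sub (u N).1.aestronglyMeasurable).restrict) ?_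
    · filter_upwards [eventually_ge_atTop N] with i hi
      exact hu' c N i N hi le_rfl
    · filter_upwards [ae_restrict_of_ae hwlim] with x hx
      exact hx.sub_const _
  let W : Space n →ₘ[volume] ℂ := AEEqFun.mk w hw.aestronglyMeasurable
  have hWw : (W : Space n → ℂ) =ᵐ[volume] w := AEEqFun.coeFn_mk _ _
  have hW : W ∈ BStar n := by
    have h1 : W - (u 0 : Space n →ₘ[volume] ℂ) ∈ BStar n := by
      rw [mem_BStar, bStarENorm_congr ((AEEqFun.coeFn_sub _ _).trans (hWw.sub (ae_eq_refl _)))]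
      exact (hest 0).trans_lt (by simp)
    simpa using (BStar n).add_mem h1 (u 0).2
  refine ⟨⟨W, hW⟩, ?_⟩
  rw [tendsto_iff_norm_sub_tendsto_zero]
  have h0 : Tendsto (fun N : ℕ => ((1 : ℝ) / 2) ^ N) atTop (𝓝 0) :=
    tendsto_pow_atTop_nhds_zero_of_lt_one (by norm_num) (by norm_num)
  refine squeeze_zero (fun _ => norm_nonneg _) (fun N => ?_) h0
  rw [norm_sub_rev, BStar.norm_def]
  have h2 : bStarENorm (((⟨W, hW⟩ : BStar n) - u N : BStar n) : Space n → ℂ) ≤ (1 / 2) ^ N := by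
    refine (bStarENorm_congr ?_).trans_le (hest N)
    exact (AEEqFun.coeFn_sub W (u N)).trans (hWw.sub (ae_eq_refl _))
  refine (ENNReal.toReal_mono (by simp) h2).trans ?_
  simp

end Spaces

/-! ### Density of the Schwartz functions in B. -/

section Density

variable {n : ℕ}

/-- The function g = (1 + |x|²)φ is still in L², and on the j-th shell the factor 1 + |x|² is at
least 4^j/4. This gain beats the weight 2^(j/2) and leaves a geometric series. -/
lemma bENorm_schwartz_lt_top (φ : 𝓢(Space n, ℂ)) : bENorm φ < ⊤ := by
  let g : 𝓢(Space n, ℂ) := SchwartzMap.smulLeftCLM ℂ (fun x : Space n => 1 + ‖x‖ ^ 2) φ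
  have htg : Function.HasTemperateGrowth (fun x : Space n => 1 + ‖x‖ ^ 2) := by fun_prop
  have hg : ∀ x, ‖g x‖ = (1 + ‖x‖ ^ 2) * ‖φ x‖ := fun x => by
    rw [SchwartzMap.smulLeftCLM_apply_apply htg, norm_smul, Real.norm_of_nonneg (by positivity)]
  have hbound : ∀ j : ℕ, (2 : ℝ≥0∞) ^ ((j : ℝ) / 2) * shellNorm 2 φ j ≤
      4 * eLpNorm g 2 volume * (2⁻¹) ^ j := by
    intro j
    have h1 : ∀ x ∈ shell n j, ‖φ x‖ ≤ 4 * ((1 / 2) ^ j) ^ 2 * ‖g x‖ := by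
      intro x hx
      rw [hg]
      have h2 : 1 ≤ 4 * ((1 / 2 : ℝ) ^ j) ^ 2 * (1 + ‖x‖ ^ 2) := by
        cases j with
        | zero => nlinarith [sq_nonneg ‖x‖]
        | succ j =>
          have h3 : (2 : ℝ) ^ j ≤ ‖x‖ := hx.1.le
          have h4 : (1 : ℝ) ≤ (1 / 2) ^ j * ‖x‖ := by
            calc (1 : ℝ) = (1 / 2) ^ j * 2 ^ j := by rw [← mul_pow]; norm_num
              _ ≤ _ := by gcongr
          have h5 : (1 : ℝ) ≤ ((1 / 2) ^ j * ‖x‖) ^ 2 := one_le_pow₀ h4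
          calc (1 : ℝ) ≤ ((1 / 2) ^ j * ‖x‖) ^ 2 := h5
            _ = 4 * ((1 / 2 : ℝ) ^ (j + 1)) ^ 2 * ‖x‖ ^ 2 := by rw [pow_succ]; ring
            _ ≤ _ := by gcongr; linarith
      nlinarith [norm_nonneg (φ x), mul_le_mul_of_nonneg_right h2 (norm_nonneg (φ x))]
    have h2 : shellNorm 2 φ j ≤ ENNReal.ofReal (4 * ((1 / 2) ^ j) ^ 2) * eLpNorm g 2 volume := by
      refine (eLpNorm_le_mul_eLpNorm_of_ae_le_mul (g := g)
        ((ae_restrict_iff' (measurableSet_shell j)).2 (ae_of_all _ h1)) 2).trans ?_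
      gcongr
      exact Measure.restrict_le_self
    have h3 : ENNReal.ofReal (4 * ((1 / 2) ^ j) ^ 2) = 4 * ((2⁻¹ : ℝ≥0∞) ^ j) ^ 2 := by
      rw [ENNReal.ofReal_mul (by norm_num), ENNReal.ofReal_pow (by positivity),
        ENNReal.ofReal_pow (by norm_num), ENNReal.ofReal_div_of_pos (by norm_num)]
      simp
    have h4 : (2 : ℝ≥0∞) ^ ((j : ℝ) / 2) * (2⁻¹) ^ j ≤ 1 := by
      calc (2 : ℝ≥0∞) ^ ((j : ℝ) / 2) * (2⁻¹) ^ j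
          ≤ (2 : ℝ≥0∞) ^ (j : ℝ) * (2⁻¹) ^ j := by
            gcongr
            · norm_num
            · have : (0 : ℝ) ≤ j := by positivity
              linarith
        _ = 1 := by
            rw [ENNReal.rpow_natCast, ← mul_pow, ENNReal.mul_inv_cancel (by norm_num) (by norm_num),
              one_pow]
    calc (2 : ℝ≥0∞) ^ ((j : ℝ) / 2) * shellNorm 2 φ j
        ≤ (2 : ℝ≥0∞) ^ ((j : ℝ) / 2) * (4 * ((2⁻¹ : ℝ≥0∞) ^ j) ^ 2 * eLpNorm g 2 volume) := by
          gcongr; exact h2.trans_eq (by rw [h3])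
      _ = ((2 : ℝ≥0∞) ^ ((j : ℝ) / 2) * (2⁻¹) ^ j) * (4 * eLpNorm g 2 volume * (2⁻¹) ^ j) := by
          ring
      _ ≤ 1 * (4 * eLpNorm g 2 volume * (2⁻¹) ^ j) := by gcongr
      _ = _ := one_mul _
  refine (ENNReal.tsum_le_tsum hbound).trans_lt ?_
  rw [ENNReal.tsum_mul_left, ENNReal.tsum_geometric]
  refine ENNReal.mul_lt_top (ENNReal.mul_lt_top (by norm_num) ?_) (by simp)
  exact g.eLpNorm_lt_top 2 volume

/-- A smooth L² approximation is cut off by a bump that equals 1 where b lives. The error does not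
grow: outside that ball b = 0 and the cutoff only shrinks the approximation. Control of the support
is what later upgrades the L² error to an error in B. -/
lemma exists_schwartz_eLpNorm_sub_le {b : Space n → ℂ} (hb : MemLp b 2 volume) (J : ℕ)
    (hs : ∀ x, 2 ^ J < ‖x‖ → b x = 0) {ε : ℝ} (hε : 0 < ε) :
    ∃ φ : 𝓢(Space n, ℂ), (∀ x, 2 ^ (J + 1) < ‖x‖ → φ x = 0) ∧
      eLpNorm (b - ⇑φ) 2 volume ≤ ENNReal.ofReal ε := by
  obtain ⟨g, hg1, hg2, hg3⟩ := hb.exist_eLpNorm_sub_le (by norm_num) (by norm_num) hε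
  let χ : ContDiffBump (0 : Space n) :=
    ⟨2 ^ J, 2 ^ (J + 1), by positivity, pow_lt_pow_right₀ (by norm_num) (by omega)⟩
  have hχ : ContDiff ℝ ∞ (fun x => χ x • g x) := χ.contDiff.smul hg2
  have hc : HasCompactSupport (fun x => χ x • g x) :=
    hg1.mono fun x hx => by
      simp only [Function.mem_support] at hx ⊢
      exact fun h => hx (by rw [h, smul_zero])
  refine ⟨hc.toSchwartzMap hχ, fun x hx => ?_, ?_⟩
  · change χ x • g x = 0
    rw [χ.zero_of_le_dist (by simpa using hx.le), zero_smul]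
  · refine (eLpNorm_mono fun x => ?_).trans hg3
    change ‖b x - χ x • g x‖ ≤ ‖b x - g x‖
    rcases le_or_gt ‖x‖ (2 ^ J) with h | h
    · rw [χ.one_of_mem_closedBall (by simpa using h), one_smul]
    · rw [hs x h, zero_sub, zero_sub, norm_neg, norm_neg, norm_smul, Real.norm_of_nonneg χ.nonneg]
      exact mul_le_of_le_one_left (norm_nonneg _) χ.le_one

lemma exists_schwartz_bENorm_sub_le_of_support {b : Space n → ℂ} (hb : MemLp b 2 volume) (J : ℕ)
    (hs : ∀ x, 2 ^ J < ‖x‖ → b x = 0) {ε : ℝ} (hε : 0 < ε) :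
    ∃ φ : 𝓢(Space n, ℂ), (∀ x, 2 ^ (J + 1) < ‖x‖ → φ x = 0) ∧
      eLpNorm (b - ⇑φ) 2 volume ≤ ENNReal.ofReal ε ∧ bENorm (b - ⇑φ) ≤ ENNReal.ofReal ε := by
  set c := (∑ j ∈ Finset.range (J + 1 + 1), (2 : ℝ≥0∞) ^ ((j : ℝ) / 2)) with hc
  have hc' : c ≠ ⊤ := sum_two_rpow_ne_top _
  have hpos : 0 < c.toReal + 1 := by positivity
  obtain ⟨φ, h1, h2⟩ := exists_schwartz_eLpNorm_sub_le hb J hs (ε := ε / (c.toReal + 1))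
    (by positivity)
  refine ⟨φ, h1, h2.trans (ENNReal.ofReal_le_ofReal ?_), ?_⟩
  · exact div_le_self hε.le (by linarith [ENNReal.toReal_nonneg (a := c)])
  · refine (bENorm_le_of_support (J + 1) (f := b - ⇑φ) fun x hx => ?_).trans ?_
    · have : (2 : ℝ) ^ J < ‖x‖ := lt_of_le_of_lt (pow_le_pow_right₀ one_le_two (by omega)) hx
      simp [hs x this, h1 x hx]
    · calc c * eLpNorm (b - ⇑φ) 2 volume ≤ c * ENNReal.ofReal (ε / (c.toReal + 1)) := by gcongr
        _ = ENNReal.ofReal (c.toReal * (ε / (c.toReal + 1))) := by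
          rw [ENNReal.ofReal_mul ENNReal.toReal_nonneg, ENNReal.ofReal_toReal hc']
        _ ≤ ENNReal.ofReal ε := by
          refine ENNReal.ofReal_le_ofReal ?_
          rw [← mul_div_assoc, div_le_iff₀ hpos]
          nlinarith [ENNReal.toReal_nonneg (a := c)]

/-- The Schwartz functions are dense in `B`. -/
lemma exists_schwartz_bENorm_sub_le {b : Space n → ℂ} (hb : AEStronglyMeasurable b volume)
    (hb' : bENorm b < ⊤) {ε : ℝ} (hε : 0 < ε) :
    ∃ φ : 𝓢(Space n, ℂ), bENorm (b - ⇑φ) ≤ ENNReal.ofReal ε := by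
  have htail := ENNReal.tendsto_sum_nat_add
    (fun j : ℕ => (2 : ℝ≥0∞) ^ ((j : ℝ) / 2) * shellNorm 2 b j) hb'.ne
  have hε2 : 0 < ENNReal.ofReal (ε / 2) := ENNReal.ofReal_pos.2 (by positivity)
  obtain ⟨J, hJ⟩ := (htail.eventually (eventually_le_nhds hε2)).exists
  let b₁ : Space n → ℂ := (Metric.closedBall 0 (2 ^ J)).indicator b
  have hb₁m : AEStronglyMeasurable b₁ volume := hb.indicator measurableSet_closedBall
  have hb₁s : ∀ x, 2 ^ J < ‖x‖ → b₁ x = 0 := fun x hx =>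
    indicator_of_notMem (by simpa using hx) _
  have hb₁1 : ∀ x, ‖x‖ ≤ 2 ^ J → b₁ x = b x := fun x hx =>
    indicator_of_mem (by simpa using hx) _
  have hb₁L : MemLp b₁ 2 volume := by
    refine ⟨hb₁m, ?_⟩
    have h1 : eLpNorm b₁ 2 volume ^ 2 < ⊤ := by
      rw [eLpNorm_two_sq]
      calc ∫⁻ x, ‖b₁ x‖ₑ ^ 2 = ∫⁻ x in ⋃ j, shell n j, ‖b₁ x‖ₑ ^ 2 := by
            rw [iUnion_shell, Measure.restrict_univ]
        _ ≤ ∑' j, ∫⁻ x in shell n j, ‖b₁ x‖ₑ ^ 2 := lintegral_iUnion_le _ _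
        _ = ∑' j, (shellNorm 2 b₁ j) ^ 2 := by
            simp only [shellNorm, eLpNorm_two_sq]
        _ = ∑ j ∈ Finset.range (J + 1), (shellNorm 2 b₁ j) ^ 2 := by
            refine tsum_eq_sum fun j hj => ?_
            rw [shellNorm_eq_zero fun x hx =>
              hb₁s x (lt_norm_of_mem_shell (by simpa using hj) hx)]
            simp
        _ < ⊤ := by
            refine ENNReal.sum_lt_top.2 fun j _ => ENNReal.pow_lt_top ?_
            have h2 : shellNorm 2 b₁ j ≤ bENorm b :=
              calc shellNorm 2 b₁ j ≤ shellNorm 2 b j :=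
                    eLpNorm_mono fun x => norm_indicator_le_norm_self _ _
                _ ≤ 2 ^ ((j : ℝ) / 2) * shellNorm 2 b j :=
                    le_mul_of_one_le_left zero_le (one_le_two_rpow j)
                _ ≤ _ := mul_shellNorm_le_bENorm b j
            exact h2.trans_lt hb'
    by_contra hcon
    rw [not_lt_top_iff.1 hcon] at h1
    simp at h1
  obtain ⟨φ, -, -, h3⟩ := exists_schwartz_bENorm_sub_le_of_support hb₁L J hb₁s
    (ε := ε / 2) (by positivity)
  refine ⟨φ, ?_⟩
  have h4 : bENorm (b - b₁) ≤ ENNReal.ofReal (ε / 2) := by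
    -- The difference vanishes on the shells up to J, so its norm is dominated by a tail of the
    -- convergent series for b.
    refine le_trans ?_ hJ
    have h5 : ∀ j : ℕ, j ≤ J → shellNorm 2 (b - b₁) j = 0 := fun j hj =>
      shellNorm_eq_zero fun x hx => by
        rw [Pi.sub_apply, hb₁1 x ((norm_le_of_mem_shell hx).trans
          (pow_le_pow_right₀ one_le_two hj)), sub_self]
    unfold bENorm
    rw [← ENNReal.summable.sum_add_tsum_nat_add' (k := J)]
    rw [Finset.sum_eq_zero fun j hj => by rw [h5 j (Finset.mem_range.1 hj).le, mul_zero], zero_add]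
    refine ENNReal.tsum_le_tsum fun j => ?_
    gcongr
    refine eLpNorm_mono fun x => ?_
    rcases le_or_gt ‖x‖ (2 ^ J) with h | h
    · simp [hb₁1 x h]
    · simp [hb₁s x h]
  calc bENorm (b - ⇑φ) = bENorm ((b - b₁) + (b₁ - ⇑φ)) := by rw [sub_add_sub_cancel]
    _ ≤ bENorm (b - b₁) + bENorm (b₁ - ⇑φ) := bENorm_add_le (hb.sub hb₁m)
        (hb₁m.sub φ.continuous.aestronglyMeasurable)
    _ ≤ ENNReal.ofReal (ε / 2) + ENNReal.ofReal (ε / 2) := add_le_add h4 h3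
    _ = ENNReal.ofReal ε := by
        rw [← ENNReal.ofReal_add (by positivity) (by positivity), add_halves]

end Density

/-! ### Duality between B and B*, and the Schwartz functions inside B. -/

section Duality

variable {n : ℕ}

open ComplexConjugate in
/-- A bounded function whose pairing with the Schwartz functions is controlled by the norm of `B`
belongs to `B*`. -/
lemma bStarENorm_le_of_integral {u : Space n → ℂ} (hu : AEStronglyMeasurable u volume) {M : ℝ}
    (hM : ∀ x, ‖u x‖ ≤ M) {A : ℝ} (hA : 0 ≤ A)
    (h : ∀ φ : 𝓢(Space n, ℂ), ‖∫ x, u x * conj (φ x)‖ ≤ A * (bENorm φ).toReal) :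
    bStarENorm u ≤ ENNReal.ofReal A := by
  refine bStarENorm_le_of_shellNorm_le fun j => ?_
  -- The test function will be u restricted to the j-th shell, of norm at most 2^(j/2) ‖u‖_{L²(D_j)}
  -- in B. Its Schwartz approximations spill into the ball of twice the radius, hence K.
  let K : Set (Space n) := Metric.closedBall 0 (2 ^ (j + 1))
  let b : Space n → ℂ := (shell n j).indicator u
  let uK : Space n → ℂ := K.indicator u
  have hbm : AEStronglyMeasurable b volume := hu.indicator (measurableSet_shell j)
  have huKm : AEStronglyMeasurable uK volume := hu.indicator measurableSet_closedBall
  have huK : MemLp uK 2 volume := by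
    rw [memLp_indicator_iff_restrict measurableSet_closedBall]
    have : IsFiniteMeasure ((volume : Measure (Space n)).restrict (Metric.closedBall 0 (2 ^ (j + 1)))) :=
      ⟨by rw [Measure.restrict_apply_univ]; exact measure_closedBall_lt_top⟩
    exact MemLp.of_bound hu.restrict M (ae_of_all _ hM)
  have hbK : ∀ x, ‖b x‖ ≤ ‖uK x‖ := by
    intro x
    by_cases hx : x ∈ shell n j
    · have : x ∈ K := by
        simp only [K, Metric.mem_closedBall, dist_zero_right]
        exact (norm_le_of_mem_shell hx).trans (pow_le_pow_right₀ one_le_two (by omega))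
      simp [b, uK, hx, this]
    · simp [b, hx]
  have hb : MemLp b 2 volume := huK.mono hbm (ae_of_all _ hbK)
  have hbs : ∀ x, 2 ^ j < ‖x‖ → b x = 0 := fun x hx =>
    indicator_of_notMem (fun hx' => not_lt.2 (norm_le_of_mem_shell hx') hx) _
  have hNb : eLpNorm b 2 volume = shellNorm 2 u j :=
    eLpNorm_indicator_eq_eLpNorm_restrict (measurableSet_shell j)
  have hBb : bENorm b ≤ (2 : ℝ≥0∞) ^ ((j : ℝ) / 2) * shellNorm 2 u j := by
    unfold bENorm
    rw [tsum_eq_single j, shellNorm, ← hNb]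
    · gcongr
      exact Measure.restrict_le_self
    · intro i hij
      rw [shellNorm_eq_zero, mul_zero]
      intro x hx
      refine indicator_of_notMem (fun hx' => ?_) _
      rcases lt_or_gt_of_ne hij with h1 | h1
      · exact not_lt.2 (norm_le_of_mem_shell hx) (lt_norm_of_mem_shell h1 hx')
      · exact not_lt.2 (norm_le_of_mem_shell hx') (lt_norm_of_mem_shell h1 hx)
  set N := (shellNorm 2 u j).toReal with hN
  have hNtop : shellNorm 2 u j ≠ ⊤ := by rw [← hNb]; exact hb.2.ne
  have hsq : ∫ x, u x * conj (b x) = ((N ^ 2 : ℝ) : ℂ) := by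
    have h1 : ∀ x, u x * conj (b x) = ((‖b x‖ ^ 2 : ℝ) : ℂ) := by
      intro x
      by_cases hx : x ∈ shell n j
      · simp [b, hx, Complex.mul_conj, Complex.normSq_eq_norm_sq]
      · simp [b, hx]
    simp_rw [h1]
    rw [integral_complex_ofReal]
    congr 1
    rw [integral_eq_lintegral_of_nonneg_ae (f := fun x => ‖b x‖ ^ 2)
      (ae_of_all _ fun x => sq_nonneg ‖b x‖) (hbm.norm.pow 2), hN, ← hNb, ← ENNReal.toReal_pow, eLpNorm_two_sq]
    congr 1
    refine lintegral_congr fun x => ?_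
    rw [ENNReal.ofReal_pow (norm_nonneg _), ofReal_norm]
  set c := (2 : ℝ) ^ ((j : ℝ) / 2) with hc
  have hc0 : 0 ≤ c := by positivity
  have hcE : ((2 : ℝ≥0∞) ^ ((j : ℝ) / 2)).toReal = c := by
    rw [← ENNReal.toReal_rpow]; simp [hc]
  set M' := (eLpNorm uK 2 volume).toReal with hM'
  have hmain : ∀ ε : ℝ, 0 < ε → N ^ 2 ≤ A * (c * N) + (A + M') * ε := by
    intro ε hε
    obtain ⟨φ, h1, h2, h3⟩ := exists_schwartz_bENorm_sub_le_of_support hb j hbs hε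
    have hφ2 : MemLp (b - ⇑φ) 2 volume := hb.sub (φ.memLp 2 volume)
    -- Since b and φ both vanish off K, the error term sees only u on K, which is square integrable
    -- because u is bounded.
    have hsplit : ∀ x, u x * conj (b x) = u x * conj (φ x) + uK x * conj ((b - ⇑φ) x) := by
      intro x
      by_cases hx : x ∈ K
      · simp only [uK, indicator_of_mem hx, Pi.sub_apply, map_sub]; ring
      · have hx' : 2 ^ (j + 1) < ‖x‖ := by simpa [K] using hx
        have hx'' : (2 : ℝ) ^ j < ‖x‖ := lt_of_le_of_lt (pow_le_pow_right₀ one_le_two (by omega)) hx'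
        simp [hbs x hx'', h1 x hx', uK, hx]
    have hi1 : Integrable (fun x => u x * conj (φ x)) volume := by
      refine (Integrable.bdd_mul (c := M) ?_ hu (ae_of_all _ hM))
      exact (φ.integrable (μ := volume)).norm.mono'
        (Complex.continuous_conj.comp φ.continuous).aestronglyMeasurable
        (ae_of_all _ fun x => by simp)
    have hcs : ∫⁻ x, ‖uK x * conj ((b - ⇑φ) x)‖ₑ ≤
        eLpNorm uK 2 volume * eLpNorm (b - ⇑φ) 2 volume := by
      refine le_trans (le_of_eq ?_) (lintegral_mul_le_eLpNorm huKm hφ2.1)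
      refine lintegral_congr fun x => ?_
      rw [enorm_mul, RCLike.enorm_conj]
    have hi2 : Integrable (fun x => uK x * conj ((b - ⇑φ) x)) volume :=
      ⟨huKm.mul (Complex.continuous_conj.comp_aestronglyMeasurable hφ2.1),
        hcs.trans_lt (ENNReal.mul_lt_top huK.2 hφ2.2)⟩
    have hn2 : ‖∫ x, uK x * conj ((b - ⇑φ) x)‖ ≤ M' * ε := by
      refine (norm_integral_le_lintegral_norm _).trans ?_
      simp only [ofReal_norm]
      refine (ENNReal.toReal_mono (ENNReal.mul_ne_top huK.2.ne ENNReal.ofReal_ne_top)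
        (hcs.trans (mul_le_mul_right h2 _))).trans ?_
      rw [ENNReal.toReal_mul, ENNReal.toReal_ofReal hε.le]
    have hφB : (bENorm φ).toReal ≤ c * N + ε := by
      have h4 : bENorm φ ≤ (2 : ℝ≥0∞) ^ ((j : ℝ) / 2) * shellNorm 2 u j + ENNReal.ofReal ε := by
        have : (φ : Space n → ℂ) = b + (-1 : ℂ) • (b - ⇑φ) := by
          ext x; simp
        rw [this]
        refine (bENorm_add_le hbm (hφ2.1.const_smul _)).trans (add_le_add hBb ?_)
        rw [bENorm_smul]
        simpa using h3
      refine (ENNReal.toReal_mono (by finiteness) h4).trans ?_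
      rw [ENNReal.toReal_add (by finiteness) (by finiteness), ENNReal.toReal_mul, hcE,
        ENNReal.toReal_ofReal hε.le]
    have h5 : N ^ 2 = ‖∫ x, u x * conj (b x)‖ := by
      rw [hsq, Complex.norm_real, Real.norm_of_nonneg (by positivity)]
    rw [h5]
    simp_rw [hsplit]
    rw [integral_add hi1 hi2]
    calc _ ≤ ‖∫ x, u x * conj (φ x)‖ + ‖∫ x, uK x * conj ((b - ⇑φ) x)‖ := norm_add_le _ _
      _ ≤ A * (c * N + ε) + M' * ε :=
        add_le_add ((h φ).trans (mul_le_mul_of_nonneg_left hφB hA)) hn2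
      _ = _ := by ring
  have hN0 : 0 ≤ N := ENNReal.toReal_nonneg
  have hlim : N ^ 2 ≤ A * (c * N) := by
    refine le_of_forall_pos_le_add fun δ hδ => ?_
    have hD : 0 < A + M' + 1 := by
      have : 0 ≤ M' := ENNReal.toReal_nonneg
      linarith
    refine (hmain (δ / (A + M' + 1)) (by positivity)).trans ?_
    gcongr
    rw [← mul_div_assoc, div_le_iff₀ hD]
    nlinarith
  -- One factor N is cancelled, which is legitimate because boundedness of u makes N finite.
  have hfin : N ≤ c * A := by
    rcases hN0.eq_or_lt with h0 | h0
    · rw [← h0]; positivity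
    · nlinarith
  rw [← ENNReal.ofReal_toReal hNtop, ← hN]
  refine (ENNReal.ofReal_le_ofReal hfin).trans_eq ?_
  rw [ENNReal.ofReal_mul hc0, ← hcE, ENNReal.ofReal_toReal (two_rpow_ne_top _)]

lemma integrable_mul_of_bStarENorm {u f : Space n → ℂ}
    (hu : AEStronglyMeasurable u volume) (hu' : bStarENorm u < ⊤)
    (hf : AEStronglyMeasurable f volume) (hf' : bENorm f < ⊤) :
    Integrable (fun x => u x * f x) volume := by
  refine ⟨hu.mul hf, ?_⟩
  change ∫⁻ x, ‖u x * f x‖ₑ < ⊤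
  simp only [enorm_mul]
  exact (lintegral_mul_le_bStarENorm_mul_bENorm hu hf).trans_lt (ENNReal.mul_lt_top hu' hf')

lemma norm_integral_mul_le {u f : Space n → ℂ}
    (hu : AEStronglyMeasurable u volume) (hu' : bStarENorm u < ⊤)
    (hf : AEStronglyMeasurable f volume) (hf' : bENorm f < ⊤) :
    ‖∫ x, u x * f x‖ ≤ (bStarENorm u).toReal * (bENorm f).toReal := by
  refine (norm_integral_le_lintegral_norm _).trans ?_
  simp only [ofReal_norm, enorm_mul]
  rw [← ENNReal.toReal_mul]
  exact ENNReal.toReal_mono (ENNReal.mul_lt_top hu' hf').ne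
    (lintegral_mul_le_bStarENorm_mul_bENorm hu hf)

/-- Integration against an element of `B`, as a functional on `B*`. -/
def pairBStar (f : Space n → ℂ) (hf : AEStronglyMeasurable f volume) (hf' : bENorm f < ⊤) :
    BStar n →L[ℂ] ℂ :=
  LinearMap.mkContinuous
    { toFun := fun u => ∫ x, (u : Space n → ℂ) x * f x
      map_add' := fun u v => by
        rw [← integral_add
          (integrable_mul_of_bStarENorm u.1.aestronglyMeasurable (mem_BStar.1 u.2) hf hf')
          (integrable_mul_of_bStarENorm v.1.aestronglyMeasurable (mem_BStar.1 v.2) hf hf')]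
        refine integral_congr_ae ?_
        filter_upwards [AEEqFun.coeFn_add (u : Space n →ₘ[volume] ℂ) v] with x hx
        change ((u : Space n →ₘ[volume] ℂ) + v : Space n →ₘ[volume] ℂ) x * f x = _
        rw [hx, Pi.add_apply, add_mul]
      map_smul' := fun c u => by
        rw [RingHom.id_apply, ← integral_smul]
        refine integral_congr_ae ?_
        filter_upwards [AEEqFun.coeFn_smul c (u : Space n →ₘ[volume] ℂ)] with x hx
        change (c • (u : Space n →ₘ[volume] ℂ) : Space n →ₘ[volume] ℂ) x * f x = _
        rw [hx, Pi.smul_apply, smul_mul_assoc] }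
    (bENorm f).toReal fun u => by
      rw [mul_comm, BStar.norm_def]
      exact norm_integral_mul_le u.1.aestronglyMeasurable (mem_BStar.1 u.2) hf hf'

/-- Integration against an element of `B*`, as a functional on `B`. -/
def pairB (f : Space n → ℂ) (hf : AEStronglyMeasurable f volume) (hf' : bStarENorm f < ⊤) :
    B n →L[ℂ] ℂ :=
  LinearMap.mkContinuous
    { toFun := fun u => ∫ x, f x * (u : Space n → ℂ) x
      map_add' := fun u v => by
        rw [← integral_add
          (integrable_mul_of_bStarENorm hf hf' u.1.aestronglyMeasurable (mem_B.1 u.2))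
          (integrable_mul_of_bStarENorm hf hf' v.1.aestronglyMeasurable (mem_B.1 v.2))]
        refine integral_congr_ae ?_
        filter_upwards [AEEqFun.coeFn_add (u : Space n →ₘ[volume] ℂ) v] with x hx
        change f x * ((u : Space n →ₘ[volume] ℂ) + v : Space n →ₘ[volume] ℂ) x = _
        rw [hx, Pi.add_apply, mul_add]
      map_smul' := fun c u => by
        rw [RingHom.id_apply, ← integral_smul]
        refine integral_congr_ae ?_
        filter_upwards [AEEqFun.coeFn_smul c (u : Space n →ₘ[volume] ℂ)] with x hx
        change f x * (c • (u : Space n →ₘ[volume] ℂ) : Space n →ₘ[volume] ℂ) x = _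
        rw [hx, Pi.smul_apply, mul_smul_comm] }
    (bStarENorm f).toReal fun u => by
      rw [B.norm_def]
      exact norm_integral_mul_le hf hf' u.1.aestronglyMeasurable (mem_B.1 u.2)

lemma pairB_apply {f : Space n → ℂ} (hf : AEStronglyMeasurable f volume)
    (hf' : bStarENorm f < ⊤) (u : B n) :
    pairB f hf hf' u = ∫ x, f x * (u : Space n → ℂ) x := rfl

/-- The inclusion of the Schwartz space into `B`. -/
def schwartzB (n : ℕ) : 𝓢(Space n, ℂ) →ₗ[ℂ] B n where
  toFun φ := ⟨AEEqFun.mk φ φ.continuous.aestronglyMeasurable, by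
    rw [mem_B, bENorm_congr (AEEqFun.coeFn_mk _ _)]
    exact bENorm_schwartz_lt_top φ⟩
  map_add' φ ψ := Subtype.ext rfl
  map_smul' c φ := Subtype.ext rfl

lemma coeFn_schwartzB (φ : 𝓢(Space n, ℂ)) : (schwartzB n φ : Space n → ℂ) =ᵐ[volume] φ :=
  AEEqFun.coeFn_mk _ _

lemma norm_schwartzB (φ : 𝓢(Space n, ℂ)) : ‖schwartzB n φ‖ = (bENorm φ).toReal := by
  rw [B.norm_def, bENorm_congr (coeFn_schwartzB φ)]

lemma eq_schwartzB {b : B n} {φ : 𝓢(Space n, ℂ)} (h : (b : Space n → ℂ) =ᵐ[volume] φ) :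
    b = schwartzB n φ :=
  Subtype.ext (AEEqFun.ext (h.trans (coeFn_schwartzB φ).symm))

lemma denseRange_schwartzB : DenseRange (schwartzB n) := by
  intro b
  rw [Metric.mem_closure_range_iff]
  intro ε hε
  obtain ⟨φ, hφ⟩ := exists_schwartz_bENorm_sub_le b.1.aestronglyMeasurable (mem_B.1 b.2)
    (half_pos hε)
  refine ⟨φ, ?_⟩
  rw [dist_eq_norm, B.norm_def]
  have h1 : bENorm ((b - schwartzB n φ : B n) : Space n → ℂ) ≤ ENNReal.ofReal (ε / 2) := by
    refine (bENorm_congr ?_).trans_le hφ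
    exact (AEEqFun.coeFn_sub (b : Space n →ₘ[volume] ℂ) _).trans
      ((ae_eq_refl _).sub (coeFn_schwartzB φ))
  refine lt_of_le_of_lt (ENNReal.toReal_mono ENNReal.ofReal_ne_top h1) ?_
  rw [ENNReal.toReal_ofReal (by positivity)]
  linarith

end Duality

/-! ### The sine integral and the Fourier transform of the truncated 1/r. -/

section Kernels

lemma norm_exp_neg_I_mul (r : ℝ) : ‖Complex.exp (-Complex.I * (r : ℂ))‖ = 1 := by
  rw [Complex.norm_exp]; simp

lemma norm_exp_I_mul (r : ℝ) : ‖Complex.exp (Complex.I * (r : ℂ))‖ = 1 := by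
  rw [Complex.norm_exp]; simp

lemma intervalIntegrable_sin_div {t a b : ℝ} (ha : 0 < a) (hab : a ≤ b) :
    IntervalIntegrable (fun r => Real.sin (t * r) / r) volume a b := by
  refine ContinuousOn.intervalIntegrable ?_
  rw [uIcc_of_le hab]
  exact ContinuousOn.div (by fun_prop) (by fun_prop) fun r hr => (ha.trans_le hr.1).ne'

lemma abs_integral_sin_div_le_of_le {t a b : ℝ} (ht : 0 < t) (ha : 0 < a) (hab : a ≤ b)
    (hb : t * b ≤ 1) : |∫ r in a..b, Real.sin (t * r) / r| ≤ 1 := by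
  have h := intervalIntegral.norm_integral_le_of_norm_le_const (a := a) (b := b) (C := t)
    (f := fun r => Real.sin (t * r) / r) fun r hr => by
      rw [uIoc_of_le hab] at hr
      have hr0 : 0 < r := ha.trans hr.1
      rw [Real.norm_eq_abs, abs_div, abs_of_pos hr0, div_le_iff₀ hr0]
      refine Real.abs_sin_le_abs.trans_eq ?_
      rw [abs_of_pos (by positivity)]
  rw [Real.norm_eq_abs, abs_of_nonneg (sub_nonneg.2 hab)] at h
  nlinarith

/-- Integration by parts: the boundary terms contribute at most 1/(ta) + 1/(tb) and the remaining
integral at most 1/(ta) - 1/(tb), so the total is at most 2/(ta). -/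
lemma abs_integral_sin_div_le_of_ge {t a b : ℝ} (ht : 0 < t) (ha : 1 ≤ t * a) (hab : a ≤ b) :
    |∫ r in a..b, Real.sin (t * r) / r| ≤ 2 := by
  have ha0 : 0 < a := by
    by_contra h
    nlinarith [not_lt.1 h]
  have hne : ∀ r ∈ uIcc a b, r ≠ 0 := fun r hr => by
    rw [uIcc_of_le hab] at hr
    exact (ha0.trans_le hr.1).ne'
  have hF : ∀ r ∈ uIcc a b, HasDerivAt (fun r => -(Real.cos (t * r) / (t * r)))
      (Real.sin (t * r) / r + Real.cos (t * r) / (t * r ^ 2)) r := by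
    intro r hr
    have hr0 := hne r hr
    have h1 : HasDerivAt (fun r => t * r) t r := by simpa using (hasDerivAt_id r).const_mul t
    have h2 := ((h1.cos).div h1 (by positivity)).neg
    refine h2.congr_deriv ?_
    field_simp
    ring
  have hG : ∀ r ∈ uIcc a b, HasDerivAt (fun r => -(1 / (t * r))) (1 / (t * r ^ 2)) r := by
    intro r hr
    have hr0 := hne r hr
    have h1 : HasDerivAt (fun r => t * r) t r := by simpa using (hasDerivAt_id r).const_mul t
    have h2 := ((hasDerivAt_const r (1 : ℝ)).div h1 (by positivity)).neg
    refine h2.congr_deriv ?_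
    field_simp
    ring
  have hi1 := intervalIntegrable_sin_div (t := t) ha0 hab
  have hi2 : IntervalIntegrable (fun r => Real.cos (t * r) / (t * r ^ 2)) volume a b := by
    refine ContinuousOn.intervalIntegrable (ContinuousOn.div (by fun_prop) (by fun_prop) ?_)
    intro r hr
    have := hne r hr
    positivity
  have hi3 : IntervalIntegrable (fun r => 1 / (t * r ^ 2)) volume a b := by
    refine ContinuousOn.intervalIntegrable (ContinuousOn.div (by fun_prop) (by fun_prop) ?_)
    intro r hr
    have := hne r hr
    positivity
  have e1 := intervalIntegral.integral_eq_sub_of_hasDerivAt hF (hi1.add hi2)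
  have e2 := intervalIntegral.integral_eq_sub_of_hasDerivAt hG hi3
  rw [intervalIntegral.integral_add hi1 hi2] at e1
  have e3 : |∫ r in a..b, Real.cos (t * r) / (t * r ^ 2)| ≤ ∫ r in a..b, 1 / (t * r ^ 2) := by
    rw [← Real.norm_eq_abs]
    refine intervalIntegral.norm_integral_le_of_norm_le hab (ae_of_all _ fun r hr => ?_) hi3
    have hr0 : 0 < r := ha0.trans hr.1
    rw [Real.norm_eq_abs, abs_div, abs_of_pos (by positivity : 0 < t * r ^ 2)]
    gcongr
    exact Real.abs_cos_le_one _
  have hb0 : 0 < b := ha0.trans_le hab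
  have hcos : ∀ r : ℝ, 0 < r → |Real.cos (t * r) / (t * r)| ≤ 1 / (t * r) := fun r hr => by
    rw [abs_div, abs_of_pos (by positivity : 0 < t * r)]
    gcongr
    exact Real.abs_cos_le_one _
  have h1 := abs_le.1 (hcos a ha0)
  have h2 := abs_le.1 (hcos b hb0)
  have h3 : 1 / (t * a) ≤ 1 := by rw [div_le_one (by positivity)]; exact ha
  rw [e2] at e3
  have h4 := abs_le.1 e3
  rw [abs_le]
  constructor <;> linarith [h1.1, h1.2, h2.1, h2.2, h4.1, h4.2]

/-- Uniform boundedness of the sine integral. -/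
lemma abs_integral_sin_div_le (t : ℝ) {a b : ℝ} (ha : 0 < a) (hab : a ≤ b) :
    |∫ r in a..b, Real.sin (t * r) / r| ≤ 3 := by
  have key : ∀ t : ℝ, 0 < t → |∫ r in a..b, Real.sin (t * r) / r| ≤ 3 := by
    intro t ht
    rcases le_or_gt (t * b) 1 with hb | hb
    · exact (abs_integral_sin_div_le_of_le ht ha hab hb).trans (by norm_num)
    rcases le_or_gt 1 (t * a) with ha1 | ha1
    · exact (abs_integral_sin_div_le_of_ge ht ha1 hab).trans (by norm_num)
    -- Here 1/t separates a from b: below it |sin x| ≤ |x| suffices, above it the oscillation is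
    -- used. The bound 3 is 1 + 2.
    have htt : t * (1 / t) = 1 := by field_simp
    have hac : a ≤ 1 / t := by rw [le_div_iff₀ ht]; linarith
    have hcb : 1 / t ≤ b := by rw [div_le_iff₀ ht]; linarith
    have hc : 0 < 1 / t := by positivity
    rw [← intervalIntegral.integral_add_adjacent_intervals
      (intervalIntegrable_sin_div ha hac) (intervalIntegrable_sin_div hc hcb)]
    refine (abs_add_le _ _).trans ?_
    have h1 := abs_integral_sin_div_le_of_le ht ha hac htt.le
    have h2 := abs_integral_sin_div_le_of_ge ht htt.ge hcb
    linarith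
  rcases lt_trichotomy t 0 with ht | rfl | ht
  · have := key (-t) (by linarith)
    simpa [Real.sin_neg, neg_div, intervalIntegral.integral_neg] using this
  · simp
  · exact key t ht

/-- The truncation of `1 / r` to `α < |r| < μ`. -/
def truncInv (α μ : ℝ) : ℝ → ℝ := {r | α < |r| ∧ |r| < μ}.indicator fun r => 1 / r

lemma measurableSet_truncInv (α μ : ℝ) : MeasurableSet {r : ℝ | α < |r| ∧ |r| < μ} :=
  (measurableSet_lt measurable_const measurable_norm).inter
    (measurableSet_lt measurable_norm measurable_const)

lemma truncInv_neg (α μ r : ℝ) : truncInv α μ (-r) = -truncInv α μ r := by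
  unfold truncInv
  by_cases h : α < |r| ∧ |r| < μ
  · rw [indicator_of_mem (by simpa using h), indicator_of_mem (by simpa using h), one_div, one_div,
      inv_neg]
  · rw [indicator_of_notMem (by simpa using h), indicator_of_notMem (by simpa using h), neg_zero]

lemma integrable_truncInv {α : ℝ} (hα : 0 < α) (μ : ℝ) : Integrable (truncInv α μ) := by
  unfold truncInv
  rw [integrable_indicator_iff (measurableSet_truncInv α μ)]
  refine Measure.integrableOn_of_bounded (M := 1 / α) ?_
    (by fun_prop) ?_
  · refine ne_top_of_le_ne_top (b := volume (Icc (-μ) μ)) (by simp) (measure_mono ?_)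
    intro r hr
    exact abs_le.1 hr.2.le
  · refine (ae_restrict_iff' (measurableSet_truncInv α μ)).2 (ae_of_all _ fun r hr => ?_)
    rw [norm_div, norm_one, Real.norm_eq_abs]
    exact one_div_le_one_div_of_le hα hr.1.le

/-- The kernel is odd, so only the sine part of the exponential survives, and its integral is twice
the integral over the half line; hence 6 = 2 · 3. -/
lemma norm_integral_exp_mul_truncInv_le {α : ℝ} (hα : 0 < α) (μ τ : ℝ) :
    ‖∫ r, Complex.exp (-Complex.I * ((τ * r : ℝ) : ℂ)) * (truncInv α μ r : ℂ)‖ ≤ 6 := by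
  have hint : ∀ τ : ℝ, Integrable
      (fun r => Complex.exp (-Complex.I * ((τ * r : ℝ) : ℂ)) * (truncInv α μ r : ℂ)) := by
    intro τ
    refine (integrable_truncInv hα μ).ofReal.bdd_mul (c := 1) ?_ ?_
    · exact Continuous.aestronglyMeasurable (by fun_prop)
    · exact ae_of_all _ fun r => (norm_exp_neg_I_mul _).le
  have hflip : ∫ r, Complex.exp (-Complex.I * ((τ * r : ℝ) : ℂ)) * (truncInv α μ r : ℂ) =
      -∫ r, Complex.exp (-Complex.I * ((-τ * r : ℝ) : ℂ)) * (truncInv α μ r : ℂ) := by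
    rw [← integral_neg_eq_self, ← integral_neg]
    refine integral_congr_ae (ae_of_all _ fun r => ?_)
    simp only
    rw [truncInv_neg]
    push_cast
    ring_nf
  have hsin : 2 * ∫ r, Complex.exp (-Complex.I * ((τ * r : ℝ) : ℂ)) * (truncInv α μ r : ℂ) =
      -2 * Complex.I * ((∫ r, Real.sin (τ * r) * truncInv α μ r : ℝ) : ℂ) := by
    rw [two_mul]
    nth_rewrite 2 [hflip]
    rw [← sub_eq_add_neg, ← integral_sub (hint τ) (hint (-τ)), ← integral_complex_ofReal,
      ← integral_const_mul]
    refine integral_congr_ae (ae_of_all _ fun r => ?_)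
    simp only
    have h1 : Complex.exp (-Complex.I * ((τ * r : ℝ) : ℂ)) =
        Complex.cos (τ * r) - Complex.sin (τ * r) * Complex.I := by
      rw [show -Complex.I * ((τ * r : ℝ) : ℂ) = (-(τ * r : ℂ)) * Complex.I by push_cast; ring,
        Complex.exp_mul_I, Complex.cos_neg, Complex.sin_neg]
      ring
    have h2 : Complex.exp (-Complex.I * ((-τ * r : ℝ) : ℂ)) =
        Complex.cos (τ * r) + Complex.sin (τ * r) * Complex.I := by
      rw [show -Complex.I * ((-τ * r : ℝ) : ℂ) = (τ * r : ℂ) * Complex.I by push_cast; ring,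
        Complex.exp_mul_I]
    rw [h1, h2]
    push_cast
    ring
  have heven : ∫ r, Real.sin (τ * r) * truncInv α μ r =
      2 * ∫ r in Ioi (0 : ℝ), Real.sin (τ * r) * truncInv α μ r := by
    rw [← integral_comp_abs (f := fun r => Real.sin (τ * r) * truncInv α μ r)]
    refine integral_congr_ae (ae_of_all _ fun r => ?_)
    rcases abs_choice r with h | h
    · simp only [h]
    · simp only [h]
      rw [truncInv_neg, mul_neg τ, Real.sin_neg]
      ring
  have hval : |∫ r in Ioi (0 : ℝ), Real.sin (τ * r) * truncInv α μ r| ≤ 3 := by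
    rcases le_or_gt μ α with hμ | hμ
    · have h0 : ∀ r, truncInv α μ r = 0 := fun r =>
        indicator_of_notMem (fun hr => by linarith [hr.1, hr.2]) _
      simp [h0]
    · have h1 : ∫ r in Ioi (0 : ℝ), Real.sin (τ * r) * truncInv α μ r =
          ∫ r in α..μ, Real.sin (τ * r) / r := by
        rw [intervalIntegral.integral_of_le hμ.le, integral_Ioc_eq_integral_Ioo,
          ← integral_indicator measurableSet_Ioi, ← integral_indicator measurableSet_Ioo]
        refine integral_congr_ae (ae_of_all _ fun r => ?_)
        simp only [indicator, mem_Ioi, mem_Ioo, truncInv, mem_ofPred_eq]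
        by_cases hr : 0 < r
        · rw [abs_of_pos hr]
          split_ifs <;> simp [div_eq_mul_inv]
        · have : ¬(α < r ∧ r < μ) := fun h => by linarith [h.1]
          simp [hr, this]
      rw [h1]
      exact abs_integral_sin_div_le τ hα hμ.le
  have h2 : ‖∫ r, Complex.exp (-Complex.I * ((τ * r : ℝ) : ℂ)) * (truncInv α μ r : ℂ)‖ * 2 ≤
      12 := by
    calc _ = ‖2 * ∫ r, Complex.exp (-Complex.I * ((τ * r : ℝ) : ℂ)) * (truncInv α μ r : ℂ)‖ := by
          rw [norm_mul, mul_comm]; simp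
      _ = 2 * |2 * ∫ r in Ioi (0 : ℝ), Real.sin (τ * r) * truncInv α μ r| := by
          rw [hsin, heven, norm_mul, norm_mul, Complex.norm_real]
          simp
      _ ≤ 12 := by
          rw [abs_mul]
          norm_num
          linarith
  linarith

end Kernels

/-! ### The model kernel μ/(μ² - s²) with its two poles. -/

section KernelBounds

lemma measurableSet_lt_abs_sub_sq (q ε : ℝ) : MeasurableSet {s : ℝ | ε < |q - s ^ 2|} :=
  (isOpen_lt continuous_const (by fun_prop)).measurableSet

lemma integrable_div_sq_add_sq {μ : ℝ} (hμ : 0 < μ) :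
    Integrable (fun s : ℝ => μ / (s ^ 2 + μ ^ 2)) ∧ ∫ s : ℝ, μ / (s ^ 2 + μ ^ 2) = Real.pi := by
  have h : ∀ s : ℝ, μ / (s ^ 2 + μ ^ 2) = μ⁻¹ * (1 + (s / μ) ^ 2)⁻¹ := fun s => by
    field_simp
    ring
  simp_rw [h]
  constructor
  · exact (integrable_inv_one_add_sq.comp_div hμ.ne').const_mul _
  · rw [integral_const_mul, Measure.integral_comp_div (fun s => (1 + s ^ 2)⁻¹) μ,
      integral_univ_inv_one_add_sq, abs_of_pos hμ, smul_eq_mul]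
    field_simp

/-- Pointwise comparison of the truncated kernel `μ / (μ² - s²)` with the truncations of `1 / r`
around the two poles. -/
lemma abs_pv_sub_truncInv_le {μ ε : ℝ} (hμ : 0 < μ) (hε : 0 < ε) (s : ℝ) :
    |{s : ℝ | ε < |μ ^ 2 - s ^ 2|}.indicator (fun s => μ / (μ ^ 2 - s ^ 2)) s
      - (1 / 2 * truncInv (ε / μ) μ (μ - s) + 1 / 2 * truncInv (ε / μ) μ (μ + s))| ≤
    4 * (μ / (s ^ 2 + μ ^ 2)) + 3 * μ / (2 * ε) * ((Icc (μ - ε / μ) (μ + ε / μ)).indicator 1 s +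
      (Icc (-μ - ε / μ) (-μ + ε / μ)).indicator 1 s) := by
  -- The reflection s ↦ -s exchanges the two poles and the two intervals around them.
  wlog hs : 0 ≤ s generalizing s
  · have := this (-s) (by linarith)
    have e1 : (Icc (μ - ε / μ) (μ + ε / μ)).indicator (1 : ℝ → ℝ) (-s) =
        (Icc (-μ - ε / μ) (-μ + ε / μ)).indicator 1 s := by
      simp only [indicator, mem_Icc]
      congr 1
      exact propext ⟨fun h => ⟨by linarith [h.2], by linarith [h.1]⟩,
        fun h => ⟨by linarith [h.2], by linarith [h.1]⟩⟩
    have e2 : (Icc (-μ - ε / μ) (-μ + ε / μ)).indicator (1 : ℝ → ℝ) (-s) =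
        (Icc (μ - ε / μ) (μ + ε / μ)).indicator 1 s := by
      simp only [indicator, mem_Icc]
      congr 1
      exact propext ⟨fun h => ⟨by linarith [h.2], by linarith [h.1]⟩,
        fun h => ⟨by linarith [h.2], by linarith [h.1]⟩⟩
    rw [e1, e2, sub_neg_eq_add, ← sub_eq_add_neg] at this
    simp only [indicator, mem_ofPred_eq, neg_sq] at this ⊢
    rw [add_comm (1 / 2 * truncInv (ε / μ) μ (μ - s))]
    linarith
  have hα : 0 < ε / μ := by positivity
  have hαμ : ε / μ * μ = ε := by field_simp
  -- The outer cutoff at distance μ keeps the two truncations of 1/r from overlapping: for s ≥ 0 the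
  -- one centred at -μ is switched off.
  have hg2 : truncInv (ε / μ) μ (μ + s) = 0 :=
    indicator_of_notMem (fun h => by
      have := h.2
      rw [abs_of_pos (by linarith)] at this
      linarith) _
  have hI : 0 ≤ (Icc (-μ - ε / μ) (-μ + ε / μ)).indicator (1 : ℝ → ℝ) s :=
    indicator_nonneg (fun _ _ => zero_le_one) _
  have hI' : 0 ≤ (Icc (μ - ε / μ) (μ + ε / μ)).indicator (1 : ℝ → ℝ) s :=
    indicator_nonneg (fun _ _ => zero_le_one) _
  have hc : 0 < 3 * μ / (2 * ε) := by positivity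
  have hD : 0 < μ / (s ^ 2 + μ ^ 2) := by positivity
  rw [hg2, mul_zero, add_zero]
  rcases hs.eq_or_lt with rfl | hs0
  · have h1 : truncInv (ε / μ) μ (μ - 0) = 0 :=
      indicator_of_notMem (fun h => by
        have := h.2
        rw [abs_of_pos (by linarith)] at this
        linarith) _
    have h2 : |{s : ℝ | ε < |μ ^ 2 - s ^ 2|}.indicator (fun s => μ / (μ ^ 2 - s ^ 2)) 0| ≤
        μ / (0 ^ 2 + μ ^ 2) := by
      refine (norm_indicator_le_norm_self (fun s => μ / (μ ^ 2 - s ^ 2)) 0).trans_eq ?_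
      rw [Real.norm_eq_abs, abs_of_pos (by simpa using (by positivity : 0 < μ / μ ^ 2))]
      simp
    rw [h1, mul_zero, sub_zero]
    nlinarith
  -- Beyond 2μ both truncations of 1/r vanish and the kernel itself is of size μ/s².
  rcases le_or_gt (2 * μ) s with hs2 | hs2
  · have h1 : truncInv (ε / μ) μ (μ - s) = 0 :=
      indicator_of_notMem (fun h => by
        have := h.2
        rw [abs_of_neg (by linarith)] at this
        linarith) _
    have h3 : 0 < s ^ 2 - μ ^ 2 := by nlinarith
    have h2 : |{s : ℝ | ε < |μ ^ 2 - s ^ 2|}.indicator (fun s => μ / (μ ^ 2 - s ^ 2)) s| ≤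
        4 * (μ / (s ^ 2 + μ ^ 2)) := by
      refine (norm_indicator_le_norm_self (fun s => μ / (μ ^ 2 - s ^ 2)) s).trans ?_
      rw [Real.norm_eq_abs, abs_div, abs_of_pos hμ, abs_sub_comm, abs_of_pos h3, ← mul_div_assoc,
        div_le_div_iff₀ h3 (by positivity)]
      have h4 : 5 * μ ^ 2 ≤ 3 * s ^ 2 := by nlinarith
      nlinarith
    rw [h1, mul_zero, sub_zero]
    nlinarith
  rcases eq_or_ne s μ with rfl | hne
  · have h1 : truncInv (ε / s) s (s - s) = 0 :=
      indicator_of_notMem (fun h => by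
        have := h.1
        simp only [sub_self, abs_zero] at this
        linarith) _
    have h2 : {r : ℝ | ε < |s ^ 2 - r ^ 2|}.indicator (fun r => s / (s ^ 2 - r ^ 2)) s = 0 :=
      indicator_of_notMem (fun h => by
        have h : ε < |s ^ 2 - s ^ 2| := h
        simp only [sub_self, abs_zero] at h
        linarith) _
    rw [h1, h2, mul_zero, sub_zero, abs_zero]
    positivity
  have hne' : μ - s ≠ 0 := sub_ne_zero.2 hne.symm
  have hps : 0 < μ + s := by linarith
  have habs : |μ ^ 2 - s ^ 2| = |μ - s| * (μ + s) := by
    rw [show μ ^ 2 - s ^ 2 = (μ - s) * (μ + s) by ring, abs_mul, abs_of_pos hps]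
  -- On 0 < s < 2μ only the first fraction is singular; the second is absorbed by the integrable
  -- majorant.
  have hpf : μ / (μ ^ 2 - s ^ 2) = 1 / 2 * (1 / (μ - s)) + 1 / 2 * (1 / (μ + s)) := by
    rw [show μ ^ 2 - s ^ 2 = (μ - s) * (μ + s) by ring]
    field_simp
    ring
  have hsec : |1 / 2 * (1 / (μ + s))| ≤ 4 * (μ / (s ^ 2 + μ ^ 2)) := by
    rw [abs_of_pos (by positivity), ← mul_div_assoc, ← mul_div_assoc,
      div_le_div_iff₀ hps (by positivity)]
    nlinarith
  have hlt : |μ - s| < μ := abs_lt.2 ⟨by linarith, by linarith⟩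
  -- As μ + s > μ, distance more than ε/μ from the pole forces |μ² - s²| > ε, so both cutoffs are
  -- inactive and the singular parts cancel exactly.
  rcases lt_or_ge (ε / μ) |μ - s| with hcase | hcase
  · have h1 : truncInv (ε / μ) μ (μ - s) = 1 / (μ - s) := indicator_of_mem (s := {r | _ < |r| ∧ |r| < _}) ⟨hcase, hlt⟩ _
    have h2 : {s : ℝ | ε < |μ ^ 2 - s ^ 2|}.indicator (fun s => μ / (μ ^ 2 - s ^ 2)) s =
        μ / (μ ^ 2 - s ^ 2) := by
      refine indicator_of_mem ?_ _
      change ε < |μ ^ 2 - s ^ 2|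
      rw [habs]
      nlinarith
    rw [h1, h2, hpf, add_sub_cancel_left]
    nlinarith
  · have h1 : truncInv (ε / μ) μ (μ - s) = 0 :=
      indicator_of_notMem (fun h => not_lt.2 hcase h.1) _
    have h3 : (Icc (μ - ε / μ) (μ + ε / μ)).indicator (1 : ℝ → ℝ) s = 1 := by
      refine indicator_of_mem ?_ _
      have := abs_le.1 hcase
      exact ⟨by linarith [this.2], by linarith [this.1]⟩
    rw [h1, mul_zero, sub_zero, h3]
    by_cases hmem : ε < |μ ^ 2 - s ^ 2|
    · rw [indicator_of_mem (s := {s : ℝ | ε < |μ ^ 2 - s ^ 2|}) hmem, hpf]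
      refine (abs_add_le _ _).trans ?_
      -- The two cutoffs disagree here. From μ + s < 3μ and |μ² - s²| > ε one gets |μ - s| > ε/(3μ).
      have hfirst : |1 / 2 * (1 / (μ - s))| ≤ 3 * μ / (2 * ε) := by
        have hpos : 0 < |μ - s| := abs_pos.2 hne'
        rw [abs_mul, abs_of_pos (by norm_num : (0 : ℝ) < 1 / 2), abs_div, abs_one, ← mul_div_assoc,
          div_le_div_iff₀ hpos (by positivity)]
        rw [habs] at hmem
        nlinarith
      nlinarith
    · rw [indicator_of_notMem (s := {s : ℝ | ε < |μ ^ 2 - s ^ 2|}) hmem, abs_zero]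
      positivity

/-- The Fourier transform of the truncated kernel `μ / (μ² - s²)` is bounded, uniformly in the
truncation. -/
lemma norm_integral_exp_mul_pv_le {μ ε : ℝ} (hμ : 0 < μ) (hε : 0 < ε) (t : ℝ) :
    Integrable ({s : ℝ | ε < |μ ^ 2 - s ^ 2|}.indicator fun s => μ / (μ ^ 2 - s ^ 2)) ∧
    ‖∫ s, Complex.exp (-Complex.I * ((t * s : ℝ) : ℂ)) *
      (({s : ℝ | ε < |μ ^ 2 - s ^ 2|}.indicator (fun s => μ / (μ ^ 2 - s ^ 2)) s : ℝ) : ℂ)‖ ≤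
      25 := by
  have hα : 0 < ε / μ := by positivity
  set k : ℝ → ℝ := {s : ℝ | ε < |μ ^ 2 - s ^ 2|}.indicator (fun s => μ / (μ ^ 2 - s ^ 2)) with hk
  set k₀ : ℝ → ℝ := fun s =>
    1 / 2 * truncInv (ε / μ) μ (μ - s) + 1 / 2 * truncInv (ε / μ) μ (μ + s) with hk₀
  set D : ℝ → ℝ := fun s => 4 * (μ / (s ^ 2 + μ ^ 2)) +
    3 * μ / (2 * ε) * ((Icc (μ - ε / μ) (μ + ε / μ)).indicator 1 s +
      (Icc (-μ - ε / μ) (-μ + ε / μ)).indicator 1 s) with hD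
  have hI : ∀ a b : ℝ, Integrable ((Icc a b).indicator (1 : ℝ → ℝ)) := fun a b =>
    (integrable_indicator_iff measurableSet_Icc).2 (by
      change IntegrableOn (fun _ => (1 : ℝ)) _ _
      exact integrableOn_const (by simp))
  have hDi : Integrable D :=
    ((integrable_div_sq_add_sq hμ).1.const_mul 4).add (((hI _ _).add (hI _ _)).const_mul _)
  -- The 6 is 3μ/(2ε) times the total length 4ε/μ of the two intervals: the mismatch of the cutoffs
  -- has mass independent of ε and μ.
  have hDint : ∫ s, D s = 4 * Real.pi + 6 := by
    have hIv : ∀ a b : ℝ, a ≤ b → ∫ s, (Icc a b).indicator (1 : ℝ → ℝ) s = b - a := by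
      intro a b hab
      rw [integral_indicator_one measurableSet_Icc, Real.volume_real_Icc_of_le hab]
    refine (integral_add ((integrable_div_sq_add_sq hμ).1.const_mul 4)
      (((hI _ _).add (hI _ _)).const_mul _)).trans ?_
    simp only [Pi.add_apply]
    rw [integral_const_mul, integral_const_mul,
      (integrable_div_sq_add_sq hμ).2, integral_add (hI _ _) (hI _ _), hIv _ _ (by linarith),
      hIv _ _ (by linarith)]
    field_simp
    ring
  have hgi := integrable_truncInv hα μ
  have hk₀i : Integrable k₀ :=
    ((hgi.comp_sub_left μ).const_mul _).add ((hgi.comp_add_left μ).const_mul _)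
  have hkm : AEStronglyMeasurable k volume :=
    (Measurable.indicator (by fun_prop) (measurableSet_lt_abs_sub_sq _ _)).aestronglyMeasurable
  have hsub : Integrable (fun s => k s - k₀ s) :=
    hDi.mono' (hkm.sub hk₀i.1) (ae_of_all _ fun s => abs_pv_sub_truncInv_le hμ hε s)
  have hki : Integrable k := by
    have := hsub.add hk₀i
    refine this.congr (ae_of_all _ fun s => ?_)
    simp
  refine ⟨hki, ?_⟩
  have hexp : ∀ {f : ℝ → ℝ}, Integrable f →
      Integrable (fun s => Complex.exp (-Complex.I * ((t * s : ℝ) : ℂ)) * (f s : ℂ)) := by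
    intro f hf
    refine hf.ofReal.bdd_mul (c := 1) ?_ ?_
    · exact Continuous.aestronglyMeasurable (by fun_prop)
    · exact ae_of_all _ fun r => (norm_exp_neg_I_mul _).le
  have hsplit : ∫ s, Complex.exp (-Complex.I * ((t * s : ℝ) : ℂ)) * (k s : ℂ) =
      (∫ s, Complex.exp (-Complex.I * ((t * s : ℝ) : ℂ)) * ((k s - k₀ s : ℝ) : ℂ)) +
      ∫ s, Complex.exp (-Complex.I * ((t * s : ℝ) : ℂ)) * (k₀ s : ℂ) := by
    rw [← integral_add (hexp hsub) (hexp hk₀i)]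
    refine integral_congr_ae (ae_of_all _ fun s => ?_)
    simp only
    push_cast
    ring
  have h1 : ‖∫ s, Complex.exp (-Complex.I * ((t * s : ℝ) : ℂ)) * ((k s - k₀ s : ℝ) : ℂ)‖ ≤
      4 * Real.pi + 6 := by
    rw [← hDint]
    refine norm_integral_le_of_norm_le hDi (ae_of_all _ fun s => ?_)
    rw [norm_mul, norm_exp_neg_I_mul, one_mul, Complex.norm_real]
    exact abs_pv_sub_truncInv_le hμ hε s
  have h2 : ‖∫ s, Complex.exp (-Complex.I * ((t * s : ℝ) : ℂ)) * (k₀ s : ℂ)‖ ≤ 6 := by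
    have e1 : ∫ s, Complex.exp (-Complex.I * ((t * s : ℝ) : ℂ)) *
        (truncInv (ε / μ) μ (μ - s) : ℂ) = Complex.exp (-Complex.I * ((t * μ : ℝ) : ℂ)) *
          ∫ r, Complex.exp (-Complex.I * ((-t * r : ℝ) : ℂ)) * (truncInv (ε / μ) μ r : ℂ) := by
      rw [← integral_sub_left_eq_self _ volume μ, ← integral_const_mul]
      refine integral_congr_ae (ae_of_all _ fun s => ?_)
      simp only
      rw [← mul_assoc, ← Complex.exp_add, sub_sub_cancel]
      congr 2
      push_cast
      ring
    have e2 : ∫ s, Complex.exp (-Complex.I * ((t * s : ℝ) : ℂ)) *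
        (truncInv (ε / μ) μ (μ + s) : ℂ) = Complex.exp (-Complex.I * ((-t * μ : ℝ) : ℂ)) *
          ∫ r, Complex.exp (-Complex.I * ((t * r : ℝ) : ℂ)) * (truncInv (ε / μ) μ r : ℂ) := by
      rw [← integral_const_mul, ← integral_add_left_eq_self (fun r =>
        Complex.exp (-Complex.I * ((-t * μ : ℝ) : ℂ)) *
          (Complex.exp (-Complex.I * ((t * r : ℝ) : ℂ)) * (truncInv (ε / μ) μ r : ℂ))) μ]
      refine integral_congr_ae (ae_of_all _ fun s => ?_)
      simp only
      rw [← mul_assoc, ← Complex.exp_add]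
      congr 2
      push_cast
      ring
    have e3 : ∫ s, Complex.exp (-Complex.I * ((t * s : ℝ) : ℂ)) * (k₀ s : ℂ) =
        1 / 2 * (∫ s, Complex.exp (-Complex.I * ((t * s : ℝ) : ℂ)) *
          (truncInv (ε / μ) μ (μ - s) : ℂ)) +
        1 / 2 * ∫ s, Complex.exp (-Complex.I * ((t * s : ℝ) : ℂ)) *
          (truncInv (ε / μ) μ (μ + s) : ℂ) := by
      rw [← integral_const_mul, ← integral_const_mul,
        ← integral_add ((hexp (hgi.comp_sub_left μ)).const_mul _)
          ((hexp (hgi.comp_add_left μ)).const_mul _)]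
      refine integral_congr_ae (ae_of_all _ fun s => ?_)
      simp only [hk₀]
      push_cast
      ring
    rw [e3, e1, e2]
    refine (norm_add_le _ _).trans ?_
    rw [norm_mul, norm_mul, norm_mul, norm_mul, norm_exp_neg_I_mul, norm_exp_neg_I_mul]
    have g1 := norm_integral_exp_mul_truncInv_le hα μ (-t)
    have g2 := norm_integral_exp_mul_truncInv_le hα μ t
    have g3 : ‖(1 / 2 : ℂ)‖ = 1 / 2 := by simp
    rw [g3]
    linarith
  rw [hsplit]
  refine (norm_add_le _ _).trans ?_
  -- The total is 4π + 6 from the majorant plus 6 from the two half-weighted truncations of 1/r,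
  -- which is below 25.
  linarith [Real.pi_lt_d2]

end KernelBounds

/-! ### One-dimensional kernels of the weighted multipliers. -/

section MultiplierKernels

/-- `k` is integrable and its Fourier transform is bounded by `A`. -/
def HasKernelBound (k : ℝ → ℝ) (A : ℝ) : Prop :=
  Integrable k ∧ ∀ t : ℝ, ‖∫ s, Complex.exp (-Complex.I * ((t * s : ℝ) : ℂ)) * (k s : ℂ)‖ ≤ A

lemma hasKernelBound_of_abs_le {k D : ℝ → ℝ} {A : ℝ} (hk : AEStronglyMeasurable k volume)
    (hD : Integrable D) (h : ∀ s, |k s| ≤ D s) (hA : ∫ s, D s ≤ A) : HasKernelBound k A := by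
  refine ⟨hD.mono' hk (ae_of_all _ h), fun t => le_trans ?_ hA⟩
  refine norm_integral_le_of_norm_le hD (ae_of_all _ fun s => ?_)
  rw [norm_mul, norm_exp_neg_I_mul, one_mul, Complex.norm_real]
  exact h s

lemma HasKernelBound.mono {k : ℝ → ℝ} {A A' : ℝ} (h : HasKernelBound k A) (hA : A ≤ A') :
    HasKernelBound k A' :=
  ⟨h.1, fun t => (h.2 t).trans hA⟩

lemma HasKernelBound.add {k l : ℝ → ℝ} {A A' : ℝ} (hk : HasKernelBound k A)
    (hl : HasKernelBound l A') : HasKernelBound (fun s => k s + l s) (A + A') := by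
  have hexp : ∀ {f : ℝ → ℝ} (t : ℝ), Integrable f →
      Integrable (fun s => Complex.exp (-Complex.I * ((t * s : ℝ) : ℂ)) * (f s : ℂ)) := by
    intro f t hf
    refine hf.ofReal.bdd_mul (c := 1) ?_ ?_
    · exact Continuous.aestronglyMeasurable (by fun_prop)
    · exact ae_of_all _ fun r => (norm_exp_neg_I_mul _).le
  refine ⟨hk.1.add hl.1, fun t => ?_⟩
  simp only [Complex.ofReal_add, mul_add]
  rw [integral_add (hexp t hk.1) (hexp t hl.1)]
  exact (norm_add_le _ _).trans (add_le_add (hk.2 t) (hl.2 t))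

lemma HasKernelBound.const_mul {k : ℝ → ℝ} {A : ℝ} (hk : HasKernelBound k A) (c : ℝ) :
    HasKernelBound (fun s => c * k s) (|c| * A) := by
  refine ⟨hk.1.const_mul c, fun t => ?_⟩
  have h : ∀ s : ℝ, Complex.exp (-Complex.I * ((t * s : ℝ) : ℂ)) * ((c * k s : ℝ) : ℂ) =
      c * (Complex.exp (-Complex.I * ((t * s : ℝ) : ℂ)) * (k s : ℂ)) := fun s => by
    push_cast
    ring
  simp_rw [h]
  rw [integral_const_mul, norm_mul, Complex.norm_real, Real.norm_eq_abs]
  exact mul_le_mul_of_nonneg_left (hk.2 t) (abs_nonneg c)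

lemma HasKernelBound.congr_ae {k l : ℝ → ℝ} {A : ℝ} (hk : HasKernelBound k A)
    (h : k =ᵐ[volume] l) : HasKernelBound l A := by
  refine ⟨hk.1.congr h, fun t => ?_⟩
  rw [← integral_congr_ae (f := fun s => Complex.exp (-Complex.I * ((t * s : ℝ) : ℂ)) * (k s : ℂ))]
  · exact hk.2 t
  · filter_upwards [h] with s hs
    rw [hs]

/-- The multiplier `ξ_i² |ξ|⁻² (lam² - |ξ|²)⁻¹`, truncated to `|lam² - |ξ|²| > ε`, as a function of
`s = ξ_i` when the norm `ρ` of the other coordinates is fixed. -/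
lemma hasKernelBound_resolvent {lam ε : ℝ} (hlam : 0 < lam) (hε : 0 < ε) (ρ : ℝ) :
    HasKernelBound ({s : ℝ | ε < |lam ^ 2 - (s ^ 2 + ρ ^ 2)|}.indicator
      fun s => s ^ 2 / (s ^ 2 + ρ ^ 2) * (lam ^ 2 - (s ^ 2 + ρ ^ 2))⁻¹) (30 / lam) := by
  have hset : MeasurableSet {s : ℝ | ε < |lam ^ 2 - (s ^ 2 + ρ ^ 2)|} :=
    (isOpen_lt continuous_const (by fun_prop)).measurableSet
  have hDi : Integrable (fun s : ℝ => 1 / lam * (lam / (s ^ 2 + lam ^ 2))) :=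
    (integrable_div_sq_add_sq hlam).1.const_mul _
  have hDint : ∫ s : ℝ, 1 / lam * (lam / (s ^ 2 + lam ^ 2)) ≤ 4 / lam := by
    rw [integral_const_mul, (integrable_div_sq_add_sq hlam).2, one_div_mul_eq_div]
    gcongr
    exact Real.pi_le_four
  have hDeq : ∀ s : ℝ, 1 / lam * (lam / (s ^ 2 + lam ^ 2)) = 1 / (s ^ 2 + lam ^ 2) := fun s => by
    field_simp
  -- If λ ≤ |ρ| there is no pole off s = 0: the weight s² is at most s² + ρ² - λ², so the product is
  -- bounded by 1/(s² + λ²).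
  rcases le_or_gt (lam ^ 2 - ρ ^ 2) 0 with hq | hq
  · refine HasKernelBound.mono (hasKernelBound_of_abs_le (D := fun s =>
      1 / lam * (lam / (s ^ 2 + lam ^ 2))) ?_ hDi (fun s => ?_) hDint) (by gcongr; norm_num)
    · exact (Measurable.indicator (by fun_prop) hset).aestronglyMeasurable
    · rw [hDeq]
      refine (norm_indicator_le_norm_self
        (fun s => s ^ 2 / (s ^ 2 + ρ ^ 2) * (lam ^ 2 - (s ^ 2 + ρ ^ 2))⁻¹) s).trans ?_
      rw [Real.norm_eq_abs, abs_mul, abs_inv, abs_of_nonneg (by positivity)]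
      rcases eq_or_ne s 0 with rfl | hs
      · simp only [ne_eq, OfNat.ofNat_ne_zero, not_false_eq_true, zero_pow, zero_div, zero_mul]
        positivity
      have hs2 : 0 < s ^ 2 := by positivity
      rw [abs_of_neg (by linarith), ← div_eq_mul_inv, div_div, div_le_div_iff₀]
      · have h1 : s ^ 2 + lam ^ 2 ≤ s ^ 2 + ρ ^ 2 := by linarith
        have h2 : s ^ 2 ≤ -(lam ^ 2 - (s ^ 2 + ρ ^ 2)) := by linarith
        calc s ^ 2 * (s ^ 2 + lam ^ 2)
            ≤ -(lam ^ 2 - (s ^ 2 + ρ ^ 2)) * (s ^ 2 + ρ ^ 2) := by gcongr; linarith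
          _ = _ := by ring
      · exact mul_pos (by positivity) (by linarith)
      · positivity
  · set μ := Real.sqrt (lam ^ 2 - ρ ^ 2) with hμdef
    have hμ : 0 < μ := Real.sqrt_pos.2 hq
    have hμ2 : μ ^ 2 = lam ^ 2 - ρ ^ 2 := Real.sq_sqrt hq.le
    have hset_eq : {s : ℝ | ε < |lam ^ 2 - (s ^ 2 + ρ ^ 2)|} = {s : ℝ | ε < |μ ^ 2 - s ^ 2|} := by
      ext s
      change ε < |lam ^ 2 - (s ^ 2 + ρ ^ 2)| ↔ ε < |μ ^ 2 - s ^ 2|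
      rw [hμ2, show lam ^ 2 - ρ ^ 2 - s ^ 2 = lam ^ 2 - (s ^ 2 + ρ ^ 2) by ring]
    have h1 : HasKernelBound ({s : ℝ | ε < |μ ^ 2 - s ^ 2|}.indicator
        fun s => μ / (μ ^ 2 - s ^ 2)) 25 :=
      ⟨(norm_integral_exp_mul_pv_le hμ hε 0).1, fun t => (norm_integral_exp_mul_pv_le hμ hε t).2⟩
    have h2 : HasKernelBound ({s : ℝ | ε < |lam ^ 2 - (s ^ 2 + ρ ^ 2)|}.indicator
        fun s => -(ρ ^ 2 / lam ^ 2 / (s ^ 2 + ρ ^ 2))) (4 / lam) := by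
      refine hasKernelBound_of_abs_le (D := fun s => 1 / lam * (lam / (s ^ 2 + lam ^ 2))) ?_ hDi
        (fun s => ?_) hDint
      · exact (Measurable.indicator (by fun_prop) hset).aestronglyMeasurable
      · rw [hDeq]
        refine (norm_indicator_le_norm_self
          (fun s => -(ρ ^ 2 / lam ^ 2 / (s ^ 2 + ρ ^ 2))) s).trans ?_
        rw [norm_neg, Real.norm_eq_abs, abs_of_nonneg (by positivity), div_div]
        rcases eq_or_ne ρ 0 with rfl | hρ
        · simp only [ne_eq, OfNat.ofNat_ne_zero, not_false_eq_true, zero_pow, zero_div]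
          positivity
        rw [div_le_div_iff₀ (by positivity) (by positivity)]
        nlinarith [sq_nonneg s]
    -- Partial fractions in s²: s²/((s² + ρ²)(μ² - s²)) = (μ/λ²) · μ/(μ² - s²) - (ρ²/λ²)/(s² + ρ²),
    -- using λ² = μ² + ρ².
    have h3 := (h1.const_mul (μ / lam ^ 2)).add h2
    have hμlam : μ ≤ lam := by
      refine Real.sqrt_le_iff.2 ⟨hlam.le, ?_⟩
      nlinarith [sq_nonneg ρ]
    refine HasKernelBound.mono (h3.congr_ae ?_) (A' := 30 / lam) ?_
    -- The point s = 0 is discarded because s² + ρ² may vanish there.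
    · have hae : ∀ᵐ s : ℝ, s ≠ 0 := by simp [ae_iff, measure_singleton]
      filter_upwards [hae] with s hs
      rw [hset_eq]
      by_cases hmem : s ∈ {s : ℝ | ε < |μ ^ 2 - s ^ 2|}
      · simp only [indicator_of_mem hmem]
        have hne : μ ^ 2 - s ^ 2 ≠ 0 := fun h0 => by
          have : ε < |μ ^ 2 - s ^ 2| := hmem
          rw [h0, abs_zero] at this
          linarith
        have hsρ : s ^ 2 + ρ ^ 2 ≠ 0 := by positivity
        rw [show lam ^ 2 - (s ^ 2 + ρ ^ 2) = μ ^ 2 - s ^ 2 by rw [hμ2]; ring]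
        have hl : lam ^ 2 = μ ^ 2 + ρ ^ 2 := by rw [hμ2]; ring
        have hlam2 : μ ^ 2 + ρ ^ 2 ≠ 0 := by positivity
        rw [hl]
        field_simp
        ring
      · simp only [indicator_of_notMem hmem]
        simp
    · rw [abs_of_pos (by positivity)]
      have : μ / lam ^ 2 * 25 ≤ 25 / lam := by
        rw [div_mul_eq_mul_div, div_le_div_iff₀ (by positivity) hlam]
        nlinarith [mul_le_mul_of_nonneg_right hμlam hlam.le]
      calc μ / lam ^ 2 * 25 + 4 / lam ≤ 25 / lam + 4 / lam := by gcongr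
        _ = 29 / lam := by ring
        _ ≤ 30 / lam := by gcongr; norm_num

/-- The multiplier `ξ_i² |ξ|⁻²`, truncated to `|lam² - |ξ|²| < ε`, as a function of `s = ξ_i` when
the norm `ρ` of the other coordinates is fixed. -/
lemma hasKernelBound_annulus {lam ε : ℝ} (hlam : 0 < lam) (hε : 0 < ε) (hε' : ε ≤ lam ^ 2 / 2)
    (ρ : ℝ) :
    HasKernelBound ({s : ℝ | |lam ^ 2 - (s ^ 2 + ρ ^ 2)| < ε}.indicator
      fun s => s ^ 2 / (s ^ 2 + ρ ^ 2)) (4 * ε / lam) := by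
  have hset : MeasurableSet {s : ℝ | |lam ^ 2 - (s ^ 2 + ρ ^ 2)| < ε} :=
    (isOpen_lt (by fun_prop) continuous_const).measurableSet
  set q := lam ^ 2 - ρ ^ 2 with hq
  -- `Real.sqrt` is 0 on negative numbers, so [a, b] also covers the cases in which the frozen slice
  -- of the annulus has no inner radius or is empty.
  set a := Real.sqrt (q - ε) with ha
  set b := Real.sqrt (q + ε) with hb
  have hab : a ≤ b := Real.sqrt_le_sqrt (by linarith)
  have ha0 : 0 ≤ a := Real.sqrt_nonneg _
  let D : ℝ → ℝ := fun s => 2 / lam * (Icc a b).indicator (fun s => s) |s|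
  have hDIi : Integrable ((Icc a b).indicator (fun s : ℝ => s)) :=
    (integrable_indicator_iff measurableSet_Icc).2 (continuous_id.integrableOn_Icc)
  have hDi : Integrable D :=
    Integrable.const_mul (by
      have hm : MeasurableSet ((fun s : ℝ => |s|) ⁻¹' Icc a b) := by measurability
      have := (integrable_indicator_iff hm).2 ((continuous_abs.integrableOn_Icc
        (a := -b) (b := b) (μ := volume)).mono_set fun s hs => abs_le.1 hs.2)
      exact this) _
  refine hasKernelBound_of_abs_le (D := D) ?_ hDi (fun s => ?_) ?_
  · exact (Measurable.indicator (by fun_prop) hset).aestronglyMeasurable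
  · by_cases hs : |lam ^ 2 - (s ^ 2 + ρ ^ 2)| < ε
    · rw [indicator_of_mem (s := {s : ℝ | |lam ^ 2 - (s ^ 2 + ρ ^ 2)| < ε}) hs]
      obtain ⟨h1, h2⟩ := abs_lt.1 hs
      have hmem : |s| ∈ Icc a b := by
        constructor
        · rw [ha, Real.sqrt_le_left (abs_nonneg s), sq_abs]; linarith
        · rw [hb]
          refine Real.le_sqrt_of_sq_le ?_
          rw [sq_abs]; linarith
      change _ ≤ 2 / lam * (Icc a b).indicator (fun s => s) |s|
      rw [indicator_of_mem hmem, abs_of_nonneg (by positivity)]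
      have hpos : lam ^ 2 / 2 ≤ s ^ 2 + ρ ^ 2 := by linarith
      have hpos' : 0 < s ^ 2 + ρ ^ 2 := lt_of_lt_of_le (by positivity) hpos
      rw [div_mul_eq_mul_div, div_le_div_iff₀ hpos' hlam, ← sq_abs s]
      -- On the annulus s² + ρ² ≥ λ²/2, so the weight is at most 2|s|/λ. The factor |s| makes the
      -- integral over [a, b] depend only on b² - a² ≤ 2ε and not on the width of the interval.
      have hsl : |s| * lam ≤ 2 * (|s| ^ 2 + ρ ^ 2) := by
        rw [← sq_abs s] at hpos
        nlinarith [sq_nonneg (|s| - lam), sq_nonneg ρ]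
      nlinarith [abs_nonneg s]
    · rw [indicator_of_notMem (s := {s : ℝ | |lam ^ 2 - (s ^ 2 + ρ ^ 2)| < ε}) hs, abs_zero]
      exact mul_nonneg (by positivity) (indicator_nonneg (fun x hx => ha0.trans hx.1) _)
  · change ∫ s, 2 / lam * (Icc a b).indicator (fun s => s) |s| ≤ _
    rw [integral_const_mul, integral_comp_abs (f := (Icc a b).indicator (fun s => s))]
    have h1 : ∫ s in Ioi (0 : ℝ), (Icc a b).indicator (fun s => s) s ≤ ε := by
      calc ∫ s in Ioi (0 : ℝ), (Icc a b).indicator (fun s => s) s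
          ≤ ∫ s, (Icc a b).indicator (fun s => s) s := by
            refine setIntegral_le_integral hDIi (ae_of_all _ fun s => ?_)
            exact indicator_nonneg (fun x hx => ha0.trans hx.1) _
        _ = (b ^ 2 - a ^ 2) / 2 := by
            rw [integral_indicator measurableSet_Icc, integral_Icc_eq_integral_Ioc,
              ← intervalIntegral.integral_of_le hab, integral_id]
        _ ≤ ε := by
            have hbb : b ^ 2 = max (q + ε) 0 := by
              rcases le_total 0 (q + ε) with h | h
              · rw [hb, Real.sq_sqrt h, max_eq_left h]
              · rw [hb, Real.sqrt_eq_zero_of_nonpos h, max_eq_right h]; norm_num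
            have haa : q - ε ≤ a ^ 2 := by
              rcases le_total 0 (q - ε) with h | h
              · rw [ha, Real.sq_sqrt h]
              · exact h.trans (sq_nonneg a)
            have : max (q + ε) 0 ≤ a ^ 2 + 2 * ε := max_le (by linarith) (by positivity)
            linarith
    calc 2 / lam * (2 * ∫ s in Ioi (0 : ℝ), (Icc a b).indicator (fun s => s) s)
        ≤ 2 / lam * (2 * ε) := by gcongr
      _ = _ := by ring

end MultiplierKernels

/-! ### The unitary Fourier transform on the Schwartz space. -/

section Fourier

variable {n : ℕ}

lemma two_pi_inv_ne_zero : ((2 * Real.pi)⁻¹ : ℝ) ≠ 0 := by positivity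

/-- The unitary Fourier transform of a Schwartz function, as a Schwartz function. -/
def schwartzFourier (φ : 𝓢(Space n, ℂ)) : 𝓢(Space n, ℂ) :=
  (((2 * Real.pi) ^ (-((n : ℝ) / 2)) : ℝ) : ℂ) •
    SchwartzMap.compCLMOfContinuousLinearEquiv ℂ
      (ContinuousLinearEquiv.smulLeft (R₁ := ℝ) (M₁ := Space n)
        (Units.mk0 ((2 * Real.pi)⁻¹ : ℝ) two_pi_inv_ne_zero)) (SchwartzMap.fourierTransformCLM ℂ φ)

lemma fourierTransform_eq (f : Space n → ℂ) (ξ : Space n) :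
    fourierTransform f ξ = (((2 * Real.pi) ^ (-((n : ℝ) / 2)) : ℝ) : ℂ) *
      FourierTransform.fourier f ((2 * Real.pi)⁻¹ • ξ) := by
  rw [fourierTransform, Real.fourier_eq']
  congr 2
  ext x
  rw [smul_eq_mul, real_inner_smul_right]
  congr 2
  push_cast
  field_simp

lemma schwartzFourier_apply (φ : 𝓢(Space n, ℂ)) (ξ : Space n) :
    schwartzFourier φ ξ = fourierTransform φ ξ := by
  rw [fourierTransform_eq]
  rfl

lemma coe_schwartzFourier (φ : 𝓢(Space n, ℂ)) : ⇑(schwartzFourier φ) = fourierTransform φ :=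
  funext (schwartzFourier_apply φ)

open ComplexConjugate in
/-- Parseval's identity. -/
lemma integral_fourierTransform_mul_conj (φ ψ : 𝓢(Space n, ℂ)) :
    ∫ ξ, fourierTransform φ ξ * conj (fourierTransform ψ ξ) = ∫ x, φ x * conj (ψ x) := by
  have h := SchwartzMap.integral_inner_fourier_fourier ψ φ
  simp only [RCLike.inner_apply] at h
  rw [← h]
  have h1 : ∀ ξ, fourierTransform φ ξ * conj (fourierTransform ψ ξ) =
      (((2 * Real.pi) ^ (-(n : ℝ)) : ℝ) : ℂ) *
        (fun w => FourierTransform.fourier (φ : Space n → ℂ) w *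
          conj (FourierTransform.fourier (ψ : Space n → ℂ) w)) ((2 * Real.pi)⁻¹ • ξ) := by
    intro ξ
    rw [fourierTransform_eq, fourierTransform_eq, map_mul, Complex.conj_ofReal]
    have : (2 * Real.pi) ^ (-(n : ℝ)) =
        (2 * Real.pi) ^ (-((n : ℝ) / 2)) * (2 * Real.pi) ^ (-((n : ℝ) / 2)) := by
      rw [← Real.rpow_add (by positivity)]
      congr 1
      ring
    rw [this]
    push_cast
    ring
  simp_rw [h1]
  rw [integral_const_mul, Measure.integral_comp_inv_smul volume (fun w =>
    FourierTransform.fourier (φ : Space n → ℂ) w *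
      conj (FourierTransform.fourier (ψ : Space n → ℂ) w)) (2 * Real.pi),
    finrank_euclideanSpace_fin, abs_of_pos (by positivity), Complex.real_smul, ← mul_assoc,
    ← Complex.ofReal_mul, ← Real.rpow_natCast, ← Real.rpow_add (by positivity), neg_add_cancel,
    Real.rpow_zero, Complex.ofReal_one, one_mul]
  rfl

/-- Plancherel's identity. -/
lemma eLpNorm_fourierTransform (φ : 𝓢(Space n, ℂ)) :
    ∫⁻ ξ, ‖fourierTransform φ ξ‖ₑ ^ 2 = ∫⁻ x, ‖φ x‖ₑ ^ 2 := by
  have key : ∀ ψ : 𝓢(Space n, ℂ), ∫⁻ x, ‖ψ x‖ₑ ^ 2 = ENNReal.ofReal (∫ x, ‖ψ x‖ ^ 2) := by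
    intro ψ
    rw [ofReal_integral_eq_lintegral_ofReal]
    · refine lintegral_congr fun x => ?_
      rw [ENNReal.ofReal_pow (norm_nonneg _), ofReal_norm]
    · exact (memLp_two_iff_integrable_sq_norm ψ.continuous.aestronglyMeasurable).1
        (ψ.memLp 2 volume)
    · exact ae_of_all _ fun x => sq_nonneg _
  rw [key φ, ← coe_schwartzFourier, key]
  congr 1
  have h := integral_fourierTransform_mul_conj φ φ
  have h2 : ∀ z : ℂ, z * (starRingEnd ℂ) z = ((‖z‖ ^ 2 : ℝ) : ℂ) := fun z => by
    rw [Complex.mul_conj, Complex.normSq_eq_norm_sq]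
  simp only [h2] at h
  rw [integral_complex_ofReal, integral_complex_ofReal] at h
  rw [coe_schwartzFourier]
  exact_mod_cast h

lemma fourierTransform_laplacian (φ : 𝓢(Space n, ℂ)) (ξ : Space n) :
    fourierTransform (fun x => Laplacian.laplacian (φ : Space n → ℂ) x) ξ =
      -((‖ξ‖ ^ 2 : ℝ) : ℂ) * fourierTransform φ ξ := by
  have h1 : (fun x => Laplacian.laplacian (φ : Space n → ℂ) x) =
      ⇑(Laplacian.laplacian φ : 𝓢(Space n, ℂ)) :=
    funext fun x => (SchwartzMap.laplacian_apply φ x).symm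
  rw [h1, fourierTransform_eq, fourierTransform_eq]
  have h2 : FourierTransform.fourier (⇑(Laplacian.laplacian φ : 𝓢(Space n, ℂ))) =
      ⇑(FourierTransform.fourier (Laplacian.laplacian φ : 𝓢(Space n, ℂ))) := rfl
  have h3 : FourierTransform.fourier (φ : Space n → ℂ) =
      ⇑(FourierTransform.fourier φ : 𝓢(Space n, ℂ)) := rfl
  have htg : Function.HasTemperateGrowth (fun x : Space n => ‖x‖ ^ 2) := by fun_prop
  rw [h2, h3, SchwartzMap.laplacian_eq_fourierMultiplierCLM, FourierTransform.fourier_smul,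
    SchwartzMap.fourierMultiplierCLM_apply, FourierTransform.fourier_fourierInv_eq,
    _root_.smul_apply]
  change _ * (-(2 * Real.pi) ^ 2 • SchwartzMap.smulLeftCLM ℂ (fun x : Space n => ‖x‖ ^ 2)
    (FourierTransform.fourier φ) ((2 * Real.pi)⁻¹ • ξ)) = _
  rw [SchwartzMap.smulLeftCLM_apply_apply htg, norm_smul, Real.norm_of_nonneg (by positivity),
    smul_smul, Complex.real_smul]
  have h4 : -(2 * Real.pi) ^ 2 * ((2 * Real.pi)⁻¹ * ‖ξ‖) ^ 2 = -‖ξ‖ ^ 2 := by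
    field_simp
  rw [h4]
  push_cast
  ring

end Fourier

/-! ### Hyperplane slices and the partial Fourier transform. -/

section Slices

variable {m : ℕ}

/-- The point of `ℝ^(m+1)` whose `i`-th coordinate is `s` and whose other coordinates are those
of `x`. -/
def insertCoord (i : Fin (m + 1)) (s : ℝ) (x : Space m) : Space (m + 1) :=
  WithLp.toLp 2 (i.insertNth s x.ofLp)

@[simp] lemma insertCoord_same (i : Fin (m + 1)) (s : ℝ) (x : Space m) :
    insertCoord i s x i = s := by
  simp [insertCoord]

@[simp] lemma insertCoord_succAbove (i : Fin (m + 1)) (s : ℝ) (x : Space m) (j : Fin m) :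
    insertCoord i s x (i.succAbove j) = x j := by
  simp [insertCoord]

lemma inner_insertCoord (i : Fin (m + 1)) (s t : ℝ) (x y : Space m) :
    inner ℝ (insertCoord i s x) (insertCoord i t y) = s * t + inner ℝ x y := by
  rw [PiLp.inner_apply, PiLp.inner_apply, Fin.sum_univ_succAbove _ i]
  simp [mul_comm]

lemma norm_sq_insertCoord (i : Fin (m + 1)) (s : ℝ) (x : Space m) :
    ‖insertCoord i s x‖ ^ 2 = s ^ 2 + ‖x‖ ^ 2 := by
  rw [← real_inner_self_eq_norm_sq, ← real_inner_self_eq_norm_sq, inner_insertCoord, sq]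

lemma insertCoord_sub (i : Fin (m + 1)) (s t : ℝ) (x y : Space m) :
    insertCoord i s x - insertCoord i t y = insertCoord i (s - t) (x - y) := by
  ext k
  rcases Fin.eq_self_or_eq_succAbove i k with rfl | ⟨j, rfl⟩ <;> simp

/-- The linear embedding of a coordinate hyperplane. -/
def insertZero (i : Fin (m + 1)) : Space m →ₗ[ℝ] Space (m + 1) where
  toFun x := insertCoord i 0 x
  map_add' x y := by
    ext k
    rcases Fin.eq_self_or_eq_succAbove i k with rfl | ⟨j, rfl⟩ <;> simp
  map_smul' c x := by
    ext k
    rcases Fin.eq_self_or_eq_succAbove i k with rfl | ⟨j, rfl⟩ <;> simp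

lemma insertCoord_eq_add (i : Fin (m + 1)) (s : ℝ) (x : Space m) :
    insertCoord i s x = s • insertCoord i 1 0 + (insertZero i).toContinuousLinearMap x := by
  change _ = _ + insertCoord i 0 x
  ext k
  rcases Fin.eq_self_or_eq_succAbove i k with rfl | ⟨j, rfl⟩ <;> simp

lemma continuous_insertCoord (i : Fin (m + 1)) :
    Continuous (fun p : ℝ × Space m => insertCoord i p.1 p.2) := by
  rw [show (fun p : ℝ × Space m => insertCoord i p.1 p.2) = fun p => p.1 • insertCoord i 1 0 +
    (insertZero i).toContinuousLinearMap p.2 from funext fun p => insertCoord_eq_add i p.1 p.2]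
  fun_prop

lemma isometry_insertCoord (i : Fin (m + 1)) (s : ℝ) : Isometry (insertCoord i s) := by
  refine Isometry.of_dist_eq fun x y => ?_
  rw [dist_eq_norm, dist_eq_norm, insertCoord_sub, sub_self,
    ← sq_eq_sq₀ (norm_nonneg _) (norm_nonneg _), norm_sq_insertCoord]
  ring

lemma measurePreserving_insertCoord (i : Fin (m + 1)) :
    MeasurePreserving (fun p : ℝ × Space m => insertCoord i p.1 p.2)
      ((volume : Measure ℝ).prod (volume : Measure (Space m))) volume := by
  have h1 : MeasurePreserving (fun p : ℝ × Space m => (p.1, p.2.ofLp))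
      ((volume : Measure ℝ).prod (volume : Measure (Space m)))
      ((volume : Measure ℝ).prod (volume : Measure (Fin m → ℝ))) :=
    (MeasurePreserving.id _).prod (PiLp.volume_preserving_ofLp _)
  have h2 := (volume_preserving_piFinSuccAbove (fun _ : Fin (m + 1) => ℝ) i).symm
  exact (PiLp.volume_preserving_toLp _).comp (h2.comp h1)

/-- `insertCoord` as a measurable equivalence. -/
lemma measurableEmbedding_insertCoord (i : Fin (m + 1)) :
    MeasurableEmbedding (fun p : ℝ × Space m => insertCoord i p.1 p.2) := by
  refine (continuous_insertCoord i).measurableEmbedding ?_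
  intro p q h
  have h' : insertCoord i p.1 p.2 = insertCoord i q.1 q.2 := h
  refine Prod.ext ?_ ?_
  · simpa using congrArg (fun z : Space (m + 1) => z i) h'
  · ext j
    simpa using congrArg (fun z : Space (m + 1) => z (i.succAbove j)) h'

lemma integrable_comp_insertCoord (i : Fin (m + 1)) {f : Space (m + 1) → ℂ}
    (hf : Integrable f volume) :
    Integrable (fun p : ℝ × Space m => f (insertCoord i p.1 p.2))
      ((volume : Measure ℝ).prod (volume : Measure (Space m))) :=
  (measurePreserving_insertCoord i).integrable_comp_of_integrable hf

lemma integral_insertCoord (i : Fin (m + 1)) (f : Space (m + 1) → ℂ) :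
    ∫ p : ℝ × Space m, f (insertCoord i p.1 p.2)
      ∂((volume : Measure ℝ).prod (volume : Measure (Space m))) = ∫ x, f x :=
  (measurePreserving_insertCoord i).integral_comp (measurableEmbedding_insertCoord i) f

lemma lintegral_insertCoord (i : Fin (m + 1)) {f : Space (m + 1) → ℝ≥0∞}
    (hf : Measurable f) :
    ∫⁻ y, ∫⁻ x, f (insertCoord i y x) = ∫⁻ x, f x := by
  rw [← (measurePreserving_insertCoord i).lintegral_comp hf, lintegral_prod]
  exact (hf.comp (continuous_insertCoord i).measurable).aemeasurable

/-- The restriction of a Schwartz function to the hyperplane `x_i = s`. -/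
def slice (i : Fin (m + 1)) (s : ℝ) (φ : 𝓢(Space (m + 1), ℂ)) : 𝓢(Space m, ℂ) :=
  SchwartzMap.compCLMOfAntilipschitz ℂ (g := insertCoord i s) (by
    rw [show insertCoord i s = fun x => s • insertCoord i 1 0 +
      (insertZero i).toContinuousLinearMap x from funext fun x => insertCoord_eq_add i s x]
    fun_prop) (isometry_insertCoord i s).antilipschitz φ

@[simp] lemma slice_apply (i : Fin (m + 1)) (s : ℝ) (φ : 𝓢(Space (m + 1), ℂ)) (x : Space m) :
    slice i s φ x = φ (insertCoord i s x) := rfl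

/-- The partial Fourier transform in all the variables but the `i`-th. -/
def partialFourier (i : Fin (m + 1)) (φ : 𝓢(Space (m + 1), ℂ)) (p : ℝ × Space m) : ℂ :=
  fourierTransform (slice i p.1 φ) p.2

lemma stronglyMeasurable_partialFourier (i : Fin (m + 1)) (φ : 𝓢(Space (m + 1), ℂ)) :
    StronglyMeasurable (partialFourier i φ) := by
  unfold partialFourier fourierTransform
  refine StronglyMeasurable.const_mul ?_ _
  refine StronglyMeasurable.integral_prod_right'
    (f := fun q : (ℝ × Space m) × Space m =>
      Complex.exp (-Complex.I * (inner ℝ q.2 q.1.2 : ℝ)) * slice i q.1.1 φ q.2) ?_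
  refine Continuous.stronglyMeasurable ?_
  refine Continuous.mul (by fun_prop) ?_
  exact φ.continuous.comp ((continuous_insertCoord i).comp (by fun_prop : Continuous
    (fun q : (ℝ × Space m) × Space m => (q.1.1, q.2))))

lemma lintegral_partialFourier_sq (i : Fin (m + 1)) (φ : 𝓢(Space (m + 1), ℂ)) (y : ℝ) :
    ∫⁻ ξ, ‖partialFourier i φ (y, ξ)‖ₑ ^ 2 = ∫⁻ x, ‖φ (insertCoord i y x)‖ₑ ^ 2 :=
  eLpNorm_fourierTransform (slice i y φ)

lemma norm_partialFourier_le (i : Fin (m + 1)) (φ : 𝓢(Space (m + 1), ℂ)) (y : ℝ) (ξ : Space m) :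
    ‖partialFourier i φ (y, ξ)‖ ≤
      (2 * Real.pi) ^ (-((m : ℝ) / 2)) * ∫ x, ‖φ (insertCoord i y x)‖ := by
  unfold partialFourier fourierTransform
  rw [norm_mul, Complex.norm_real, Real.norm_of_nonneg (by positivity)]
  gcongr
  refine (norm_integral_le_integral_norm _).trans_eq ?_
  refine integral_congr_ae (ae_of_all _ fun x => ?_)
  simp only [norm_mul, slice_apply]
  rw [norm_exp_neg_I_mul, one_mul]

lemma integrable_partialFourier (i : Fin (m + 1)) (φ : 𝓢(Space (m + 1), ℂ)) (ξ : Space m) :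
    Integrable (fun y => partialFourier i φ (y, ξ)) := by
  have h1 := (integrable_comp_insertCoord i (φ.integrable (μ := volume))).integral_norm_prod_left
  refine (h1.const_mul ((2 * Real.pi) ^ (-((m : ℝ) / 2)))).mono' ?_
    (ae_of_all _ fun y => norm_partialFourier_le i φ y ξ)
  exact ((stronglyMeasurable_partialFourier i φ).comp_measurable
    (measurable_id.prodMk measurable_const)).aestronglyMeasurable

/-- Fubini: the full transform is a one-dimensional transform of the partial one, and the
normalization leaves (2π)^(-1/2) for the distinguished variable. -/
lemma fourierTransform_insertCoord (i : Fin (m + 1)) (φ : 𝓢(Space (m + 1), ℂ)) (s : ℝ)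
    (ξ : Space m) :
    fourierTransform φ (insertCoord i s ξ) = (((2 * Real.pi) ^ (-(1 / 2 : ℝ)) : ℝ) : ℂ) *
      ∫ y, Complex.exp (-Complex.I * ((s * y : ℝ) : ℂ)) * partialFourier i φ (y, ξ) := by
  unfold partialFourier fourierTransform
  have hint : Integrable (fun x : Space (m + 1) =>
      Complex.exp (-Complex.I * (inner ℝ x (insertCoord i s ξ) : ℝ)) * φ x) volume := by
    refine (φ.integrable (μ := volume)).bdd_mul (c := 1) ?_ ?_
    · exact Continuous.aestronglyMeasurable (by fun_prop)
    · exact ae_of_all _ fun r => (norm_exp_neg_I_mul _).le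
  rw [← integral_insertCoord i, integral_prod _ (integrable_comp_insertCoord i hint),
    ← integral_const_mul, ← integral_const_mul]
  refine integral_congr_ae (ae_of_all _ fun y => ?_)
  simp only
  have hc : (2 * Real.pi) ^ (-(((m + 1 : ℕ) : ℝ) / 2)) =
      (2 * Real.pi) ^ (-(1 / 2 : ℝ)) * (2 * Real.pi) ^ (-((m : ℝ) / 2)) := by
    rw [← Real.rpow_add (by positivity)]
    congr 1
    push_cast
    ring
  rw [hc, Complex.ofReal_mul]
  have h2 : ∀ x : Space m, Complex.exp (-Complex.I *
      (inner ℝ (insertCoord i y x) (insertCoord i s ξ) : ℝ)) * φ (insertCoord i y x) =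
      Complex.exp (-Complex.I * ((s * y : ℝ) : ℂ)) *
        (Complex.exp (-Complex.I * (inner ℝ x ξ : ℝ)) * slice i y φ x) := by
    intro x
    rw [inner_insertCoord, slice_apply, ← mul_assoc, ← Complex.exp_add]
    congr 2
    push_cast
    ring
  simp_rw [h2]
  rw [integral_const_mul]
  ring

end Slices

/-! ### Multipliers with bounded one-dimensional kernels act from B to B*. -/

section KeyEstimate

open ComplexConjugate

/-- By Fubini the integral equals ∬ p(y) conj q(y') k̂(y - y') dy dy', where k̂ is the transform of
k, bounded by A. This is the estimate L¹ → L^∞ for convolution with a bounded kernel. -/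
lemma norm_integral_kernel_le {k : ℝ → ℝ} {A : ℝ} (hk : HasKernelBound k A)
    {p q : ℝ → ℂ} (hp : Integrable p) (hq : Integrable q) :
    ‖∫ s, (k s : ℂ) * ((∫ y, Complex.exp (-Complex.I * ((s * y : ℝ) : ℂ)) * p y) *
      conj (∫ y, Complex.exp (-Complex.I * ((s * y : ℝ) : ℂ)) * q y))‖ ≤
    A * ((∫ y, ‖p y‖) * ∫ y, ‖q y‖) := by
  have hq' : Integrable (fun y => conj (q y)) :=
    hq.congr' (Complex.continuous_conj.comp_aestronglyMeasurable hq.1)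
      (ae_of_all _ fun y => by simp)
  have hpq : Integrable (fun z : ℝ × ℝ => p z.1 * conj (q z.2))
      ((volume : Measure ℝ).prod volume) := hp.mul_prod hq'
  have hH : Integrable (fun w : ℝ × (ℝ × ℝ) =>
      Complex.exp (-Complex.I * (((w.2.1 - w.2.2) * w.1 : ℝ) : ℂ)) *
        ((k w.1 : ℂ) * (p w.2.1 * conj (q w.2.2))))
      ((volume : Measure ℝ).prod ((volume : Measure ℝ).prod volume)) := by
    refine (hk.1.ofReal.mul_prod hpq).bdd_mul (c := 1) ?_ ?_
    · exact Continuous.aestronglyMeasurable (by fun_prop)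
    · exact ae_of_all _ fun r => (norm_exp_neg_I_mul _).le
  have h1 : ∀ s : ℝ, (k s : ℂ) * ((∫ y, Complex.exp (-Complex.I * ((s * y : ℝ) : ℂ)) * p y) *
      conj (∫ y, Complex.exp (-Complex.I * ((s * y : ℝ) : ℂ)) * q y)) =
      ∫ z : ℝ × ℝ, Complex.exp (-Complex.I * (((z.1 - z.2) * s : ℝ) : ℂ)) *
        ((k s : ℂ) * (p z.1 * conj (q z.2))) ∂((volume : Measure ℝ).prod volume) := by
    intro s
    rw [← integral_conj, ← integral_prod_mul, ← integral_const_mul]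
    refine integral_congr_ae (ae_of_all _ fun z => ?_)
    simp only
    rw [map_mul, ← Complex.exp_conj]
    have h2 : Complex.exp (-Complex.I * (((z.1 - z.2) * s : ℝ) : ℂ)) =
        Complex.exp (-Complex.I * ((s * z.1 : ℝ) : ℂ)) *
          Complex.exp (conj (-Complex.I * ((s * z.2 : ℝ) : ℂ))) := by
      rw [← Complex.exp_add, map_mul, map_neg, Complex.conj_I, Complex.conj_ofReal]
      congr 1
      push_cast
      ring
    rw [h2]
    ring
  simp_rw [h1]
  rw [integral_integral_swap hH, ← integral_prod_mul, ← integral_const_mul]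
  refine norm_integral_le_of_norm_le ((hp.norm.mul_prod hq.norm).const_mul A)
    (ae_of_all _ fun z => ?_)
  have h3 : ∀ s : ℝ, Complex.exp (-Complex.I * (((z.1 - z.2) * s : ℝ) : ℂ)) *
        ((k s : ℂ) * (p z.1 * conj (q z.2))) =
      (p z.1 * conj (q z.2)) *
        (Complex.exp (-Complex.I * (((z.1 - z.2) * s : ℝ) : ℂ)) * (k s : ℂ)) := fun s => by ring
  simp_rw [h3]
  rw [integral_const_mul, norm_mul, norm_mul, RCLike.norm_conj, mul_comm]
  exact mul_le_mul_of_nonneg_right (hk.2 _) (by positivity)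

/-- Minkowski's integral inequality for `L²`. -/
lemma lintegral_lintegral_sq_le {α β : Type*} [MeasurableSpace α] [MeasurableSpace β]
    {μ : Measure α} {ν : Measure β} [SFinite μ] [SFinite ν] {h : α × β → ℝ≥0∞}
    (hh : Measurable h) :
    ∫⁻ b, (∫⁻ a, h (a, b) ∂μ) ^ 2 ∂ν ≤
      (∫⁻ a, (∫⁻ b, h (a, b) ^ 2 ∂ν) ^ (1 / 2 : ℝ) ∂μ) ^ 2 := by
  have hsec : ∀ a, Measurable fun b => h (a, b) := fun a => hh.comp measurable_prodMk_left
  have hsec' : ∀ b, Measurable fun a => h (a, b) := fun b => hh.comp measurable_prodMk_right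
  have hN : Measurable fun a => (∫⁻ b, h (a, b) ^ 2 ∂ν) ^ (1 / 2 : ℝ) :=
    ((hh.pow_const 2).lintegral_prod_right').pow_const _
  calc ∫⁻ b, (∫⁻ a, h (a, b) ∂μ) ^ 2 ∂ν
      = ∫⁻ b, ∫⁻ a, ∫⁻ a', h (a, b) * h (a', b) ∂μ ∂μ ∂ν := by
        -- The square of the inner integral is expanded into a double integral, so that after
        -- Tonelli only Cauchy-Schwarz in b is needed.
        refine lintegral_congr fun b => ?_
        rw [sq, ← lintegral_mul_const _ (hsec' b)]
        refine lintegral_congr fun a => ?_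
        rw [lintegral_const_mul _ (hsec' b)]
    _ = ∫⁻ a, ∫⁻ b, ∫⁻ a', h (a, b) * h (a', b) ∂μ ∂ν ∂μ := by
        rw [lintegral_lintegral_swap]
        refine Measurable.aemeasurable ?_
        refine Measurable.lintegral_prod_right' (f := fun q : (β × α) × α =>
          h (q.1.2, q.1.1) * h (q.2, q.1.1)) ?_
        exact (hh.comp (by fun_prop)).mul (hh.comp (by fun_prop))
    _ = ∫⁻ a, ∫⁻ a', ∫⁻ b, h (a, b) * h (a', b) ∂ν ∂μ ∂μ := by
        refine lintegral_congr fun a => ?_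
        rw [lintegral_lintegral_swap]
        exact ((hh.comp (by fun_prop)).mul (hh.comp (by fun_prop))).aemeasurable
    _ ≤ ∫⁻ a, ∫⁻ a', (∫⁻ b, h (a, b) ^ 2 ∂ν) ^ (1 / 2 : ℝ) *
          (∫⁻ b, h (a', b) ^ 2 ∂ν) ^ (1 / 2 : ℝ) ∂μ ∂μ := by
        refine lintegral_mono fun a => lintegral_mono fun a' => ?_
        have := ENNReal.lintegral_mul_le_Lp_mul_Lq ν Real.HolderConjugate.two_two
          (hsec a).aemeasurable (hsec a').aemeasurable
        simpa using this
    _ = _ := by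
        rw [sq, ← lintegral_mul_const _ hN]
        refine lintegral_congr fun a => ?_
        rw [lintegral_const_mul _ hN]

variable {m : ℕ}

/-- The mixed `L¹L²` norm, with `L²` in all the variables but the `i`-th, is controlled by the
norm of `B`. -/
lemma lintegral_slice_le_bENorm (i : Fin (m + 1)) {f : Space (m + 1) → ℂ} (hf : Measurable f) :
    ∫⁻ y, (∫⁻ x, ‖f (insertCoord i y x)‖ₑ ^ 2) ^ (1 / 2 : ℝ) ≤
      (2 : ℝ≥0∞) ^ (1 / 2 : ℝ) * bENorm f := by
  let F : ℕ → Space (m + 1) → ℝ≥0∞ := fun j => (shell (m + 1) j).indicator fun x => ‖f x‖ₑ ^ 2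
  have hF : ∀ j, Measurable (F j) := fun j =>
    (hf.enorm.pow_const 2).indicator (measurableSet_shell j)
  have hFi : ∀ j y, Measurable fun x => F j (insertCoord i y x) := fun j y =>
    (hF j).comp (isometry_insertCoord i y).continuous.measurable
  let c : ℕ → ℝ → ℝ≥0∞ := fun j y => (∫⁻ x, F j (insertCoord i y x)) ^ (1 / 2 : ℝ)
  have hc2 : ∀ j y, c j y ^ 2 = ∫⁻ x, F j (insertCoord i y x) := fun j y => by
    rw [← ENNReal.rpow_natCast, ← ENNReal.rpow_mul]; simp
  have hcm : ∀ j, Measurable (c j) := fun j =>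
    (Measurable.lintegral_prod_right' ((hF j).comp
      (continuous_insertCoord i).measurable)).pow_const _
  have h1 : ∀ y, (∫⁻ x, ‖f (insertCoord i y x)‖ₑ ^ 2) ^ (1 / 2 : ℝ) ≤ ∑' j, c j y := by
    intro y
    -- On each hyperplane the squares of the shell contributions add up, and ∑ c_j² ≤ (∑ c_j)².
    have h2 : ∫⁻ x, ‖f (insertCoord i y x)‖ₑ ^ 2 ≤ (∑' j, c j y) ^ 2 := by
      calc ∫⁻ x, ‖f (insertCoord i y x)‖ₑ ^ 2 ≤ ∫⁻ x, ∑' j, F j (insertCoord i y x) := by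
            refine lintegral_mono fun x => ?_
            have hx : insertCoord i y x ∈ ⋃ j, shell (m + 1) j := by
              rw [iUnion_shell]; exact mem_univ _
            obtain ⟨j, hj⟩ := mem_iUnion.1 hx
            refine le_trans ?_ (ENNReal.le_tsum j)
            simp [F, hj]
        _ = ∑' j, c j y ^ 2 := by
            rw [lintegral_tsum fun j => (hFi j y).aemeasurable]
            simp_rw [hc2]
        _ ≤ ∑' j, c j y * ∑' l, c l y := by
            refine ENNReal.tsum_le_tsum fun j => ?_
            rw [sq]
            gcongr
            exact ENNReal.le_tsum j
        _ = (∑' j, c j y) ^ 2 := by rw [ENNReal.tsum_mul_right, sq]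
    calc _ ≤ ((∑' j, c j y) ^ 2) ^ (1 / 2 : ℝ) := by gcongr
      _ = _ := by rw [← ENNReal.rpow_natCast, ← ENNReal.rpow_mul]; simp
  calc ∫⁻ y, (∫⁻ x, ‖f (insertCoord i y x)‖ₑ ^ 2) ^ (1 / 2 : ℝ)
      ≤ ∫⁻ y, ∑' j, c j y := lintegral_mono h1
    _ = ∑' j, ∫⁻ y, c j y := lintegral_tsum fun j => (hcm j).aemeasurable
    _ ≤ ∑' j : ℕ, (2 : ℝ≥0∞) ^ (1 / 2 : ℝ) * (2 ^ ((j : ℝ) / 2) * shellNorm 2 f j) := by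
        refine ENNReal.tsum_le_tsum fun j => ?_
        -- The j-th shell meets the hyperplane only for |y| ≤ 2^j. Cauchy-Schwarz on this interval
        -- of length 2 · 2^j produces the factor √2 · 2^(j/2), which is the weight in B.
        have hsupp : ∀ y, y ∉ Icc (-(2 : ℝ) ^ j) (2 ^ j) → c j y = 0 := by
          intro y hy
          have : ∀ x, F j (insertCoord i y x) = 0 := fun x => by
            refine indicator_of_notMem (fun hmem => hy ?_) _
            have h3 := norm_le_of_mem_shell hmem
            refine abs_le.1 (le_trans ?_ h3)
            refine abs_le_of_sq_le_sq ?_ (norm_nonneg _)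
            rw [norm_sq_insertCoord]
            nlinarith [sq_nonneg ‖x‖]
          simp [c, this]
        have hshell : ∫⁻ y, c j y ^ 2 = shellNorm 2 f j ^ 2 := by
          simp_rw [hc2]
          rw [lintegral_insertCoord i (hF j), shellNorm, eLpNorm_two_sq,
            lintegral_indicator (measurableSet_shell j)]
        have hcs := ENNReal.lintegral_mul_le_Lp_mul_Lq (volume : Measure ℝ)
          Real.HolderConjugate.two_two (hcm j).aemeasurable
          (g := (Icc (-(2 : ℝ) ^ j) (2 ^ j)).indicator 1)
          (measurable_one.indicator measurableSet_Icc).aemeasurable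
        have e1 : ∫⁻ y, c j y = ∫⁻ y, (c j * (Icc (-(2 : ℝ) ^ j) (2 ^ j)).indicator (1 : ℝ → ℝ≥0∞)) y := by
          refine lintegral_congr fun y => ?_
          by_cases hy : y ∈ Icc (-(2 : ℝ) ^ j) (2 ^ j)
          · simp [hy]
          · simp [hsupp y hy]
        have e2 : (∫⁻ y, c j y ^ (2 : ℝ)) ^ (1 / 2 : ℝ) = shellNorm 2 f j := by
          simp only [ENNReal.rpow_two]
          rw [hshell, ← ENNReal.rpow_natCast, ← ENNReal.rpow_mul]
          simp
        have e3 : (∫⁻ y, (Icc (-(2 : ℝ) ^ j) (2 ^ j)).indicator (1 : ℝ → ℝ≥0∞) y ^ (2 : ℝ)) ^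
            (1 / 2 : ℝ) = (2 : ℝ≥0∞) ^ (1 / 2 : ℝ) * 2 ^ ((j : ℝ) / 2) := by
          have e4 : ∀ y, (Icc (-(2 : ℝ) ^ j) (2 ^ j)).indicator (1 : ℝ → ℝ≥0∞) y ^ (2 : ℝ) =
              (Icc (-(2 : ℝ) ^ j) (2 ^ j)).indicator 1 y := by
            intro y
            by_cases hy : y ∈ Icc (-(2 : ℝ) ^ j) (2 ^ j)
            · simp [hy]
            · simp [hy]
          simp_rw [e4]
          rw [lintegral_indicator_one measurableSet_Icc, Real.volume_Icc,
            show (2 : ℝ) ^ j - -(2 : ℝ) ^ j = 2 * 2 ^ j by ring,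
            ENNReal.ofReal_mul (by norm_num), ENNReal.ofReal_pow (by norm_num),
            ENNReal.mul_rpow_of_nonneg _ _ (by norm_num), ← ENNReal.rpow_natCast,
            ← ENNReal.rpow_mul, mul_one_div]
          simp
        rw [e1]
        refine hcs.trans_eq ?_
        rw [e2, e3]
        ring
    _ = _ := by rw [ENNReal.tsum_mul_left]; rfl

/-- Minkowski puts the L² norm in ξ inside the integral over y, Plancherel removes the partial
transform, and the mixed norm is controlled by B; the 2 is (√2)². -/
lemma lintegral_partialFourier_le (i : Fin (m + 1)) (φ : 𝓢(Space (m + 1), ℂ)) :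
    ∫⁻ ξ, (∫⁻ y, ‖partialFourier i φ (y, ξ)‖ₑ) ^ 2 ≤ 2 * bENorm φ ^ 2 := by
  refine (lintegral_lintegral_sq_le (stronglyMeasurable_partialFourier i φ).measurable.enorm).trans
    ?_
  simp_rw [lintegral_partialFourier_sq]
  refine (pow_le_pow_left' (lintegral_slice_le_bENorm i φ.continuous.measurable) 2).trans_eq ?_
  rw [mul_pow, ← ENNReal.rpow_natCast, ← ENNReal.rpow_mul]
  simp

/-- A Fourier multiplier whose kernels in the `i`-th variable are bounded by `A` is bounded from
`B` to its dual. -/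
lemma norm_integral_multiplier_le (i : Fin (m + 1)) {M : Space (m + 1) → ℝ} {A c : ℝ} (hA : 0 ≤ A)
    (hM : Measurable M) (hMc : ∀ ξ, |M ξ| ≤ c)
    (hk : ∀ ξ : Space m, HasKernelBound (fun s => M (insertCoord i s ξ)) A)
    (f g : 𝓢(Space (m + 1), ℂ)) :
    ‖∫ ξ, (M ξ : ℂ) * (fourierTransform f ξ * conj (fourierTransform g ξ))‖ ≤
      A / Real.pi * (bENorm f).toReal * (bENorm g).toReal := by
  have hfg : Integrable (fun ξ => fourierTransform f ξ * conj (fourierTransform g ξ)) volume := by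
    rw [← coe_schwartzFourier, ← coe_schwartzFourier]
    exact MemLp.integrable_mul (p := 2) (q := 2) ((schwartzFourier f).memLp 2 volume)
      ((schwartzFourier g).memLp 2 volume).star
  have hint : Integrable (fun ξ => (M ξ : ℂ) *
      (fourierTransform f ξ * conj (fourierTransform g ξ))) volume :=
    hfg.bdd_mul (c := c) (Complex.measurable_ofReal.comp hM).aestronglyMeasurable
      (ae_of_all _ fun ξ => by simpa using hMc ξ)
  have hfin : ∀ φ : 𝓢(Space (m + 1), ℂ), bENorm φ ≠ ⊤ := fun φ => (bENorm_schwartz_lt_top φ).ne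
  let a : 𝓢(Space (m + 1), ℂ) → Space m → ℝ≥0∞ := fun φ ξ => ∫⁻ y, ‖partialFourier i φ (y, ξ)‖ₑ
  have ham : ∀ φ, Measurable (a φ) := fun φ =>
    (stronglyMeasurable_partialFourier i φ).measurable.enorm.lintegral_prod_left'
  have hval : ∀ φ ξ, ENNReal.ofReal (∫ y, ‖partialFourier i φ (y, ξ)‖) = a φ ξ := fun φ ξ => by
    rw [ofReal_integral_norm_eq_lintegral_enorm (integrable_partialFourier i φ ξ)]
  have hinner : ∀ ξ : Space m, ‖∫ s, (M (insertCoord i s ξ) : ℂ) *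
      (fourierTransform f (insertCoord i s ξ) * conj (fourierTransform g (insertCoord i s ξ)))‖ₑ ≤
      ENNReal.ofReal (A / (2 * Real.pi)) * (a f ξ * a g ξ) := by
    intro ξ
    have h1 : ∀ s, (M (insertCoord i s ξ) : ℂ) * (fourierTransform f (insertCoord i s ξ) *
        conj (fourierTransform g (insertCoord i s ξ))) = ((1 / (2 * Real.pi) : ℝ) : ℂ) *
        ((M (insertCoord i s ξ) : ℂ) *
          ((∫ y, Complex.exp (-Complex.I * ((s * y : ℝ) : ℂ)) * partialFourier i f (y, ξ)) *
          conj (∫ y, Complex.exp (-Complex.I * ((s * y : ℝ) : ℂ)) *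
            partialFourier i g (y, ξ)))) := by
      intro s
      rw [fourierTransform_insertCoord, fourierTransform_insertCoord, map_mul, Complex.conj_ofReal]
      -- Each of the two transforms contributes (2π)^(-1/2).
      have : (1 / (2 * Real.pi) : ℝ) =
          (2 * Real.pi) ^ (-(1 / 2 : ℝ)) * (2 * Real.pi) ^ (-(1 / 2 : ℝ)) := by
        rw [← Real.rpow_add (by positivity)]
        norm_num [Real.rpow_neg_one]
      rw [this]
      push_cast
      ring
    simp_rw [h1]
    rw [integral_const_mul, ← ofReal_norm, norm_mul, Complex.norm_real,
      Real.norm_of_nonneg (by positivity)]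
    rw [← hval, ← hval, ← ENNReal.ofReal_mul (integral_nonneg fun _ => norm_nonneg _),
      ← ENNReal.ofReal_mul (by positivity)]
    refine ENNReal.ofReal_le_ofReal ?_
    have := norm_integral_kernel_le (hk ξ) (integrable_partialFourier i f ξ)
      (integrable_partialFourier i g ξ)
    calc _ ≤ 1 / (2 * Real.pi) * (A * ((∫ y, ‖partialFourier i f (y, ξ)‖) *
          ∫ y, ‖partialFourier i g (y, ξ)‖)) := by gcongr
      _ = _ := by ring
  -- Cauchy-Schwarz in the frozen frequencies; combined with A/(2π) this gives the constant A/π.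
  have hCS : ∫⁻ ξ, a f ξ * a g ξ ≤ 2 * (bENorm f * bENorm g) := by
    have h1 := ENNReal.lintegral_mul_le_Lp_mul_Lq (volume : Measure (Space m))
      Real.HolderConjugate.two_two (ham f).aemeasurable (ham g).aemeasurable
    refine h1.trans ?_
    have h2 : ∀ φ, (∫⁻ ξ, a φ ξ ^ (2 : ℝ)) ^ (1 / 2 : ℝ) ≤ (2 : ℝ≥0∞) ^ (1 / 2 : ℝ) * bENorm φ := by
      intro φ
      simp only [ENNReal.rpow_two]
      refine (ENNReal.rpow_le_rpow (lintegral_partialFourier_le i φ) (by norm_num)).trans_eq ?_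
      rw [ENNReal.mul_rpow_of_nonneg _ _ (by norm_num), ← ENNReal.rpow_natCast (bENorm φ),
        ← ENNReal.rpow_mul]
      simp
    refine (mul_le_mul' (h2 f) (h2 g)).trans_eq ?_
    have h3 : (2 : ℝ≥0∞) ^ (1 / 2 : ℝ) * 2 ^ (1 / 2 : ℝ) = 2 := by
      rw [← ENNReal.rpow_add _ _ (by norm_num) (by norm_num)]
      norm_num
    calc _ = ((2 : ℝ≥0∞) ^ (1 / 2 : ℝ) * 2 ^ (1 / 2 : ℝ)) * (bENorm f * bENorm g) := by ring
      _ = _ := by rw [h3]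
  rw [← integral_insertCoord i, integral_prod_symm _ (integrable_comp_insertCoord i hint)]
  have hfinal : ‖∫ ξ : Space m, ∫ s : ℝ, (M (insertCoord i s ξ) : ℂ) *
      (fourierTransform f (insertCoord i s ξ) * conj (fourierTransform g (insertCoord i s ξ)))‖ₑ ≤
      ENNReal.ofReal (A / (2 * Real.pi)) * (2 * (bENorm f * bENorm g)) := by
    refine (enorm_integral_le_lintegral_enorm _).trans ?_
    refine (lintegral_mono hinner).trans ?_
    rw [lintegral_const_mul (f := fun ξ => a f ξ * a g ξ) _ ((ham f).mul (ham g))]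
    gcongr
  rw [← toReal_enorm]
  refine (ENNReal.toReal_mono ?_ hfinal).trans_eq ?_
  · have := hfin f
    have := hfin g
    finiteness
  · rw [ENNReal.toReal_mul, ENNReal.toReal_mul, ENNReal.toReal_mul,
      ENNReal.toReal_ofReal (by positivity)]
    simp only [ENNReal.toReal_ofNat]
    field_simp

end KeyEstimate

/-! ### Uniform bounds for the truncated resolvent and for thin annuli. -/

section ResolventEstimate

open ComplexConjugate

variable {m : ℕ}

/-- This partition of unity replaces angular cutoffs. Its weights are rational in each coordinate,
so the one-dimensional kernels can be computed by partial fractions. -/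
lemma sum_coord_sq_div_norm_sq {n : ℕ} {ξ : Space n} (hξ : ξ ≠ 0) :
    ∑ i, ξ i ^ 2 / ‖ξ‖ ^ 2 = 1 := by
  rw [← Finset.sum_div, ← EuclideanSpace.real_norm_sq_eq, div_self]
  exact pow_ne_zero 2 (norm_ne_zero_iff.2 hξ)

lemma coord_sq_le_norm_sq {n : ℕ} (ξ : Space n) (i : Fin n) : ξ i ^ 2 ≤ ‖ξ‖ ^ 2 := by
  rw [EuclideanSpace.real_norm_sq_eq]
  exact Finset.single_le_sum (f := fun i => ξ i ^ 2) (fun _ _ => sq_nonneg _) (Finset.mem_univ i)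

/-- A radial-type multiplier all of whose one dimensional kernels, after localization to the
directions in which the `i`-th coordinate is large, are bounded by `A`. -/
lemma norm_integral_weight_le {W : Space (m + 1) → ℝ} {A c : ℝ} (hA : 0 ≤ A)
    (hW : Measurable W) (hWc : ∀ ξ, |W ξ| ≤ c)
    (hk : ∀ (i : Fin (m + 1)) (ξ : Space m), HasKernelBound
      (fun s => s ^ 2 / (s ^ 2 + ‖ξ‖ ^ 2) * W (insertCoord i s ξ)) A)
    (f g : 𝓢(Space (m + 1), ℂ)) :
    ‖∫ ξ, (W ξ : ℂ) * (fourierTransform f ξ * conj (fourierTransform g ξ))‖ ≤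
      (m + 1) * (A / Real.pi * (bENorm f).toReal * (bENorm g).toReal) := by
  have hfg : Integrable (fun ξ => fourierTransform f ξ * conj (fourierTransform g ξ)) volume := by
    rw [← coe_schwartzFourier, ← coe_schwartzFourier]
    exact MemLp.integrable_mul (p := 2) (q := 2) ((schwartzFourier f).memLp 2 volume)
      ((schwartzFourier g).memLp 2 volume).star
  let M : Fin (m + 1) → Space (m + 1) → ℝ := fun i ξ => ξ i ^ 2 / ‖ξ‖ ^ 2 * W ξ
  have hM : ∀ i, Measurable (M i) := fun i => by
    refine Measurable.mul ?_ hW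
    fun_prop
  have hMc : ∀ i ξ, |M i ξ| ≤ c := fun i ξ => by
    refine le_trans ?_ (hWc ξ)
    rw [abs_mul, abs_of_nonneg (by positivity)]
    exact mul_le_of_le_one_left (abs_nonneg _)
      (div_le_one_of_le₀ (coord_sq_le_norm_sq ξ i) (by positivity))
  have hsum : ∫ ξ, (W ξ : ℂ) * (fourierTransform f ξ * conj (fourierTransform g ξ)) =
      ∑ i, ∫ ξ, (M i ξ : ℂ) * (fourierTransform f ξ * conj (fourierTransform g ξ)) := by
    rw [← integral_finsetSum]
    · refine integral_congr_ae ?_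
      have hae : ∀ᵐ ξ : Space (m + 1), ξ ≠ 0 := by simp [ae_iff, measure_singleton]
      filter_upwards [hae] with ξ hξ
      rw [← Finset.sum_mul, ← Complex.ofReal_sum]
      simp only [M]
      rw [← Finset.sum_mul, sum_coord_sq_div_norm_sq hξ, one_mul]
    · intro i _
      exact hfg.bdd_mul (c := c) (Complex.measurable_ofReal.comp (hM i)).aestronglyMeasurable
        (ae_of_all _ fun ξ => by simpa using hMc i ξ)
  rw [hsum]
  refine (norm_sum_le _ _).trans ?_
  refine (Finset.sum_le_card_nsmul _ _ _ fun i _ =>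
    norm_integral_multiplier_le i hA (hM i) (hMc i) (fun ξ => ?_) f g).trans_eq ?_
  · simp only [M, insertCoord_same, norm_sq_insertCoord]
    exact hk i ξ
  · simp

/-- The annulus complement `{ε < |lam² - |ξ|²|}`. -/
lemma measurableSet_farSet {n : ℕ} (lam ε : ℝ) :
    MeasurableSet {ξ : Space n | ε < |lam ^ 2 - ‖ξ‖ ^ 2|} :=
  (isOpen_lt continuous_const (by fun_prop)).measurableSet

lemma measurableSet_annulus {n : ℕ} (lam ε : ℝ) :
    MeasurableSet {ξ : Space n | |lam ^ 2 - ‖ξ‖ ^ 2| < ε} :=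
  (isOpen_lt (by fun_prop) continuous_const).measurableSet

/-- The truncated multiplier of the resolvent. -/
def resolventWeight {n : ℕ} (lam ε : ℝ) : Space n → ℝ :=
  {ξ : Space n | ε < |lam ^ 2 - ‖ξ‖ ^ 2|}.indicator fun ξ => (lam ^ 2 - ‖ξ‖ ^ 2)⁻¹

lemma measurable_resolventWeight {n : ℕ} (lam ε : ℝ) :
    Measurable (resolventWeight lam ε : Space n → ℝ) :=
  Measurable.indicator (by fun_prop) (measurableSet_farSet lam ε)

lemma abs_resolventWeight_le {n : ℕ} (lam : ℝ) {ε : ℝ} (hε : 0 < ε) (ξ : Space n) :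
    |resolventWeight lam ε ξ| ≤ ε⁻¹ := by
  unfold resolventWeight
  by_cases h : ξ ∈ {ξ : Space n | ε < |lam ^ 2 - ‖ξ‖ ^ 2|}
  · rw [indicator_of_mem h, abs_inv]
    exact inv_anti₀ hε (le_of_lt h)
  · rw [indicator_of_notMem h, abs_zero]
    positivity

lemma norm_integral_resolventWeight_le {lam ε : ℝ} (hlam : 0 < lam) (hε : 0 < ε)
    (f g : 𝓢(Space (m + 1), ℂ)) :
    ‖∫ ξ, (resolventWeight lam ε ξ : ℂ) * (fourierTransform f ξ * conj (fourierTransform g ξ))‖ ≤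
      (m + 1) * (30 / lam / Real.pi * (bENorm f).toReal * (bENorm g).toReal) := by
  refine norm_integral_weight_le (by positivity) (measurable_resolventWeight lam ε)
    (abs_resolventWeight_le lam hε) (fun i ξ => ?_) f g
  convert hasKernelBound_resolvent hlam hε ‖ξ‖ using 2 with s
  simp only [resolventWeight, indicator, mem_ofPred_eq, norm_sq_insertCoord]
  split_ifs <;> simp

/-- The linear dependence on ε is the point: after division by ε the bound survives the limit ε → 0
and becomes a trace estimate on the sphere. -/
lemma norm_integral_annulus_le {lam ε : ℝ} (hlam : 0 < lam) (hε : 0 < ε) (hε' : ε ≤ lam ^ 2 / 2)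
    (f : 𝓢(Space (m + 1), ℂ)) :
    ∫ ξ in {ξ : Space (m + 1) | |lam ^ 2 - ‖ξ‖ ^ 2| < ε}, ‖fourierTransform f ξ‖ ^ 2 ≤
      (m + 1) * (4 * ε / lam / Real.pi * (bENorm f).toReal * (bENorm f).toReal) := by
  have h := norm_integral_weight_le (W := {ξ : Space (m + 1) | |lam ^ 2 - ‖ξ‖ ^ 2| < ε}.indicator 1)
    (A := 4 * ε / lam) (c := 1) (by positivity)
    (measurable_one.indicator (measurableSet_annulus lam ε))
    (fun ξ => (norm_indicator_le_norm_self (1 : Space (m + 1) → ℝ) ξ).trans (by simp)) (fun i ξ => ?_) f f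
  · refine le_trans (le_of_eq ?_) h
    have h2 : ∀ z : ℂ, z * conj z = ((‖z‖ ^ 2 : ℝ) : ℂ) := fun z => by
      rw [Complex.mul_conj, Complex.normSq_eq_norm_sq]
    simp_rw [h2, ← Complex.ofReal_mul]
    rw [integral_complex_ofReal, Complex.norm_real, Real.norm_of_nonneg,
      ← integral_indicator (measurableSet_annulus lam ε)]
    · refine integral_congr_ae (ae_of_all _ fun ξ => ?_)
      simp only [indicator, mem_ofPred_eq]
      split_ifs <;> simp
    · refine integral_nonneg fun ξ => mul_nonneg ?_ (sq_nonneg _)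
      exact indicator_nonneg (fun _ _ => zero_le_one) _
  · convert hasKernelBound_annulus hlam hε hε' ‖ξ‖ using 2 with s
    simp only [indicator, mem_ofPred_eq, norm_sq_insertCoord]
    split_ifs <;> simp

section Truncated

variable {n : ℕ}

lemma truncatedIntegral_eq (lam ε : ℝ) (f : Space n → ℂ) (x : Space n) :
    truncatedIntegral lam f x ε = ((2 * Real.pi) ^ (-((n : ℝ) / 2)) : ℝ) *
      ∫ ξ, Complex.exp (Complex.I * (inner ℝ x ξ : ℝ)) *
        ((resolventWeight lam ε ξ : ℂ) * fourierTransform f ξ) := by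
  rw [truncatedIntegral, ← integral_indicator (measurableSet_farSet lam ε)]
  congr 2
  ext ξ
  simp only [resolventWeight, indicator, mem_ofPred_eq]
  split_ifs
  · push_cast
    ring
  · simp

lemma integrable_resolventWeight_mul (lam : ℝ) {ε : ℝ} (hε : 0 < ε) {h : Space n → ℂ}
    (hh : Integrable h volume) : Integrable (fun ξ => (resolventWeight lam ε ξ : ℂ) * h ξ) volume :=
  hh.bdd_mul (c := ε⁻¹)
    (Complex.measurable_ofReal.comp (measurable_resolventWeight lam ε)).aestronglyMeasurable
    (ae_of_all _ fun ξ => by simpa using abs_resolventWeight_le lam hε ξ)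

lemma integrable_fourierTransform (f : 𝓢(Space n, ℂ)) : Integrable (fourierTransform f) volume := by
  rw [← coe_schwartzFourier]
  exact (schwartzFourier f).integrable

lemma integrable_exp_mul (x : Space n) {h : Space n → ℂ} (hh : Integrable h volume) :
    Integrable (fun ξ => Complex.exp (Complex.I * (inner ℝ x ξ : ℝ)) * h ξ) volume :=
  hh.bdd_mul (c := 1) (Continuous.aestronglyMeasurable (by fun_prop))
    (ae_of_all _ fun ξ => (norm_exp_I_mul _).le)

lemma norm_integral_exp_mul_le (x : Space n) (h : Space n → ℂ) :
    ‖∫ ξ, Complex.exp (Complex.I * (inner ℝ x ξ : ℝ)) * h ξ‖ ≤ ∫ ξ, ‖h ξ‖ := by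
  refine (norm_integral_le_integral_norm _).trans_eq ?_
  refine integral_congr_ae (ae_of_all _ fun ξ => ?_)
  simp only [norm_mul]
  rw [norm_exp_I_mul, one_mul]

lemma aestronglyMeasurable_integral_exp_mul {h : Space n → ℂ}
    (hh : AEStronglyMeasurable h volume) :
    AEStronglyMeasurable
      (fun x : Space n => ∫ ξ, Complex.exp (Complex.I * (inner ℝ x ξ : ℝ)) * h ξ) volume := by
  refine AEStronglyMeasurable.integral_prod_right' (μ := (volume : Measure (Space n)))
    (ν := (volume : Measure (Space n)))
    (f := fun q : Space n × Space n => Complex.exp (Complex.I * (inner ℝ q.1 q.2 : ℝ)) * h q.2) ?_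
  exact (Continuous.aestronglyMeasurable (by fun_prop)).mul hh.comp_snd

/-- The inverse transform is the adjoint of the transform, by Fubini. Only integrability of h is
asked for, since truncated multipliers destroy smoothness. -/
lemma integral_exp_mul_pairing {h : Space n → ℂ} (hh : Integrable h volume) (g : 𝓢(Space n, ℂ)) :
    ∫ x, (((2 * Real.pi) ^ (-((n : ℝ) / 2)) : ℝ) *
      ∫ ξ, Complex.exp (Complex.I * (inner ℝ x ξ : ℝ)) * h ξ) * conj (g x) =
      ∫ ξ, h ξ * conj (fourierTransform g ξ) := by
  have hg : Integrable (fun x => conj (g x)) volume :=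
    (g.integrable (μ := volume)).congr'
      (Complex.continuous_conj.comp g.continuous).aestronglyMeasurable
      (ae_of_all _ fun y => by simp)
  have hH : Integrable (fun w : Space n × Space n =>
      Complex.exp (Complex.I * (inner ℝ w.1 w.2 : ℝ)) * (conj (g w.1) * h w.2))
      ((volume : Measure (Space n)).prod volume) := by
    refine (hg.mul_prod hh).bdd_mul (c := 1) ?_ ?_
    · exact Continuous.aestronglyMeasurable (by fun_prop)
    · exact ae_of_all _ fun r => (norm_exp_I_mul _).le
  have h1 : ∀ x : Space n, (((2 * Real.pi) ^ (-((n : ℝ) / 2)) : ℝ) *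
      ∫ ξ, Complex.exp (Complex.I * (inner ℝ x ξ : ℝ)) * h ξ) * conj (g x) =
      ((2 * Real.pi) ^ (-((n : ℝ) / 2)) : ℝ) *
        ∫ ξ, Complex.exp (Complex.I * (inner ℝ x ξ : ℝ)) * (conj (g x) * h ξ) := by
    intro x
    rw [mul_assoc, ← integral_mul_const]
    congr 2
    ext ξ
    ring
  simp_rw [h1]
  rw [integral_const_mul, integral_integral_swap hH, ← integral_const_mul]
  refine integral_congr_ae (ae_of_all _ fun ξ => ?_)
  simp only
  rw [fourierTransform, map_mul, Complex.conj_ofReal, ← integral_conj, mul_left_comm]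
  congr 1
  rw [← integral_const_mul]
  refine integral_congr_ae (ae_of_all _ fun x => ?_)
  simp only
  rw [map_mul, ← Complex.exp_conj, map_mul, map_neg, Complex.conj_I, Complex.conj_ofReal, neg_neg]
  ring

lemma integral_truncatedIntegral_mul_conj (lam : ℝ) {ε : ℝ} (hε : 0 < ε) (f g : 𝓢(Space n, ℂ)) :
    ∫ x, truncatedIntegral lam f x ε * conj (g x) =
      ∫ ξ, (resolventWeight lam ε ξ : ℂ) * (fourierTransform f ξ * conj (fourierTransform g ξ)) := by
  simp_rw [truncatedIntegral_eq]
  rw [integral_exp_mul_pairing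
    (integrable_resolventWeight_mul lam hε (integrable_fourierTransform f)) g]
  simp_rw [mul_assoc]

lemma aestronglyMeasurable_truncatedIntegral (lam : ℝ) {ε : ℝ} (hε : 0 < ε) (f : 𝓢(Space n, ℂ)) :
    AEStronglyMeasurable (fun x => truncatedIntegral lam f x ε) volume := by
  simp_rw [truncatedIntegral_eq]
  exact (aestronglyMeasurable_integral_exp_mul
    (integrable_resolventWeight_mul lam hε (integrable_fourierTransform f)).1).const_mul _

end Truncated

/-- Truncation makes the function bounded, so the duality criterion applies; the bound on its values
depends on ε, but the resulting B* bound does not. -/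
lemma bStarENorm_truncatedIntegral_le {lam ε : ℝ} (hlam : 0 < lam) (hε : 0 < ε)
    (f : 𝓢(Space (m + 1), ℂ)) :
    bStarENorm (fun x => truncatedIntegral lam f x ε) ≤
      ENNReal.ofReal ((m + 1) * 30 / Real.pi / lam) * bENorm f := by
  have h := bStarENorm_le_of_integral (aestronglyMeasurable_truncatedIntegral lam hε f)
    (M := (2 * Real.pi) ^ (-(((m + 1 : ℕ) : ℝ) / 2)) *
      ∫ ξ, ‖(resolventWeight lam ε ξ : ℂ) * fourierTransform f ξ‖)
    (A := (m + 1) * 30 / Real.pi / lam * (bENorm f).toReal) (fun x => ?_) (by positivity)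
    (fun φ => ?_)
  · rwa [ENNReal.ofReal_mul (by positivity),
      ENNReal.ofReal_toReal (bENorm_schwartz_lt_top f).ne] at h
  · rw [truncatedIntegral_eq, norm_mul, Complex.norm_real, Real.norm_of_nonneg (by positivity)]
    gcongr
    exact norm_integral_exp_mul_le _ _
  · rw [integral_truncatedIntegral_mul_conj lam hε]
    refine (norm_integral_resolventWeight_le hlam hε f φ).trans_eq ?_
    ring

end ResolventEstimate

/-! ### Polar coordinates. -/

section Polar

variable {n : ℕ}

lemma nontrivial_space (hn : 2 ≤ n) : Nontrivial (Space n) := by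
  have : Nonempty (Fin n) := ⟨⟨0, by omega⟩⟩
  infer_instance

/-- Integration in polar coordinates of a function that splits into a radial and an angular part. -/
lemma integral_radial_mul_angular (hn : 2 ≤ n) (h : ℝ → ℝ) (k : Space n → ℂ) :
    ∫ ξ : Space n, (h ‖ξ‖ : ℂ) * k (‖ξ‖⁻¹ • ξ) =
      (∫ θ : Metric.sphere (0 : Space n) 1, k θ ∂((volume : Measure (Space n)).toSphere)) *
        ((∫ r in Ioi (0 : ℝ), r ^ (n - 1) * h r : ℝ) : ℂ) := by
  have := nontrivial_space hn
  have hdim : Module.finrank ℝ (Space n) = n := finrank_euclideanSpace_fin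
  calc ∫ ξ : Space n, (h ‖ξ‖ : ℂ) * k (‖ξ‖⁻¹ • ξ)
      = ∫ x : ({(0 : Space n)}ᶜ : Set (Space n)), (h ‖x.1‖ : ℂ) * k (‖x.1‖⁻¹ • x.1)
          ∂((volume : Measure (Space n)).comap (↑)) := by
        rw [integral_subtype_comap (measurableSet_singleton _).compl
          fun x : Space n => (h ‖x‖ : ℂ) * k (‖x‖⁻¹ • x), restrict_compl_singleton]
    _ = ∫ p : Metric.sphere (0 : Space n) 1 × Ioi (0 : ℝ), k p.1 * (h p.2 : ℂ)
          ∂((volume : Measure (Space n)).toSphere.prod (.volumeIoiPow (n - 1))) := by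
        have := (volume : Measure (Space n)).measurePreserving_homeomorphUnitSphereProd
        rw [hdim] at this
        rw [← this.integral_comp (Homeomorph.measurableEmbedding _)]
        refine integral_congr_ae (ae_of_all _ fun x => ?_)
        simp only [homeomorphUnitSphereProd_apply_fst_coe, homeomorphUnitSphereProd_apply_snd_coe]
        ring
    _ = (∫ θ : Metric.sphere (0 : Space n) 1, k θ ∂((volume : Measure (Space n)).toSphere)) *
          ∫ r : Ioi (0 : ℝ), (h r : ℂ) ∂(Measure.volumeIoiPow (n - 1)) :=
        integral_prod_mul (fun θ : Metric.sphere (0 : Space n) 1 => k θ)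
          (fun r : Ioi (0 : ℝ) => (h r : ℂ))
    _ = _ := by
        congr 1
        rw [integral_complex_ofReal]
        congr 1
        simp only [Measure.volumeIoiPow, ENNReal.ofReal]
        rw [integral_withDensity_eq_integral_smul,
          integral_subtype_comap measurableSet_Ioi fun a => Real.toNNReal (a ^ (n - 1)) • h a]
        · refine setIntegral_congr_fun measurableSet_Ioi fun x hx => ?_
          rw [NNReal.smul_def, Real.coe_toNNReal _ (pow_nonneg (le_of_lt hx) _), smul_eq_mul]
        · exact (measurable_subtype_coe.pow_const _).real_toNNReal

end Polar

/-! ### Existence of principal values across the sphere. -/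

section PrincipalValue

/-- The substitution u = λ² - r² reaches only u < λ²; the vanishing of g elsewhere extends the
integral to the whole line. -/
lemma integral_Ioi_mul_comp_sq {lam : ℝ} {g : ℝ → ℝ} (hg : ∀ u, lam ^ 2 ≤ u → g u = 0) :
    ∫ r in Ioi (0 : ℝ), r * g (lam ^ 2 - r ^ 2) = 1 / 2 * ∫ u, g u := by
  have h1 := integral_comp_rpow_Ioi (fun w => g (lam ^ 2 - w)) (p := 2) (by norm_num)
  have h2 : ∫ w in Ioi (0 : ℝ), g (lam ^ 2 - w) = ∫ u, g u := by
    rw [setIntegral_eq_integral_of_forall_compl_eq_zero, integral_sub_left_eq_self]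
    intro w hw
    exact hg _ (by linarith [not_lt.1 (show ¬ (0 < w) from hw)])
  rw [← h2, ← h1, ← integral_const_mul]
  refine setIntegral_congr_fun measurableSet_Ioi fun r hr => ?_
  simp only [smul_eq_mul]
  norm_num
  ring

/-- `1 / u` truncated to `ε < |u| ≤ b`. -/
def annulusInv (ε b : ℝ) : ℝ → ℝ := {u | ε < |u| ∧ |u| ≤ b}.indicator fun u => u⁻¹

lemma measurable_annulusInv (ε b : ℝ) : Measurable (annulusInv ε b) := by
  refine Measurable.indicator (by fun_prop) ?_
  exact (measurableSet_lt measurable_const measurable_norm).inter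
    (measurableSet_le measurable_norm measurable_const)

lemma annulusInv_neg (ε b u : ℝ) : annulusInv ε b (-u) = -annulusInv ε b u := by
  simp only [annulusInv, indicator, mem_ofPred_eq, abs_neg, inv_neg]
  split_ifs <;> simp

lemma integral_annulusInv (ε b : ℝ) : ∫ u, annulusInv ε b u = 0 := by
  have h := integral_neg_eq_self (annulusInv ε b) volume
  simp_rw [annulusInv_neg] at h
  rw [integral_neg] at h
  linarith

lemma annulusInv_of_lt {ε b u : ℝ} (h : b < |u|) : annulusInv ε b u = 0 :=
  indicator_of_notMem (fun h' => not_lt.2 h'.2 h) _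

lemma abs_annulusInv_le_abs_inv (ε b u : ℝ) : |annulusInv ε b u| ≤ |u⁻¹| :=
  norm_indicator_le_norm_self (fun u : ℝ => u⁻¹) u

lemma abs_annulusInv_le {ε : ℝ} (hε : 0 < ε) (b u : ℝ) : |annulusInv ε b u| ≤ ε⁻¹ := by
  by_cases h : u ∈ {u | ε < |u| ∧ |u| ≤ b}
  · rw [annulusInv, indicator_of_mem h, abs_inv]
    exact inv_anti₀ hε h.1.le
  · rw [annulusInv, indicator_of_notMem h, abs_zero]
    positivity

lemma tendsto_annulusInv (b u : ℝ) :
    Tendsto (fun ε => annulusInv ε b u) (𝓝[>] 0) (𝓝 (annulusInv 0 b u)) := by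
  refine tendsto_const_nhds.congr' ?_
  rcases eq_or_ne u 0 with rfl | hu
  · refine Eventually.of_forall fun ε => ?_
    simp [annulusInv, indicator]
  · have hu' : 0 < |u| := abs_pos.2 hu
    filter_upwards [Ioo_mem_nhdsGT hu'] with ε hε
    simp [annulusInv, indicator, hu, hε.2]

lemma abs_one_sub_pow_le {z : ℝ} (hz0 : 0 ≤ z) (hz : z ≤ 2) (k : ℕ) :
    |1 - z ^ k| ≤ k * 2 ^ k * |1 - z| := by
  have h := mul_neg_geom_sum z k
  rw [← h, abs_mul, mul_comm]
  gcongr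
  rw [abs_of_nonneg (Finset.sum_nonneg fun i _ => by positivity)]
  calc ∑ i ∈ Finset.range k, z ^ i ≤ ∑ i ∈ Finset.range k, (2 : ℝ) ^ k := by
        refine Finset.sum_le_sum fun i hi => ?_
        calc z ^ i ≤ 2 ^ i := by gcongr
          _ ≤ 2 ^ k := pow_le_pow_right₀ (by norm_num) (Finset.mem_range.1 hi).le
    _ = k * 2 ^ k := by simp

variable {n : ℕ}

/-- The comparison function for principal values: homogeneous of degree `2 - n` and equal to `G` on
the sphere of radius `lam`. -/
def sphereExtension (lam : ℝ) (G : Space n → ℂ) (ξ : Space n) : ℂ :=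
  (((lam / ‖ξ‖) ^ (n - 2) : ℝ) : ℂ) * G (lam • (‖ξ‖⁻¹ • ξ))

lemma measurable_sphereExtension (lam : ℝ) {G : Space n → ℂ} (hG : Continuous G) :
    Measurable (sphereExtension lam G) := by
  unfold sphereExtension
  refine Measurable.mul (by fun_prop) (hG.measurable.comp (by fun_prop))

/-- The degree 2 - n is chosen so that the polar weight r^(n-1) becomes a multiple of r, which is
exactly the Jacobian of u = λ² - r². Odd g thus integrate to zero with no error term. -/
lemma integral_comp_norm_mul_sphereExtension (hn : 2 ≤ n) {lam : ℝ} {g : ℝ → ℝ}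
    (hg : ∀ u, lam ^ 2 ≤ u → g u = 0) (G : Space n → ℂ) :
    ∫ ξ : Space n, (g (lam ^ 2 - ‖ξ‖ ^ 2) : ℂ) * sphereExtension lam G ξ =
      (∫ θ : Metric.sphere (0 : Space n) 1, G (lam • (θ : Space n))
        ∂((volume : Measure (Space n)).toSphere)) *
        ((lam ^ (n - 2) * (1 / 2 * ∫ u, g u) : ℝ) : ℂ) := by
  have h1 := integral_radial_mul_angular hn (fun r => g (lam ^ 2 - r ^ 2) * (lam / r) ^ (n - 2))
    (fun ξ => G (lam • ξ))
  have h2 : ∫ r in Ioi (0 : ℝ), r ^ (n - 1) * (g (lam ^ 2 - r ^ 2) * (lam / r) ^ (n - 2)) =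
      lam ^ (n - 2) * (1 / 2 * ∫ u, g u) := by
    rw [← integral_Ioi_mul_comp_sq hg, ← integral_const_mul]
    refine setIntegral_congr_fun measurableSet_Ioi fun r hr => ?_
    have hr' : r ≠ 0 := ne_of_gt hr
    rw [show n - 1 = (n - 2) + 1 by omega, pow_succ, div_pow]
    field_simp
  rw [h2] at h1
  rw [← h1]
  refine integral_congr_ae (ae_of_all _ fun ξ => ?_)
  simp only [sphereExtension]
  push_cast
  ring

/-- Near the sphere of radius `lam` the difference between `G` and its comparison function vanishes
to first order. -/
lemma norm_sub_sphereExtension_le {lam : ℝ} (hlam : 0 < lam) {G : Space n → ℂ} {L M : ℝ}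
    (hM : ∀ ξ, ‖G ξ‖ ≤ M) (hL : ∀ ξ η, ‖G ξ - G η‖ ≤ L * ‖ξ - η‖) {ξ : Space n}
    (hξ : |lam ^ 2 - ‖ξ‖ ^ 2| ≤ lam ^ 2 / 2) :
    ‖G ξ - sphereExtension lam G ξ‖ ≤
      (L + M * (n * 2 ^ n * 2 / lam)) / lam * |lam ^ 2 - ‖ξ‖ ^ 2| := by
  set r := ‖ξ‖ with hr
  have hM0 : 0 ≤ M := (norm_nonneg _).trans (hM 0)
  obtain ⟨h1, h2⟩ := abs_le.1 hξ
  have hr0 : 0 ≤ r := norm_nonneg _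
  have hrl : lam / 2 ≤ r := by
    by_contra hcon
    nlinarith [not_le.1 hcon]
  have hrpos : 0 < r := lt_of_lt_of_le (by positivity) hrl
  have hdist : ‖ξ - lam • (r⁻¹ • ξ)‖ = |lam - r| := by
    have : ξ - lam • (r⁻¹ • ξ) = (1 - lam * r⁻¹) • ξ := by
      rw [sub_smul, one_smul, mul_smul]
    rw [this, norm_smul, Real.norm_eq_abs, ← hr]
    nth_rewrite 2 [← abs_of_pos hrpos]
    rw [← abs_mul, abs_sub_comm lam]
    congr 1
    field_simp
  have hz : lam / r ≤ 2 := by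
    rw [div_le_iff₀ hrpos]; linarith
  have hpow : |1 - (lam / r) ^ (n - 2)| ≤ n * 2 ^ n * 2 / lam * |lam - r| := by
    refine (abs_one_sub_pow_le (by positivity) hz (n - 2)).trans ?_
    have h3 : |1 - lam / r| ≤ 2 / lam * |lam - r| := by
      rw [show 1 - lam / r = -(lam - r) / r by field_simp; ring, abs_div, abs_neg, abs_of_pos hrpos,
        div_le_iff₀ hrpos]
      have h4 : 1 ≤ 2 / lam * r := by
        rw [div_mul_eq_mul_div, le_div_iff₀ hlam]; linarith
      nlinarith [abs_nonneg (lam - r)]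
    have hnn : ((n - 2 : ℕ) : ℝ) ≤ n := by exact_mod_cast Nat.sub_le n 2
    calc ((n - 2 : ℕ) : ℝ) * 2 ^ (n - 2) * |1 - lam / r|
        ≤ n * 2 ^ n * (2 / lam * |lam - r|) := by
          gcongr
          · norm_num
          · omega
      _ = _ := by ring
  -- The first term is the change of G under radial projection to the sphere, the second the
  -- deviation of the homogeneous factor from 1; both are O(|λ - r|).
  have hsplit : G ξ - sphereExtension lam G ξ = (G ξ - G (lam • (r⁻¹ • ξ))) +
      ((1 - (lam / r) ^ (n - 2) : ℝ) : ℂ) * G (lam • (r⁻¹ • ξ)) := by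
    simp only [sphereExtension, ← hr]
    push_cast
    ring
  -- Because λ + r ≥ λ.
  have ha : |lam - r| ≤ |lam ^ 2 - r ^ 2| / lam := by
    rw [le_div_iff₀ hlam, show lam ^ 2 - r ^ 2 = (lam - r) * (lam + r) by ring, abs_mul,
      abs_of_pos (by positivity : 0 < lam + r)]
    gcongr
    linarith
  have hL0 : 0 ≤ L * |lam - r| := by
    rw [← hdist]
    exact (norm_nonneg _).trans (hL _ _)
  have hLL : L * |lam - r| ≤ L * (|lam ^ 2 - r ^ 2| / lam) := by
    rcases eq_or_ne lam r with h | h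
    · simp [h]
    · have : 0 < |lam - r| := abs_pos.2 (sub_ne_zero.2 h)
      have hLn : 0 ≤ L := nonneg_of_mul_nonneg_left hL0 this
      gcongr
  rw [hsplit]
  refine (norm_add_le _ _).trans ?_
  rw [norm_mul, Complex.norm_real, Real.norm_eq_abs]
  calc ‖G ξ - G (lam • (r⁻¹ • ξ))‖ + |1 - (lam / r) ^ (n - 2)| * ‖G (lam • (r⁻¹ • ξ))‖
      ≤ L * |lam - r| + (n * 2 ^ n * 2 / lam * |lam - r|) * M := by
        gcongr
        · exact (hL _ _).trans_eq (by rw [hdist])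
        · exact hM _
    _ ≤ L * (|lam ^ 2 - r ^ 2| / lam) + (n * 2 ^ n * 2 / lam * (|lam ^ 2 - r ^ 2| / lam)) * M := by
        gcongr
    _ = _ := by ring

/-- Principal values exist for bounded integrable Lipschitz functions, with a uniform bound for the
truncated integrals. -/
lemma exists_tendsto_integral_resolventWeight (hn : 2 ≤ n) {lam : ℝ} (hlam : 0 < lam)
    {G : Space n → ℂ} (hG : Integrable G volume) {L M : ℝ}
    (hM : ∀ ξ, ‖G ξ‖ ≤ M) (hLnn : 0 ≤ L) (hL : ∀ ξ η, ‖G ξ - G η‖ ≤ L * ‖ξ - η‖) :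
    (∃ l, Tendsto (fun ε => ∫ ξ, (resolventWeight lam ε ξ : ℂ) * G ξ) (𝓝[>] 0) (𝓝 l)) ∧
    ∀ ε, 0 < ε → ε < lam ^ 2 / 2 → ‖∫ ξ, (resolventWeight lam ε ξ : ℂ) * G ξ‖ ≤
      (lam ^ 2 / 2)⁻¹ * (∫ ξ, ‖G ξ‖) + (L + M * (n * 2 ^ n * 2 / lam)) / lam *
        volume.real (Metric.closedBall (0 : Space n) (2 * lam)) := by
  -- Within |λ² - |ξ|²| ≤ λ²/2 the point ξ stays in a bounded set and away from the origin, where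
  -- the comparison function may be singular.
  set b := lam ^ 2 / 2 with hb
  have hb0 : 0 < b := by positivity
  have hM0 : 0 ≤ M := (norm_nonneg _).trans (hM 0)
  set C := (L + M * (n * 2 ^ n * 2 / lam)) / lam with hC
  have hC0 : 0 ≤ C := by positivity
  have hGc : Continuous G := by
    refine (LipschitzWith.of_dist_le_mul (K := L.toNNReal) fun ξ η => ?_).continuous
    rw [dist_eq_norm, dist_eq_norm, Real.coe_toNNReal _ hLnn]
    exact hL ξ η
  set H := sphereExtension lam G with hH
  have hHm : Measurable H := measurable_sphereExtension lam hGc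
  set S : Set (Space n) := Metric.closedBall 0 (2 * lam) with hS
  have hSm : MeasurableSet S := measurableSet_closedBall
  have hSfin : volume S ≠ ⊤ := measure_closedBall_lt_top.ne
  have hsupp : ∀ ε (ξ : Space n), ξ ∉ S → annulusInv ε b (lam ^ 2 - ‖ξ‖ ^ 2) = 0 := by
    intro ε ξ hξ
    refine annulusInv_of_lt ?_
    have h1 : 2 * lam < ‖ξ‖ := by simpa [hS] using hξ
    rw [abs_of_neg (by nlinarith)]
    nlinarith
  have hbound : ∀ ε (ξ : Space n), ‖(annulusInv ε b (lam ^ 2 - ‖ξ‖ ^ 2) : ℂ) * (G ξ - H ξ)‖ ≤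
      S.indicator (fun _ => C) ξ := by
    intro ε ξ
    by_cases hξ : ξ ∈ S
    · rw [indicator_of_mem hξ, norm_mul, Complex.norm_real, Real.norm_eq_abs]
      rcases lt_or_ge b |lam ^ 2 - ‖ξ‖ ^ 2| with h | h
      · rw [annulusInv_of_lt h, abs_zero, zero_mul]
        exact hC0
      · have h1 := norm_sub_sphereExtension_le hlam hM hL h
        have h2 := abs_annulusInv_le_abs_inv ε b (lam ^ 2 - ‖ξ‖ ^ 2)
        rcases eq_or_ne (lam ^ 2 - ‖ξ‖ ^ 2) 0 with h0 | h0
        · rw [h0] at h2 ⊢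
          have : |annulusInv ε b 0| = 0 := le_antisymm (by simpa using h2) (abs_nonneg _)
          rw [this, zero_mul]
          exact hC0
        · have hpos : 0 < |lam ^ 2 - ‖ξ‖ ^ 2| := abs_pos.2 h0
          calc _ ≤ |(lam ^ 2 - ‖ξ‖ ^ 2)⁻¹| * (C * |lam ^ 2 - ‖ξ‖ ^ 2|) :=
                mul_le_mul h2 h1 (norm_nonneg _) (abs_nonneg _)
            _ = C := by rw [abs_inv]; field_simp
    · rw [hsupp ε ξ hξ, indicator_of_notMem hξ]
      simp
  have hSi : Integrable (S.indicator fun _ => C) volume :=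
    (integrable_indicator_iff hSm).2 (integrableOn_const hSfin)
  have hVm : ∀ ε, Measurable fun ξ : Space n => (annulusInv ε b (lam ^ 2 - ‖ξ‖ ^ 2) : ℂ) := fun ε =>
    Complex.measurable_ofReal.comp ((measurable_annulusInv ε b).comp (by fun_prop))
  have hVi : ∀ ε, Integrable (fun ξ => (annulusInv ε b (lam ^ 2 - ‖ξ‖ ^ 2) : ℂ) * (G ξ - H ξ))
      volume := fun ε =>
    hSi.mono' ((hVm ε).aestronglyMeasurable.mul (hGc.aestronglyMeasurable.sub
      hHm.aestronglyMeasurable)) (ae_of_all _ (hbound ε))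
  have hVG : ∀ ε, 0 < ε → Integrable
      (fun ξ => (annulusInv ε b (lam ^ 2 - ‖ξ‖ ^ 2) : ℂ) * G ξ) volume := fun ε hε =>
    hG.bdd_mul (c := ε⁻¹) (hVm ε).aestronglyMeasurable
      (ae_of_all _ fun ξ => by simpa using abs_annulusInv_le hε b _)
  have hVH : ∀ ε, 0 < ε → Integrable
      (fun ξ => (annulusInv ε b (lam ^ 2 - ‖ξ‖ ^ 2) : ℂ) * H ξ) volume := fun ε hε => by
    refine ((hVG ε hε).sub (hVi ε)).congr (ae_of_all _ fun ξ => ?_)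
    simp only [Pi.sub_apply]
    ring
  -- Oddness of the truncated 1/u cancels H for every ε, not just in the limit.
  have hzero : ∀ ε, ∫ ξ : Space n, (annulusInv ε b (lam ^ 2 - ‖ξ‖ ^ 2) : ℂ) * H ξ = 0 := by
    intro ε
    rw [hH, integral_comp_norm_mul_sphereExtension hn, integral_annulusInv]
    · simp
    · intro u hu
      refine annulusInv_of_lt ?_
      rw [abs_of_pos (by nlinarith)]
      nlinarith
  have hsplit : ∀ ε, 0 < ε → ε < b → ∫ ξ, (resolventWeight lam ε ξ : ℂ) * G ξ =
      (∫ ξ, (resolventWeight lam b ξ : ℂ) * G ξ) +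
        ∫ ξ, (annulusInv ε b (lam ^ 2 - ‖ξ‖ ^ 2) : ℂ) * (G ξ - H ξ) := by
    intro ε hε hεb
    have h1 : ∀ ξ : Space n, (resolventWeight lam ε ξ : ℂ) * G ξ =
        (resolventWeight lam b ξ : ℂ) * G ξ +
          (annulusInv ε b (lam ^ 2 - ‖ξ‖ ^ 2) : ℂ) * G ξ := by
      intro ξ
      rw [← add_mul, ← Complex.ofReal_add]
      congr 2
      simp only [resolventWeight, annulusInv, indicator, mem_ofPred_eq]
      split_ifs with h1 h2 h3 h3 h3 h4 h4
      · linarith [h3.2]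
      · simp
      · simp
      · exact absurd ⟨h1, not_lt.1 h2⟩ h3
      · exact absurd (hεb.trans h3) h1
      · exact absurd (hεb.trans h3) h1
      · exact absurd h4.1 h1
      · simp
    simp_rw [h1]
    rw [integral_add (integrable_resolventWeight_mul lam hb0 hG) (hVG ε hε)]
    congr 1
    simp_rw [mul_sub]
    rw [integral_sub (hVG ε hε) (hVH ε hε), hzero, sub_zero]
  constructor
  -- The part far from the sphere does not depend on ε, and near it G - H cancels the singularity,
  -- so ε = 0 may be put under the integral by dominated convergence.
  · refine ⟨(∫ ξ, (resolventWeight lam b ξ : ℂ) * G ξ) +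
        ∫ ξ, (annulusInv 0 b (lam ^ 2 - ‖ξ‖ ^ 2) : ℂ) * (G ξ - H ξ), ?_⟩
    have hlim : Tendsto (fun ε => ∫ ξ, (annulusInv ε b (lam ^ 2 - ‖ξ‖ ^ 2) : ℂ) * (G ξ - H ξ))
        (𝓝[>] 0) (𝓝 (∫ ξ, (annulusInv 0 b (lam ^ 2 - ‖ξ‖ ^ 2) : ℂ) * (G ξ - H ξ))) := by
      refine tendsto_integral_filter_of_dominated_convergence (S.indicator fun _ => C)
        (Eventually.of_forall fun ε => (hVi ε).1)
        (Eventually.of_forall fun ε => ae_of_all _ (hbound ε)) hSi (ae_of_all _ fun ξ => ?_)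
      exact ((Complex.continuous_ofReal.tendsto _).comp (tendsto_annulusInv b _)).mul_const _
    refine (tendsto_const_nhds.add hlim).congr' ?_
    filter_upwards [Ioo_mem_nhdsGT hb0] with ε hε
    exact (hsplit ε hε.1 hε.2).symm
  · intro ε hε hεb
    rw [hsplit ε hε hεb]
    refine (norm_add_le _ _).trans (add_le_add ?_ ?_)
    · rw [← integral_const_mul]
      refine norm_integral_le_of_norm_le (hG.norm.const_mul _) (ae_of_all _ fun ξ => ?_)
      rw [norm_mul, Complex.norm_real, Real.norm_eq_abs]
      gcongr
      exact abs_resolventWeight_le lam hb0 ξ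
    · refine (norm_integral_le_of_norm_le hSi (ae_of_all _ (hbound ε))).trans_eq ?_
      rw [integral_indicator hSm, setIntegral_const, smul_eq_mul, mul_comm]

end PrincipalValue

/-! ### Principal values of Schwartz functions and the resolvent estimate. -/

section PrincipalValueOfSchwartz

variable {n : ℕ}

lemma exists_norm_le_schwartz (φ : 𝓢(Space n, ℂ)) : ∃ M, 0 ≤ M ∧ ∀ ξ, ‖φ ξ‖ ≤ M :=
  ⟨SchwartzMap.seminorm ℝ 0 0 φ, apply_nonneg _ _, SchwartzMap.norm_le_seminorm ℝ φ⟩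

lemma exists_lipschitz_schwartz (φ : 𝓢(Space n, ℂ)) :
    ∃ L, 0 ≤ L ∧ ∀ ξ η, ‖φ ξ - φ η‖ ≤ L * ‖ξ - η‖ := by
  refine ⟨SchwartzMap.seminorm ℝ 0 1 φ, apply_nonneg _ _, fun ξ η => ?_⟩
  refine convex_univ.norm_image_sub_le_of_norm_fderiv_le (𝕜 := ℝ) (fun z _ => φ.differentiableAt)
    (fun z _ => ?_) (mem_univ η) (mem_univ ξ)
  rw [← norm_iteratedFDeriv_one]
  exact SchwartzMap.norm_iteratedFDeriv_le_seminorm ℝ φ 1 z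

lemma norm_exp_inner_sub_le (x ξ η : Space n) :
    ‖Complex.exp (Complex.I * (inner ℝ x ξ : ℝ)) - Complex.exp (Complex.I * (inner ℝ x η : ℝ))‖ ≤
      ‖x‖ * ‖ξ - η‖ := by
  have h : Complex.exp (Complex.I * (inner ℝ x ξ : ℝ)) - Complex.exp (Complex.I * (inner ℝ x η : ℝ)) =
      Complex.exp (Complex.I * (inner ℝ x η : ℝ)) *
        (Complex.exp (Complex.I * (inner ℝ x (ξ - η) : ℝ)) - 1) := by
    rw [mul_sub, ← Complex.exp_add, inner_sub_right]
    push_cast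
    ring_nf
  rw [h, norm_mul, norm_exp_I_mul, one_mul]
  refine (Real.norm_exp_I_mul_ofReal_sub_one_le).trans ?_
  rw [Real.norm_eq_abs]
  exact abs_real_inner_le_norm _ _

/-- The oscillating factor makes the Lipschitz constant of the integrand grow linearly in |x|,
whence the bound C(1 + |x|). Its uniformity in ε serves as a majorant when the limit is paired with
Schwartz functions. -/
lemma exists_tendsto_truncatedIntegral (hn : 2 ≤ n) {lam : ℝ} (hlam : 0 < lam) (φ : 𝓢(Space n, ℂ)) :
    (∀ x, ∃ l, Tendsto (truncatedIntegral lam φ x) (𝓝[>] 0) (𝓝 l)) ∧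
    ∃ C, 0 ≤ C ∧ ∀ x ε, 0 < ε → ε < lam ^ 2 / 2 →
      ‖truncatedIntegral lam φ x ε‖ ≤ C * (1 + ‖x‖) := by
  obtain ⟨M, hM0, hM⟩ := exists_norm_le_schwartz (schwartzFourier φ)
  obtain ⟨L, hL0, hL⟩ := exists_lipschitz_schwartz (schwartzFourier φ)
  rw [coe_schwartzFourier] at hM hL
  set F := fourierTransform φ with hF
  set c : ℝ := (2 * Real.pi) ^ (-((n : ℝ) / 2)) with hc
  have hc0 : 0 ≤ c := by positivity
  have hE : ∀ x ξ, ‖Complex.exp (Complex.I * (inner ℝ x ξ : ℝ)) * F ξ‖ = ‖F ξ‖ := fun x ξ => by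
    rw [norm_mul, norm_exp_I_mul, one_mul]
  have hGL : ∀ x ξ η, ‖Complex.exp (Complex.I * (inner ℝ x ξ : ℝ)) * F ξ -
      Complex.exp (Complex.I * (inner ℝ x η : ℝ)) * F η‖ ≤ (L + ‖x‖ * M) * ‖ξ - η‖ := by
    intro x ξ η
    rw [show Complex.exp (Complex.I * (inner ℝ x ξ : ℝ)) * F ξ -
      Complex.exp (Complex.I * (inner ℝ x η : ℝ)) * F η =
      Complex.exp (Complex.I * (inner ℝ x ξ : ℝ)) * (F ξ - F η) +
      (Complex.exp (Complex.I * (inner ℝ x ξ : ℝ)) - Complex.exp (Complex.I * (inner ℝ x η : ℝ))) *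
        F η by ring]
    refine (norm_add_le _ _).trans ?_
    rw [norm_mul, norm_mul, norm_exp_I_mul, one_mul]
    have h1 := mul_le_mul (norm_exp_inner_sub_le x ξ η) (hM η) (norm_nonneg _) (by positivity)
    nlinarith [hL ξ η]
  have hint : ∀ x, Integrable (fun ξ => Complex.exp (Complex.I * (inner ℝ x ξ : ℝ)) * F ξ) volume :=
    fun x => integrable_exp_mul x (integrable_fourierTransform φ)
  have key := fun x => exists_tendsto_integral_resolventWeight hn hlam (hint x)
    (L := L + ‖x‖ * M) (M := M) (fun ξ => (hE x ξ).le.trans (hM ξ)) (by positivity) (hGL x)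
  have heq : ∀ x ε, truncatedIntegral lam φ x ε = (c : ℂ) * ∫ ξ, (resolventWeight lam ε ξ : ℂ) *
      (Complex.exp (Complex.I * (inner ℝ x ξ : ℝ)) * F ξ) := by
    intro x ε
    rw [truncatedIntegral_eq]
    congr 2
    ext ξ
    ring
  constructor
  · intro x
    obtain ⟨l, hl⟩ := (key x).1
    refine ⟨(c : ℂ) * l, ?_⟩
    refine (hl.const_mul (c : ℂ)).congr fun ε => (heq x ε).symm
  · set I := ∫ ξ, ‖F ξ‖
    have hI : 0 ≤ I := integral_nonneg fun _ => norm_nonneg _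
    set S := volume.real (Metric.closedBall (0 : Space n) (2 * lam))
    have hS : 0 ≤ S := measureReal_nonneg
    set N := M * (n * 2 ^ n * 2 / lam) with hN
    have hN0 : 0 ≤ N := by positivity
    refine ⟨c * ((lam ^ 2 / 2)⁻¹ * I + (L + M + N) / lam * S), by positivity,
      fun x ε hε hε' => ?_⟩
    have h := (key x).2 ε hε hε'
    simp_rw [hE] at h
    rw [heq, norm_mul, Complex.norm_real, Real.norm_of_nonneg hc0, mul_assoc]
    gcongr
    refine h.trans ?_
    rw [add_mul]
    refine add_le_add ?_ ?_
    · exact le_mul_of_one_le_right (by positivity) (by linarith [norm_nonneg x])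
    · have hx := norm_nonneg x
      have h3 : L + ‖x‖ * M + N ≤ (L + M + N) * (1 + ‖x‖) := by
        nlinarith [mul_nonneg hx hL0, mul_nonneg hx hN0]
      calc (L + ‖x‖ * M + N) / lam * S ≤ (L + M + N) * (1 + ‖x‖) / lam * S := by gcongr
        _ = _ := by ring

lemma tendsto_truncatedIntegral (hn : 2 ≤ n) {lam : ℝ} (hlam : 0 < lam) (φ : 𝓢(Space n, ℂ))
    (x : Space n) :
    Tendsto (truncatedIntegral lam φ x) (𝓝[>] 0) (𝓝 (principalValue lam φ x)) :=
  tendsto_nhds_limUnder ((exists_tendsto_truncatedIntegral hn hlam φ).1 x)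

/-- A sequence of truncation parameters that decreases to `0`. -/
lemma tendsto_inv_natCast_succ : Tendsto (fun k : ℕ => 1 / ((k : ℝ) + 1)) atTop (𝓝[>] 0) :=
  tendsto_nhdsWithin_iff.2 ⟨tendsto_one_div_add_atTop_nhds_zero_nat,
    Eventually.of_forall fun k => by simp only [mem_Ioi]; positivity⟩

lemma aestronglyMeasurable_principalValue (hn : 2 ≤ n) {lam : ℝ} (hlam : 0 < lam)
    (φ : 𝓢(Space n, ℂ)) : AEStronglyMeasurable (principalValue lam φ) volume :=
  aestronglyMeasurable_of_tendsto_ae atTop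
    (fun k : ℕ => aestronglyMeasurable_truncatedIntegral lam (by positivity : 0 < 1 / ((k : ℝ) + 1)) φ)
    (ae_of_all _ fun x => (tendsto_truncatedIntegral hn hlam φ x).comp tendsto_inv_natCast_succ)

/-- The resolvent estimate for Schwartz functions. -/
lemma bStarENorm_principalValue_le (hn : 2 ≤ n) {lam : ℝ} (hlam : 0 < lam) (φ : 𝓢(Space n, ℂ)) :
    bStarENorm (principalValue lam φ) ≤
      ENNReal.ofReal (n * 30 / Real.pi / lam) * bENorm φ := by
  obtain ⟨m, rfl⟩ : ∃ m, n = m + 1 := ⟨n - 1, by omega⟩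
  refine iSup_le fun j => ?_
  have hk : ∀ k : ℕ, 0 < 1 / ((k : ℝ) + 1) := fun k => by positivity
  have h1 : ∀ k : ℕ, shellNorm 2 (fun x => truncatedIntegral lam φ x (1 / ((k : ℝ) + 1))) j ≤
      (2 : ℝ≥0∞) ^ ((j : ℝ) / 2) * (ENNReal.ofReal ((m + 1 : ℕ) * 30 / Real.pi / lam) * bENorm φ) := by
    intro k
    refine (shellNorm_le_mul_bStarENorm _ j).trans ?_
    gcongr
    exact_mod_cast bStarENorm_truncatedIntegral_le hlam (hk k) φ
  have h2 : shellNorm 2 (principalValue lam φ) j ≤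
      (2 : ℝ≥0∞) ^ ((j : ℝ) / 2) * (ENNReal.ofReal ((m + 1 : ℕ) * 30 / Real.pi / lam) * bENorm φ) := by
    -- Fatou on each shell along ε = 1/(k + 1).
    refine (Lp.eLpNorm_lim_le_liminf_eLpNorm (fun k : ℕ =>
      (aestronglyMeasurable_truncatedIntegral lam (hk k) φ).restrict) _
      (ae_of_all _ fun x => (tendsto_truncatedIntegral hn hlam φ x).comp
        tendsto_inv_natCast_succ)).trans ?_
    exact (liminf_le_liminf (Eventually.of_forall h1)).trans_eq (by simp)
  calc _ ≤ (2 : ℝ≥0∞) ^ (-((j : ℝ) / 2)) * _ := mul_le_mul_right h2 _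
    _ = _ := by
      rw [← mul_assoc, mul_comm ((2 : ℝ≥0∞) ^ (-((j : ℝ) / 2))), two_rpow_mul_neg, one_mul]

/-- The factor n counts the coordinate directions, 30/λ bounds the one-dimensional kernels, and 1/π
comes from the Fourier normalization and the mixed norm. -/
lemma isResolventConstant (hn : 2 ≤ n) : IsResolventConstant n (n * 30 / Real.pi) :=
  ⟨by positivity, fun _ hlam φ => bStarENorm_principalValue_le hn hlam φ⟩

end PrincipalValueOfSchwartz

/-! ### The bounded extension of P_λ to B. -/

section Extension

variable {n : ℕ}

lemma truncatedIntegral_add (lam : ℝ) (φ ψ : 𝓢(Space n, ℂ)) (x : Space n) {ε : ℝ} (hε : 0 < ε) :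
    truncatedIntegral lam (φ + ψ : 𝓢(Space n, ℂ)) x ε =
      truncatedIntegral lam φ x ε + truncatedIntegral lam ψ x ε := by
  have h : schwartzFourier (φ + ψ) = schwartzFourier φ + schwartzFourier ψ := by
    simp only [schwartzFourier, map_add, smul_add]
  simp only [truncatedIntegral_eq]
  rw [← mul_add, ← integral_add
    (integrable_exp_mul x (integrable_resolventWeight_mul lam hε (integrable_fourierTransform φ)))
    (integrable_exp_mul x (integrable_resolventWeight_mul lam hε (integrable_fourierTransform ψ)))]
  congr 2
  ext ξ
  rw [← schwartzFourier_apply, h, _root_.add_apply, schwartzFourier_apply,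
    schwartzFourier_apply]
  ring

lemma truncatedIntegral_smul (lam : ℝ) (c : ℂ) (φ : 𝓢(Space n, ℂ)) (x : Space n) (ε : ℝ) :
    truncatedIntegral lam (c • φ : 𝓢(Space n, ℂ)) x ε = c * truncatedIntegral lam φ x ε := by
  have h : schwartzFourier (c • φ) = c • schwartzFourier φ := by
    simp only [schwartzFourier, map_smul]
    rw [smul_comm]
  simp only [truncatedIntegral_eq]
  have h2 : ∀ ξ, Complex.exp (Complex.I * (inner ℝ x ξ : ℝ)) *
      ((resolventWeight lam ε ξ : ℂ) * fourierTransform (c • φ : 𝓢(Space n, ℂ)) ξ) =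
      c * (Complex.exp (Complex.I * (inner ℝ x ξ : ℝ)) *
        ((resolventWeight lam ε ξ : ℂ) * fourierTransform φ ξ)) := fun ξ => by
    rw [← schwartzFourier_apply, h, _root_.smul_apply, schwartzFourier_apply, smul_eq_mul]
    ring
  simp_rw [h2]
  rw [integral_const_mul, mul_left_comm]

lemma principalValue_add (hn : 2 ≤ n) {lam : ℝ} (hlam : 0 < lam) (φ ψ : 𝓢(Space n, ℂ)) :
    principalValue lam (φ + ψ : 𝓢(Space n, ℂ)) = principalValue lam φ + principalValue lam ψ := by
  ext x
  refine tendsto_nhds_unique (tendsto_truncatedIntegral hn hlam (φ + ψ) x) ?_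
  refine ((tendsto_truncatedIntegral hn hlam φ x).add
    (tendsto_truncatedIntegral hn hlam ψ x)).congr' ?_
  filter_upwards [self_mem_nhdsWithin] with ε hε
  exact (truncatedIntegral_add lam φ ψ x hε).symm

lemma principalValue_smul (hn : 2 ≤ n) {lam : ℝ} (hlam : 0 < lam) (c : ℂ) (φ : 𝓢(Space n, ℂ)) :
    principalValue lam (c • φ : 𝓢(Space n, ℂ)) = c • principalValue lam φ := by
  ext x
  refine tendsto_nhds_unique (tendsto_truncatedIntegral hn hlam (c • φ) x) ?_
  refine ((tendsto_truncatedIntegral hn hlam φ x).const_mul c).congr fun ε => ?_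
  exact (truncatedIntegral_smul lam c φ x ε).symm

lemma bStarENorm_principalValue_lt_top (hn : 2 ≤ n) {lam : ℝ} (hlam : 0 < lam)
    (φ : 𝓢(Space n, ℂ)) : bStarENorm (principalValue lam φ) < ⊤ :=
  (bStarENorm_principalValue_le hn hlam φ).trans_lt
    (ENNReal.mul_lt_top ENNReal.ofReal_lt_top (bENorm_schwartz_lt_top φ))

/-- The principal value operator from the Schwartz space to `B*`. -/
def principalValueLin (hn : 2 ≤ n) {lam : ℝ} (hlam : 0 < lam) : 𝓢(Space n, ℂ) →ₗ[ℂ] BStar n where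
  toFun φ := ⟨AEEqFun.mk _ (aestronglyMeasurable_principalValue hn hlam φ), by
    rw [mem_BStar, bStarENorm_congr (AEEqFun.coeFn_mk _ _)]
    exact bStarENorm_principalValue_lt_top hn hlam φ⟩
  map_add' φ ψ := by
    refine Subtype.ext (AEEqFun.ext ((AEEqFun.coeFn_mk _ _).trans ?_))
    rw [principalValue_add hn hlam]
    exact (((AEEqFun.coeFn_mk _ _).add (AEEqFun.coeFn_mk _ _)).symm).trans
      (AEEqFun.coeFn_add _ _).symm
  map_smul' c φ := by
    refine Subtype.ext (AEEqFun.ext ((AEEqFun.coeFn_mk _ _).trans ?_))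
    rw [principalValue_smul hn hlam]
    exact (((AEEqFun.coeFn_mk _ (aestronglyMeasurable_principalValue hn hlam φ)).const_smul c).symm).trans
      (AEEqFun.coeFn_smul _ _).symm

lemma coeFn_principalValueLin (hn : 2 ≤ n) {lam : ℝ} (hlam : 0 < lam) (φ : 𝓢(Space n, ℂ)) :
    (principalValueLin hn hlam φ : Space n → ℂ) =ᵐ[volume] principalValue lam φ :=
  AEEqFun.coeFn_mk _ _

lemma norm_principalValueLin_le (hn : 2 ≤ n) {Cn lam : ℝ} (hCn : IsResolventConstant n Cn)
    (hlam : 0 < lam) (φ : 𝓢(Space n, ℂ)) :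
    ‖principalValueLin hn hlam φ‖ ≤ Cn / lam * ‖schwartzB n φ‖ := by
  rw [norm_schwartzB, BStar.norm_def, bStarENorm_congr (coeFn_principalValueLin hn hlam φ)]
  have h := ENNReal.toReal_mono (ENNReal.mul_lt_top ENNReal.ofReal_lt_top
    (bENorm_schwartz_lt_top φ)).ne (hCn.2 lam hlam φ)
  rwa [ENNReal.toReal_mul, ENNReal.toReal_ofReal (div_nonneg hCn.1.le hlam.le)] at h

lemma IsResolventExtension.apply_schwartzB {lam : ℝ} {P : B n →L[ℂ] BStar n}
    (hP : IsResolventExtension lam P) (φ : 𝓢(Space n, ℂ)) :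
    (P (schwartzB n φ) : Space n → ℂ) =ᵐ[volume] principalValue lam φ := by
  obtain ⟨-, b, hb, hPb⟩ := hP φ
  rwa [eq_schwartzB hb] at hPb

lemma isResolventExtension_resolventOp (hn : 2 ≤ n) {lam : ℝ} (hlam : 0 < lam) :
    IsResolventExtension lam (resolventOp n lam) := by
  have h : ∃ P : B n →L[ℂ] BStar n, IsResolventExtension lam P := by
    refine ⟨(principalValueLin hn hlam).extendOfNorm (schwartzB n), fun φ =>
      ⟨tendsto_truncatedIntegral hn hlam φ, schwartzB n φ, coeFn_schwartzB φ, ?_⟩⟩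
    rw [LinearMap.extendOfNorm_eq denseRange_schwartzB
      ⟨_, norm_principalValueLin_le hn (isResolventConstant hn) hlam⟩]
    exact coeFn_principalValueLin hn hlam φ
  rw [resolventOp, dif_pos h]
  exact h.choose_spec

lemma IsResolventExtension.unique {lam : ℝ} {P Q : B n →L[ℂ] BStar n}
    (hP : IsResolventExtension lam P) (hQ : IsResolventExtension lam Q) : P = Q := by
  refine ContinuousLinearMap.coeFn_injective (denseRange_schwartzB.equalizer P.continuous
    Q.continuous (funext fun φ => Subtype.ext (AEEqFun.ext ?_)))
  exact (hP.apply_schwartzB φ).trans (hQ.apply_schwartzB φ).symm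

/-- The inequality is closed in b, so every admissible constant passes from the dense Schwartz
functions to all of B. -/
lemma norm_resolventOp_le (hn : 2 ≤ n) {Cn lam : ℝ} (hCn : IsResolventConstant n Cn)
    (hlam : 0 < lam) (b : B n) : ‖resolventOp n lam b‖ ≤ Cn / lam * ‖b‖ := by
  refine denseRange_schwartzB.induction_on b
    (isClosed_le (resolventOp n lam).continuous.norm (continuous_norm.const_mul _)) fun φ => ?_
  have h : resolventOp n lam (schwartzB n φ) = principalValueLin hn hlam φ :=
    Subtype.ext (AEEqFun.ext (((isResolventExtension_resolventOp hn hlam).apply_schwartzB φ).trans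
      (coeFn_principalValueLin hn hlam φ).symm))
  rw [h]
  exact norm_principalValueLin_le hn hCn hlam φ

end Extension

/-! ### (Δ + λ²)P_λ = Id in the sense of distributions. -/

section Equation

variable {n : ℕ}

open ComplexConjugate

/-- Complex conjugation on the Schwartz space. -/
def schwartzConj (φ : 𝓢(Space n, ℂ)) : 𝓢(Space n, ℂ) :=
  SchwartzMap.postcompCLM (𝕜 := ℝ) (Complex.conjCLE : ℂ →L[ℝ] ℂ) φ

lemma schwartzConj_apply (φ : 𝓢(Space n, ℂ)) (x : Space n) : schwartzConj φ x = conj (φ x) := rfl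

/-- `(Δ + lam²) φ` as a Schwartz function. -/
def schwartzHelmholtz (lam : ℝ) (φ : 𝓢(Space n, ℂ)) : 𝓢(Space n, ℂ) :=
  Laplacian.laplacian φ + ((lam : ℂ) ^ 2) • φ

lemma schwartzHelmholtz_apply (lam : ℝ) (φ : 𝓢(Space n, ℂ)) (x : Space n) :
    schwartzHelmholtz lam φ x =
      Laplacian.laplacian (φ : Space n → ℂ) x + (lam : ℂ) ^ 2 * φ x := by
  rw [schwartzHelmholtz, _root_.add_apply, SchwartzMap.laplacian_apply,
    _root_.smul_apply, smul_eq_mul]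

lemma schwartzHelmholtz_conj (lam : ℝ) (φ : 𝓢(Space n, ℂ)) (x : Space n) :
    schwartzHelmholtz lam (schwartzConj φ) x = conj (schwartzHelmholtz lam φ x) := by
  have h : Laplacian.laplacian (schwartzConj φ : Space n → ℂ) =
      Complex.conjCLE ∘ Laplacian.laplacian (φ : Space n → ℂ) :=
    InnerProductSpace.laplacian_CLE_comp_left (l := Complex.conjCLE)
  rw [schwartzHelmholtz_apply, schwartzHelmholtz_apply, h]
  simp [schwartzConj_apply]

lemma fourierTransform_schwartzHelmholtz (lam : ℝ) (φ : 𝓢(Space n, ℂ)) (ξ : Space n) :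
    fourierTransform (schwartzHelmholtz lam φ) ξ =
      ((lam ^ 2 - ‖ξ‖ ^ 2 : ℝ) : ℂ) * fourierTransform φ ξ := by
  have h1 := fourierTransform_laplacian φ ξ
  have h2 : (fun x => Laplacian.laplacian (φ : Space n → ℂ) x) =
      ⇑(Laplacian.laplacian φ : 𝓢(Space n, ℂ)) :=
    funext fun x => (SchwartzMap.laplacian_apply φ x).symm
  rw [h2, ← schwartzFourier_apply] at h1
  have h3 : schwartzFourier (schwartzHelmholtz lam φ) =
      schwartzFourier (Laplacian.laplacian φ) + ((lam : ℂ) ^ 2) • schwartzFourier φ := by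
    simp only [schwartzFourier, schwartzHelmholtz, map_add, smul_add, map_smul]
    rw [smul_comm]
  rw [← schwartzFourier_apply, h3, _root_.add_apply, _root_.smul_apply, h1,
    schwartzFourier_apply, smul_eq_mul]
  push_cast
  ring

/-- The sphere |ξ| = |λ| is a null set, so the removed neighbourhoods disappear in the limit. -/
lemma tendsto_integral_far (hn : 2 ≤ n) {lam : ℝ} {h : Space n → ℂ}
    (hh : Integrable h volume) :
    Tendsto (fun ε => ∫ ξ, {ξ : Space n | ε < |lam ^ 2 - ‖ξ‖ ^ 2|}.indicator h ξ) (𝓝[>] 0)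
      (𝓝 (∫ ξ, h ξ)) := by
  have := nontrivial_space hn
  refine tendsto_integral_filter_of_dominated_convergence (fun ξ => ‖h ξ‖)
    (Eventually.of_forall fun ε => hh.1.indicator (measurableSet_farSet lam ε))
    (Eventually.of_forall fun ε => ae_of_all _ fun ξ => norm_indicator_le_norm_self h ξ) hh.norm ?_
  have hs : ∀ᵐ ξ : Space n, ξ ∉ Metric.sphere (0 : Space n) |lam| :=
    compl_mem_ae_iff.2 (Measure.addHaar_sphere _ _ _)
  filter_upwards [hs] with ξ hξ
  have hpos : 0 < |lam ^ 2 - ‖ξ‖ ^ 2| := by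
    refine abs_pos.2 fun h0 => hξ ?_
    rw [mem_sphere_zero_iff_norm, ← abs_norm, ← sq_eq_sq_iff_abs_eq_abs]
    linarith
  refine tendsto_const_nhds.congr' ?_
  filter_upwards [Ioo_mem_nhdsGT hpos] with ε hε
  rw [indicator_of_mem]
  exact hε.2

/-- `(Δ + lam²) P_lam f = f` in the sense of distributions, for Schwartz functions. -/
lemma integral_principalValue_mul_helmholtz (hn : 2 ≤ n) {lam : ℝ} (hlam : 0 < lam)
    (f g : 𝓢(Space n, ℂ)) :
    ∫ x, principalValue lam f x * schwartzHelmholtz lam g x = ∫ x, f x * g x := by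
  -- Conjugating the test function turns the bilinear pairing into the sesquilinear one of
  -- Parseval's identity.
  obtain ⟨g, rfl⟩ : ∃ g', g = schwartzConj g' :=
    ⟨schwartzConj g, by ext x; simp [schwartzConj_apply]⟩
  simp_rw [schwartzHelmholtz_conj, schwartzConj_apply]
  set h := schwartzHelmholtz lam g with hh
  obtain ⟨C, hC0, hC⟩ := (exists_tendsto_truncatedIntegral hn hlam f).2
  have hlim1 : Tendsto (fun ε => ∫ x, truncatedIntegral lam f x ε * conj (h x)) (𝓝[>] 0)
      (𝓝 (∫ x, principalValue lam f x * conj (h x))) := by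
    have hmem : Ioo (0 : ℝ) (lam ^ 2 / 2) ∈ 𝓝[>] (0 : ℝ) := Ioo_mem_nhdsGT (by positivity)
    -- The linear growth bound on the truncated integrals is absorbed by the decay of h.
    refine tendsto_integral_filter_of_dominated_convergence (fun x => C * (‖h x‖ + ‖x‖ ^ 1 * ‖h x‖))
      ?_ ?_ ?_ ?_
    · filter_upwards [hmem] with ε hε
      exact (aestronglyMeasurable_truncatedIntegral lam hε.1 f).mul
        (Complex.continuous_conj.comp h.continuous).aestronglyMeasurable
    · filter_upwards [hmem] with ε hε
      refine ae_of_all _ fun x => ?_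
      rw [norm_mul, RCLike.norm_conj]
      calc _ ≤ C * (1 + ‖x‖) * ‖h x‖ := by gcongr; exact hC x ε hε.1 hε.2
        _ = _ := by ring
    · exact ((h.integrable (μ := volume)).norm.add (h.integrable_pow_mul volume 1)).const_mul C
    · exact ae_of_all _ fun x => (tendsto_truncatedIntegral hn hlam f x).mul_const _
  have hfg : Integrable (fun ξ => fourierTransform f ξ * conj (fourierTransform g ξ)) volume := by
    rw [← coe_schwartzFourier, ← coe_schwartzFourier]
    exact MemLp.integrable_mul (p := 2) (q := 2) ((schwartzFourier f).memLp 2 volume)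
      ((schwartzFourier g).memLp 2 volume).star
  have hlim2 := tendsto_integral_far hn (lam := lam) hfg
  rw [integral_fourierTransform_mul_conj] at hlim2
  refine tendsto_nhds_unique hlim1 (hlim2.congr' ?_)
  filter_upwards [self_mem_nhdsWithin] with ε hε
  rw [integral_truncatedIntegral_mul_conj lam hε]
  refine integral_congr_ae (ae_of_all _ fun ξ => ?_)
  -- The symbol λ² - |ξ|² of Δ + λ² cancels the truncated multiplier and leaves the indicator of its
  -- support.
  simp only [hh, fourierTransform_schwartzHelmholtz, resolventWeight, indicator, mem_ofPred_eq]
  split_ifs with h1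
  · have h0 : lam ^ 2 - ‖ξ‖ ^ 2 ≠ 0 := abs_pos.1 (lt_trans hε h1)
    rw [map_mul, Complex.conj_ofReal, Complex.ofReal_inv]
    have h0' : ((lam ^ 2 - ‖ξ‖ ^ 2 : ℝ) : ℂ) ≠ 0 := Complex.ofReal_ne_zero.2 h0
    field_simp
  · simp

lemma bStarENorm_schwartz_lt_top (φ : 𝓢(Space n, ℂ)) : bStarENorm φ < ⊤ :=
  (bStarENorm_le_eLpNorm _).trans_lt (φ.eLpNorm_lt_top (μ := volume) 2)

/-- `(Δ + lam²) P_lam b = b` in the sense of distributions, for `b ∈ B`. -/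
lemma integral_resolventOp_mul_helmholtz (hn : 2 ≤ n) {lam : ℝ} (hlam : 0 < lam) (b : B n)
    (g : 𝓢(Space n, ℂ)) :
    ∫ x, (resolventOp n lam b : Space n → ℂ) x * schwartzHelmholtz lam g x =
      ∫ x, (b : Space n → ℂ) x * g x := by
  -- Both sides are continuous functionals of b, so their agreement on Schwartz functions is enough.
  let T : B n →L[ℂ] ℂ := (pairBStar (schwartzHelmholtz lam g)
    (schwartzHelmholtz lam g).continuous.aestronglyMeasurable (bENorm_schwartz_lt_top _)).comp
    (resolventOp n lam)
  let S : B n →L[ℂ] ℂ := pairB g g.continuous.aestronglyMeasurable (bStarENorm_schwartz_lt_top g)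
  have hTS : T = S := by
    refine ContinuousLinearMap.coeFn_injective (denseRange_schwartzB.equalizer T.continuous
      S.continuous (funext fun f => ?_))
    change ∫ x, (resolventOp n lam (schwartzB n f) : Space n → ℂ) x * schwartzHelmholtz lam g x =
      ∫ x, g x * (schwartzB n f : Space n → ℂ) x
    have h1 := (isResolventExtension_resolventOp hn hlam).apply_schwartzB f
    refine (integral_congr_ae (h1.mul (ae_eq_refl (schwartzHelmholtz lam g : Space n → ℂ)))).trans ?_
    refine (integral_principalValue_mul_helmholtz hn hlam f g).trans ?_
    refine (integral_congr_ae ((coeFn_schwartzB f).mul (ae_eq_refl (g : Space n → ℂ)))).symm.trans ?_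
    simp only [mul_comm, Pi.mul_apply]
  have h2 := congrArg (fun U : B n →L[ℂ] ℂ => U b) hTS
  refine h2.trans ?_
  simp only [S, pairB_apply, mul_comm]

end Equation

/-! ### The trace of the Fourier transform on the sphere. -/

section Trace

variable {n : ℕ}

/-- Averages over thin annuli converge to the integral over the sphere. -/
lemma tendsto_integral_annulus (hn : 2 ≤ n) {lam : ℝ} (hlam : 0 < lam) {G : Space n → ℂ} {L M : ℝ}
    (hM : ∀ ξ, ‖G ξ‖ ≤ M) (hLnn : 0 ≤ L) (hL : ∀ ξ η, ‖G ξ - G η‖ ≤ L * ‖ξ - η‖) :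
    Tendsto (fun ε : ℝ => (ε : ℂ)⁻¹ * ∫ ξ in {ξ : Space n | |lam ^ 2 - ‖ξ‖ ^ 2| < ε}, G ξ) (𝓝[>] 0)
      (𝓝 ((∫ θ : Metric.sphere (0 : Space n) 1, G (lam • (θ : Space n))
        ∂((volume : Measure (Space n)).toSphere)) * ((lam ^ (n - 2) : ℝ) : ℂ))) := by
  have := nontrivial_space hn
  have hM0 : 0 ≤ M := (norm_nonneg _).trans (hM 0)
  have hGc : Continuous G := by
    refine (LipschitzWith.of_dist_le_mul (K := L.toNNReal) fun ξ η => ?_).continuous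
    rw [dist_eq_norm, dist_eq_norm, Real.coe_toNNReal _ hLnn]
    exact hL ξ η
  set b := lam ^ 2 / 2 with hb
  have hb0 : 0 < b := by positivity
  set C := (L + M * (n * 2 ^ n * 2 / lam)) / lam with hC
  have hC0 : 0 ≤ C := by positivity
  set H := sphereExtension lam G with hH
  have hHm : Measurable H := measurable_sphereExtension lam hGc
  set S : Set (Space n) := Metric.closedBall 0 (2 * lam) with hS
  have hSm : MeasurableSet S := measurableSet_closedBall
  have hSfin : volume S ≠ ⊤ := measure_closedBall_lt_top.ne
  let A : ℝ → Set (Space n) := fun ε => {ξ : Space n | |lam ^ 2 - ‖ξ‖ ^ 2| < ε}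
  have hAm : ∀ ε, MeasurableSet (A ε) := measurableSet_annulus lam
  have hAS : ∀ ε < b, A ε ⊆ S := by
    intro ε hε ξ hξ
    have h1 : |lam ^ 2 - ‖ξ‖ ^ 2| < ε := hξ
    rw [hS, mem_closedBall_zero_iff]
    by_contra hcon
    have h2 := (abs_lt.1 h1).1
    nlinarith [not_le.1 hcon]
  have hSi : Integrable (S.indicator fun _ => C) volume :=
    (integrable_indicator_iff hSm).2 (integrableOn_const hSfin)
  have hbd : ∀ ε, 0 < ε → ε < b → ∀ ξ,
      ‖(ε : ℂ)⁻¹ * (A ε).indicator (fun ξ => G ξ - H ξ) ξ‖ ≤ S.indicator (fun _ => C) ξ := by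
    intro ε hε hεb ξ
    by_cases hξ : ξ ∈ A ε
    · rw [indicator_of_mem (hAS ε hεb hξ), indicator_of_mem hξ, norm_mul, norm_inv,
        Complex.norm_real, Real.norm_of_nonneg hε.le, inv_mul_le_iff₀ hε]
      have h1 : |lam ^ 2 - ‖ξ‖ ^ 2| < ε := hξ
      refine (norm_sub_sphereExtension_le hlam hM hL (h1.le.trans hεb.le)).trans ?_
      rw [mul_comm]
      gcongr
    · rw [indicator_of_notMem hξ, mul_zero, norm_zero]
      exact indicator_nonneg (fun _ _ => hC0) ξ
  have hm : ∀ ε : ℝ, AEStronglyMeasurable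
      (fun ξ => (ε : ℂ)⁻¹ * (A ε).indicator (fun ξ => G ξ - H ξ) ξ) volume := fun ε =>
    (AEStronglyMeasurable.indicator (hGc.aestronglyMeasurable.sub hHm.aestronglyMeasurable)
      (hAm ε)).const_mul _
  have hmem : Ioo (0 : ℝ) b ∈ 𝓝[>] (0 : ℝ) := Ioo_mem_nhdsGT hb0
  have hlim : Tendsto (fun ε : ℝ => ∫ ξ, (ε : ℂ)⁻¹ * (A ε).indicator (fun ξ => G ξ - H ξ) ξ) (𝓝[>] 0)
      (𝓝 (∫ _ : Space n, (0 : ℂ))) := by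
    refine tendsto_integral_filter_of_dominated_convergence (S.indicator fun _ => C)
      (Eventually.of_forall hm) ?_ hSi ?_
    · filter_upwards [hmem] with ε hε
      exact ae_of_all _ (hbd ε hε.1 hε.2)
    · have hs : ∀ᵐ ξ : Space n, ξ ∉ Metric.sphere (0 : Space n) |lam| :=
        compl_mem_ae_iff.2 (Measure.addHaar_sphere _ _ _)
      filter_upwards [hs] with ξ hξ
      have hpos : 0 < |lam ^ 2 - ‖ξ‖ ^ 2| := by
        refine abs_pos.2 fun h0 => hξ ?_
        rw [mem_sphere_zero_iff_norm, ← abs_norm, ← sq_eq_sq_iff_abs_eq_abs]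
        linarith
      refine tendsto_const_nhds.congr' ?_
      filter_upwards [Ioo_mem_nhdsGT hpos] with ε hε
      rw [indicator_of_notMem, mul_zero]
      exact not_lt.2 hε.2.le
  rw [integral_zero] at hlim
  rw [← add_zero ((∫ θ : Metric.sphere (0 : Space n) 1, G (lam • (θ : Space n))
        ∂((volume : Measure (Space n)).toSphere)) * ((lam ^ (n - 2) : ℝ) : ℂ))]
  refine (tendsto_const_nhds.add hlim).congr' ?_
  filter_upwards [hmem] with ε hε
  have hεC : (ε : ℂ) ≠ 0 := Complex.ofReal_ne_zero.2 hε.1.ne'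
  have hint : Integrable (fun ξ => (A ε).indicator (fun ξ => G ξ - H ξ) ξ) volume := by
    refine ((hSi.mono' (hm ε) (ae_of_all _ (hbd ε hε.1 hε.2))).const_mul (ε : ℂ)).congr
      (ae_of_all _ fun ξ => ?_)
    simp only
    rw [← mul_assoc, mul_inv_cancel₀ hεC, one_mul]
  have hGi : IntegrableOn G (A ε) volume :=
    (hGc.locallyIntegrable.integrableOn_isCompact (isCompact_closedBall 0 (2 * lam))).mono_set
      (hAS ε hε.2)
  have hHi : IntegrableOn H (A ε) volume := by
    refine (hGi.sub ((integrable_indicator_iff (hAm ε)).1 hint)).congr (ae_of_all _ fun ξ => ?_)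
    simp
  have hH1 : ∫ ξ in A ε, H ξ = (∫ θ : Metric.sphere (0 : Space n) 1, G (lam • (θ : Space n))
        ∂((volume : Measure (Space n)).toSphere)) * ((lam ^ (n - 2) * ε : ℝ) : ℂ) := by
    -- Its integral 2ε, halved by the substitution, gives exactly ε, so the average of the
    -- comparison function is already the limit for each such ε.
    let g : ℝ → ℝ := (Ioo (-ε) ε).indicator 1
    have h1 := integral_comp_norm_mul_sphereExtension hn (lam := lam) (g := g) (fun u hu => by
      refine indicator_of_notMem (fun h => ?_) _
      nlinarith [h.2, hε.2]) G
    have h2 : ∫ u, g u = 2 * ε := by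
      simp only [g]
      rw [integral_indicator measurableSet_Ioo]
      simp only [Pi.one_apply, integral_const, MeasurableSet.univ, measureReal_restrict_apply,
        univ_inter, smul_eq_mul, mul_one, Real.volume_real_Ioo]
      rw [max_eq_left (by linarith [hε.1])]
      ring
    rw [h2, show 1 / 2 * (2 * ε) = ε by ring] at h1
    rw [← h1, ← integral_indicator (hAm ε)]
    refine integral_congr_ae (ae_of_all _ fun ξ => ?_)
    simp only [A, g, indicator, mem_ofPred_eq, mem_Ioo, ← abs_lt]
    split_ifs <;> simp [hH]
  rw [integral_const_mul, integral_indicator (hAm ε), integral_sub hGi hHi, hH1]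
  push_cast
  field_simp
  ring

/-- The restriction of the Fourier transform to the sphere of radius `lam` is bounded from `B`. -/
lemma integral_sphere_norm_sq_fourierTransform_le (hn : 2 ≤ n) {lam : ℝ} (hlam : 0 < lam)
    (φ : 𝓢(Space n, ℂ)) :
    (∫ θ : Metric.sphere (0 : Space n) 1, ‖fourierTransform φ (lam • (θ : Space n))‖ ^ 2
      ∂((volume : Measure (Space n)).toSphere)) * lam ^ (n - 2) ≤
      n * (4 / lam / Real.pi * (bENorm φ).toReal ^ 2) := by
  obtain ⟨m, rfl⟩ : ∃ m, n = m + 1 := ⟨n - 1, by omega⟩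
  obtain ⟨M, hM0, hM⟩ := exists_norm_le_schwartz (schwartzFourier φ)
  obtain ⟨L, hL0, hL⟩ := exists_lipschitz_schwartz (schwartzFourier φ)
  rw [coe_schwartzFourier] at hM hL
  -- The square of the modulus of a function bounded by M and L-Lipschitz is bounded by M² and
  -- 2ML-Lipschitz.
  have h := tendsto_integral_annulus hn hlam
    (G := fun ξ => ((‖fourierTransform φ ξ‖ ^ 2 : ℝ) : ℂ)) (M := M ^ 2) (L := 2 * M * L)
    (fun ξ => by
      rw [Complex.norm_real, Real.norm_of_nonneg (by positivity)]
      gcongr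
      exact hM ξ) (by positivity) (fun ξ η => by
      rw [← Complex.ofReal_sub, Complex.norm_real, Real.norm_eq_abs, sq_sub_sq, abs_mul,
        abs_of_nonneg (by positivity), mul_assoc]
      refine mul_le_mul ?_ ((abs_norm_sub_norm_le _ _).trans (hL ξ η)) (abs_nonneg _) (by positivity)
      linarith [hM ξ, hM η])
  rw [integral_complex_ofReal, ← Complex.ofReal_mul] at h
  have h2 := (Complex.continuous_re.tendsto _).comp h
  rw [Complex.ofReal_re] at h2
  refine le_of_tendsto h2 ?_
  filter_upwards [Ioo_mem_nhdsGT (show 0 < lam ^ 2 / 2 by positivity)] with ε hε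
  rw [Function.comp_apply, integral_complex_ofReal, ← Complex.ofReal_inv, ← Complex.ofReal_mul,
    Complex.ofReal_re, inv_mul_le_iff₀ hε.1]
  refine (norm_integral_annulus_le hlam hε.1 hε.2.le φ).trans_eq ?_
  push_cast
  ring

end Trace

/-! ### Herglotz waves: membership in B* and the free equation. -/

section Herglotz

variable {n : ℕ}

lemma IsSmoothOnSphere.continuous {hn : 2 ≤ n} {f : Metric.sphere (0 : Space n) 1 → ℂ}
    (hf : IsSmoothOnSphere hn f) : Continuous f := by
  have : Fact (Module.finrank ℝ (Space n) = (n - 1) + 1) :=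
    ⟨by rw [finrank_euclideanSpace_fin]; omega⟩
  exact ContMDiff.continuous hf

lemma exists_norm_le_sphere {f : Metric.sphere (0 : Space n) 1 → ℂ} (hf : Continuous f) :
    ∃ M, 0 ≤ M ∧ ∀ θ, ‖f θ‖ ≤ M := by
  obtain ⟨M, hM⟩ := isCompact_univ.exists_bound_of_continuousOn hf.continuousOn
  exact ⟨|M|, abs_nonneg _, fun θ => (hM θ (mem_univ _)).trans (le_abs_self M)⟩

lemma norm_exp_neg_I_mul_inner (lam : ℝ) (x : Space n) (θ : Space n) :
    ‖Complex.exp (-Complex.I * ((lam * inner ℝ x θ : ℝ) : ℂ))‖ = 1 :=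
  norm_exp_neg_I_mul _

lemma norm_herglotz_le (lam : ℝ) {f : Metric.sphere (0 : Space n) 1 → ℂ} {M : ℝ}
    (hM : ∀ θ, ‖f θ‖ ≤ M) (x : Space n) :
    ‖herglotz lam f x‖ ≤ M * ((volume : Measure (Space n)).toSphere).real univ := by
  refine norm_integral_le_of_norm_le_const (ae_of_all _ fun θ => ?_)
  rw [norm_mul, norm_exp_neg_I_mul_inner, one_mul]
  exact hM θ

lemma continuous_herglotz (lam : ℝ) {f : Metric.sphere (0 : Space n) 1 → ℂ} (hf : Continuous f) :
    Continuous (herglotz lam f) := by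
  obtain ⟨M, hM0, hM⟩ := exists_norm_le_sphere hf
  refine continuous_of_dominated (bound := fun _ => M) (fun x => ?_) (fun x => ae_of_all _ fun θ => ?_)
    (integrable_const M) (ae_of_all _ fun θ => ?_)
  · exact Continuous.aestronglyMeasurable (by fun_prop)
  · rw [norm_mul, norm_exp_neg_I_mul_inner, one_mul]
    exact hM θ
  · fun_prop

/-- Herglotz waves are Fourier transforms of measures on the sphere. -/
lemma integral_herglotz_mul (lam : ℝ) {f : Metric.sphere (0 : Space n) 1 → ℂ} (hf : Continuous f)
    (ψ : 𝓢(Space n, ℂ)) :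
    (((2 * Real.pi) ^ (-((n : ℝ) / 2)) : ℝ) : ℂ) * ∫ x, herglotz lam f x * ψ x =
      ∫ θ : Metric.sphere (0 : Space n) 1, f θ * fourierTransform ψ (lam • (θ : Space n))
        ∂((volume : Measure (Space n)).toSphere) := by
  have hfi : Integrable f (volume : Measure (Space n)).toSphere := by
    obtain ⟨M, hM0, hM⟩ := exists_norm_le_sphere hf
    exact (integrable_const M).mono' hf.aestronglyMeasurable (ae_of_all _ hM)
  have hI : Integrable (fun q : Space n × Metric.sphere (0 : Space n) 1 =>
      Complex.exp (-Complex.I * ((lam * inner ℝ q.1 (q.2 : Space n) : ℝ) : ℂ)) * (ψ q.1 * f q.2))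
      ((volume : Measure (Space n)).prod (volume : Measure (Space n)).toSphere) := by
    refine ((ψ.integrable (μ := volume)).mul_prod hfi).bdd_mul (c := 1) ?_ ?_
    · exact Continuous.aestronglyMeasurable (by fun_prop)
    · exact ae_of_all _ fun q => (norm_exp_neg_I_mul_inner _ _ _).le
  have h1 : ∀ x, herglotz lam f x * ψ x = ∫ θ : Metric.sphere (0 : Space n) 1,
      Complex.exp (-Complex.I * ((lam * inner ℝ x (θ : Space n) : ℝ) : ℂ)) * (ψ x * f θ)
        ∂((volume : Measure (Space n)).toSphere) := by
    intro x
    rw [herglotz, ← integral_mul_const]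
    refine integral_congr_ae (ae_of_all _ fun θ => ?_)
    ring
  simp_rw [h1]
  rw [integral_integral_swap hI, ← integral_const_mul]
  refine integral_congr_ae (ae_of_all _ fun θ => ?_)
  simp only [fourierTransform]
  rw [mul_left_comm, ← integral_const_mul (f θ)]
  congr 1
  refine integral_congr_ae (ae_of_all _ fun x => ?_)
  simp only [real_inner_smul_right]
  ring

/-- Herglotz waves belong to `B*`. -/
lemma bStarENorm_herglotz_lt_top (hn : 2 ≤ n) {lam : ℝ} (hlam : 0 < lam)
    {f : Metric.sphere (0 : Space n) 1 → ℂ} (hf : Continuous f) :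
    bStarENorm (herglotz lam f) < ⊤ := by
  obtain ⟨M, hM0, hM⟩ := exists_norm_le_sphere hf
  set σ := (volume : Measure (Space n)).toSphere with hσ
  set s := σ.real univ with hs
  have hs0 : 0 ≤ s := measureReal_nonneg
  set D : ℝ := n * (4 / lam / Real.pi) / lam ^ (n - 2) with hD
  have hD0 : 0 ≤ D := by positivity
  set c : ℝ := (2 * Real.pi) ^ (-((n : ℝ) / 2)) with hc
  have hc0 : 0 < c := by positivity
  -- Here s is the area of the sphere and D the constant of the trace estimate; (s + D)/2 takes the
  -- place of √(sD) because Cauchy-Schwarz is replaced by the arithmetic-geometric mean inequality.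
  -- The factor c⁻¹ undoes the Fourier normalization.
  refine (bStarENorm_le_of_integral (continuous_herglotz lam hf).aestronglyMeasurable
    (norm_herglotz_le lam hM) (A := c⁻¹ * (M * ((s + D) / 2))) (by positivity) fun φ => ?_).trans_lt
    ENNReal.ofReal_lt_top
  set ψ := schwartzConj φ with hψ
  have hψN : bENorm ψ = bENorm φ := by
    simp only [bENorm, shellNorm]
    congr 1
    ext j
    congr 1
    exact eLpNorm_congr_norm_ae (ae_of_all _ fun x => by simp [hψ, schwartzConj_apply])
  set N := (bENorm φ).toReal with hN
  have hN0 : 0 ≤ N := ENNReal.toReal_nonneg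
  have hF : Continuous fun θ : Metric.sphere (0 : Space n) 1 =>
      fourierTransform ψ (lam • (θ : Space n)) := by
    rw [← coe_schwartzFourier]
    exact (schwartzFourier ψ).continuous.comp (by fun_prop)
  obtain ⟨K, hK0, hK⟩ := exists_norm_le_sphere hF
  have hi1 : Integrable (fun θ : Metric.sphere (0 : Space n) 1 =>
      ‖fourierTransform ψ (lam • (θ : Space n))‖) σ :=
    ((integrable_const K).mono' hF.aestronglyMeasurable (ae_of_all _ hK)).norm
  have hi2 : Integrable (fun θ : Metric.sphere (0 : Space n) 1 =>
      ‖fourierTransform ψ (lam • (θ : Space n))‖ ^ 2) σ := by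
    refine (integrable_const (K ^ 2)).mono' (hF.norm.pow 2).aestronglyMeasurable
      (ae_of_all _ fun θ => ?_)
    rw [Real.norm_of_nonneg (by positivity)]
    gcongr
    exact hK θ
  have htr : ∫ θ : Metric.sphere (0 : Space n) 1,
      ‖fourierTransform ψ (lam • (θ : Space n))‖ ^ 2 ∂σ ≤ D * N ^ 2 := by
    have h := integral_sphere_norm_sq_fourierTransform_le hn hlam ψ
    rw [hψN, ← le_div_iff₀ (by positivity)] at h
    refine h.trans_eq ?_
    rw [hD]
    ring
  have hL1 : ∫ θ : Metric.sphere (0 : Space n) 1,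
      ‖fourierTransform ψ (lam • (θ : Space n))‖ ∂σ ≤ (s + D) / 2 * N := by
    refine le_of_forall_pos_le_add fun e he => ?_
    -- The shift by t allows division by N + t even when N = 0, at a cost below e.
    obtain ⟨t, ht0, hte⟩ : ∃ t, 0 < t ∧ (s + D) / 2 * t ≤ e := by
      refine ⟨e / ((s + D) / 2 + 1), by positivity, ?_⟩
      rw [← mul_div_assoc, div_le_iff₀ (by positivity)]
      nlinarith
    have hr0 : 0 < N + t := by positivity
    calc _ ≤ ∫ θ : Metric.sphere (0 : Space n) 1, ((N + t) / 2 +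
          (2 * (N + t))⁻¹ * ‖fourierTransform ψ (lam • (θ : Space n))‖ ^ 2) ∂σ := by
          refine integral_mono hi1 ((integrable_const _).add (hi2.const_mul _)) fun θ => ?_
          set z := ‖fourierTransform ψ (lam • (θ : Space n))‖
          have : (N + t) / 2 + (2 * (N + t))⁻¹ * z ^ 2 - z = (2 * (N + t))⁻¹ * (N + t - z) ^ 2 := by
            field_simp
            ring
          have h2 : 0 ≤ (2 * (N + t))⁻¹ * (N + t - z) ^ 2 := by positivity
          linarith
      _ = s * ((N + t) / 2) + (2 * (N + t))⁻¹ * ∫ θ : Metric.sphere (0 : Space n) 1,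
            ‖fourierTransform ψ (lam • (θ : Space n))‖ ^ 2 ∂σ := by
          rw [integral_add (integrable_const _) (hi2.const_mul _), integral_const,
            integral_const_mul, smul_eq_mul]
      _ ≤ s * ((N + t) / 2) + (2 * (N + t))⁻¹ * (D * (N + t) ^ 2) := by
          gcongr
          refine htr.trans ?_
          gcongr
          linarith
      _ = (s + D) / 2 * N + (s + D) / 2 * t := by
          field_simp
      _ ≤ _ := by gcongr
  have h := integral_herglotz_mul lam hf ψ
  have h3 : ‖∫ θ : Metric.sphere (0 : Space n) 1, f θ * fourierTransform ψ (lam • (θ : Space n)) ∂σ‖ ≤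
      M * ((s + D) / 2 * N) := by
    refine (norm_integral_le_of_norm_le (hi1.const_mul M) (ae_of_all _ fun θ => ?_)).trans ?_
    · rw [norm_mul]
      gcongr
      exact hM θ
    · rw [integral_const_mul]
      gcongr
  rw [← h, norm_mul, Complex.norm_real, Real.norm_of_nonneg hc0.le, mul_comm, ← le_div_iff₀ hc0] at h3
  refine h3.trans_eq ?_
  field_simp

/-- Herglotz waves solve the free Helmholtz equation. -/
lemma integral_herglotz_mul_helmholtz {lam : ℝ} {f : Metric.sphere (0 : Space n) 1 → ℂ}
    (hf : Continuous f) (g : 𝓢(Space n, ℂ)) :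
    ∫ x, herglotz lam f x * schwartzHelmholtz lam g x = 0 := by
  have h := integral_herglotz_mul lam hf (schwartzHelmholtz lam g)
  have h2 : ∀ θ : Metric.sphere (0 : Space n) 1,
      fourierTransform (schwartzHelmholtz lam g) (lam • (θ : Space n)) = 0 := by
    intro θ
    rw [fourierTransform_schwartzHelmholtz, norm_smul, norm_eq_of_mem_sphere θ, mul_one,
      Real.norm_eq_abs, sq_abs, sub_self]
    simp
  simp only [h2, mul_zero, integral_zero] at h
  refine (mul_eq_zero.1 h).resolve_left (Complex.ofReal_ne_zero.2 ?_)
  positivity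

end Herglotz

/-! ### Neumann series and the perturbed equation. -/

section StationaryStates

variable {n : ℕ} {V : Space n → ℂ} (hV : MemLp V ⊤ volume) (hV' : tripleNorm V < ⊤)

lemma norm_resolventOp_multOp_le (hn : 2 ≤ n) {Cn lam : ℝ} (hCn : IsResolventConstant n Cn)
    (hlam : 0 < lam) (u : BStar n) :
    ‖resolventOp n lam (multOp V hV hV' u)‖ ≤ Cn * (tripleNorm V).toReal / lam * ‖u‖ := by
  refine (norm_resolventOp_le hn hCn hlam _).trans ?_
  have h := norm_multLin_le V hV hV' u
  have h0 : 0 ≤ Cn / lam := div_nonneg hCn.1.le hlam.le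
  calc Cn / lam * ‖multOp V hV hV' u‖ ≤ Cn / lam * ((tripleNorm V).toReal * ‖u‖) :=
        mul_le_mul_of_nonneg_left h h0
    _ = _ := by ring

lemma mul_tripleNorm_nonneg {Cn : ℝ} (hCn : IsResolventConstant n Cn) :
    0 ≤ Cn * (tripleNorm V).toReal :=
  mul_nonneg hCn.1.le ENNReal.toReal_nonneg

lemma isUnit_idSubResolventMul (hn : 2 ≤ n) {Cn lam : ℝ} (hCn : IsResolventConstant n Cn)
    (hlam : Cn * (tripleNorm V).toReal < lam) : IsUnit (idSubResolventMul V hV hV' lam) := by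
  have h0 : 0 ≤ Cn * (tripleNorm V).toReal := mul_tripleNorm_nonneg hCn
  have hlam0 : 0 < lam := h0.trans_lt hlam
  refine isUnit_one_sub_of_norm_lt_one (lt_of_le_of_lt
    (ContinuousLinearMap.opNorm_le_bound _ (div_nonneg h0 hlam0.le) fun u =>
      norm_resolventOp_multOp_le hV hV' hn hCn hlam0 u) ?_)
  rwa [div_lt_one hlam0]

/-- This is (Id - P_λ V)v = P_λ V u with the terms regrouped. The fixed-point form v = P_λ V w, w =
u + v, yields both the estimate and, after applying Δ + λ², the equation for w. -/
lemma correction_eq (hn : 2 ≤ n) {Cn lam : ℝ} (hCn : IsResolventConstant n Cn)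
    (hlam : Cn * (tripleNorm V).toReal < lam) (u : BStar n) :
    correction V hV hV' lam u =
      resolventOp n lam (multOp V hV hV' (u + correction V hV hV' lam u)) := by
  have h1 := congrArg (fun T : BStar n →L[ℂ] BStar n => T (resolventOp n lam (multOp V hV hV' u)))
    (Ring.mul_inverse_cancel _ (isUnit_idSubResolventMul hV hV' hn hCn hlam))
  have h2 : correction V hV hV' lam u -
      resolventOp n lam (multOp V hV hV' (correction V hV hV' lam u)) =
      resolventOp n lam (multOp V hV hV' u) := h1
  rw [map_add, map_add, ← h2]
  abel

/-- The norm bound on P_λ V is applied to the fixed-point form and the v on the right is absorbed.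
The product form leaves open how λ - λ_V is compared with λ. -/
lemma norm_correction_mul_le (hn : 2 ≤ n) {Cn lam : ℝ} (hCn : IsResolventConstant n Cn)
    (hlam : Cn * (tripleNorm V).toReal < lam) (u : BStar n) :
    ‖correction V hV hV' lam u‖ * (lam - Cn * (tripleNorm V).toReal) ≤
      Cn * (tripleNorm V).toReal * ‖u‖ := by
  have h0 : 0 ≤ Cn * (tripleNorm V).toReal := mul_tripleNorm_nonneg hCn
  have hlam0 : 0 < lam := h0.trans_lt hlam
  set v := correction V hV hV' lam u with hv
  have h1 : ‖v‖ ≤ Cn * (tripleNorm V).toReal / lam * ‖u + v‖ := by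
    have h := norm_resolventOp_multOp_le hV hV' hn hCn hlam0 (u + v)
    rwa [← correction_eq hV hV' hn hCn hlam u] at h
  rw [div_mul_eq_mul_div, le_div_iff₀ hlam0] at h1
  have h2 := mul_le_mul_of_nonneg_left (norm_add_le u v) h0
  linarith

lemma exists_coeFn_herglotz (hn : 2 ≤ n) {lam : ℝ} (hlam : 0 < lam)
    {f : Metric.sphere (0 : Space n) 1 → ℂ} (hf : Continuous f) :
    ∃ u : BStar n, (u : Space n → ℂ) =ᵐ[volume] herglotz lam f := by
  have hm := (continuous_herglotz lam hf).aestronglyMeasurable (μ := volume)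
  refine ⟨⟨AEEqFun.mk _ hm, ?_⟩, AEEqFun.coeFn_mk _ _⟩
  rw [mem_BStar, bStarENorm_congr (AEEqFun.coeFn_mk _ _)]
  exact bStarENorm_herglotz_lt_top hn hlam hf

lemma solvesHelmholtz_add_correction (hn : 2 ≤ n) {Cn lam : ℝ} (hCn : IsResolventConstant n Cn)
    (hlam : Cn * (tripleNorm V).toReal < lam) {f : Metric.sphere (0 : Space n) 1 → ℂ}
    (hf : Continuous f) {u : BStar n} (hu : (u : Space n → ℂ) =ᵐ[volume] herglotz lam f) :
    SolvesHelmholtz V lam (u + correction V hV hV' lam u : BStar n) := by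
  have hlam0 : 0 < lam := (mul_tripleNorm_nonneg hCn).trans_lt hlam
  intro φ hφ hφc
  set v := correction V hV hV' lam u with hv
  set w : BStar n := u + v with hw
  have hvw : v = resolventOp n lam (multOp V hV hV' w) := correction_eq hV hV' hn hCn hlam u
  let g : 𝓢(Space n, ℂ) := hφc.toSchwartzMap hφ
  have hg : (g : Space n → ℂ) = φ := rfl
  have hgh : ∀ x, Laplacian.laplacian φ x + (lam : ℂ) ^ 2 * φ x = schwartzHelmholtz lam g x :=
    fun x => by rw [schwartzHelmholtz_apply, hg]
  have hI : ∀ z : BStar n, Integrable (fun x => (z : Space n → ℂ) x * schwartzHelmholtz lam g x)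
      volume := fun z => integrable_mul_of_bStarENorm z.1.aestronglyMeasurable (mem_BStar.1 z.2)
    (schwartzHelmholtz lam g).continuous.aestronglyMeasurable (bENorm_schwartz_lt_top _)
  have hVw : Integrable (fun x => g x * (multOp V hV hV' w : Space n → ℂ) x) volume :=
    integrable_mul_of_bStarENorm g.continuous.aestronglyMeasurable (bStarENorm_schwartz_lt_top g)
      (multOp V hV hV' w).1.aestronglyMeasurable (mem_B.1 (multOp V hV hV' w).2)
  have hae : (fun x => (w : Space n → ℂ) x *
      (Laplacian.laplacian φ x + (lam : ℂ) ^ 2 * φ x - V x * φ x)) =ᵐ[volume]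
      fun x => (herglotz lam f x * schwartzHelmholtz lam g x +
        (v : Space n → ℂ) x * schwartzHelmholtz lam g x) -
        g x * (multOp V hV hV' w : Space n → ℂ) x := by
    filter_upwards [multOp_apply V hV hV' w,
      AEEqFun.coeFn_add (u : Space n →ₘ[volume] ℂ) (v : Space n →ₘ[volume] ℂ), hu] with x h1 h2 h3
    have h4 : (w : Space n → ℂ) x = herglotz lam f x + (v : Space n → ℂ) x := by
      rw [← h3]
      exact h2
    rw [h1, hgh, Pi.mul_apply, hg, ← add_mul, ← h4]
    ring
  have hIu : Integrable (fun x => herglotz lam f x * schwartzHelmholtz lam g x) volume := by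
    refine (hI u).congr ?_
    filter_upwards [hu] with x hx
    rw [hx]
  have hIs : Integrable (fun x => herglotz lam f x * schwartzHelmholtz lam g x +
      (v : Space n → ℂ) x * schwartzHelmholtz lam g x) volume := hIu.add (hI v)
  rw [integral_congr_ae hae, integral_sub hIs hVw, integral_add hIu (hI v),
    integral_herglotz_mul_helmholtz hf, zero_add, hvw,
    integral_resolventOp_mul_helmholtz hn hlam0]
  simp only [mul_comm, sub_self]

end StationaryStates

end StationaryStates

end

/-! ### The theorem, with the choice of constants. -/

open StationaryStates in
theorem mainTheorem3 (n : ℕ) (hn : 2 ≤ n) :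
    -- `P_lam` is well defined: the principal values exist, and they extend uniquely to `B`.
    (∀ lam : ℝ, 0 < lam → IsResolventExtension lam (resolventOp n lam) ∧
      ∀ P : B n →L[ℂ] BStar n, IsResolventExtension lam P → P = resolventOp n lam) ∧
    -- For every admissible constant `Cₙ`, with `lam_V = Cₙ ⦀V⦀`:
    (∀ Cn : ℝ, IsResolventConstant n Cn →
      -- the stationary states exist for `lam > lam_V`,
      (∀ (V : Space n → ℂ) (hV : MemLp V ⊤ volume) (hV' : tripleNorm V < ⊤) (lam : ℝ),
        Cn * (tripleNorm V).toReal < lam →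
        IsUnit (idSubResolventMul V hV hV' lam) ∧
        ∀ f : Metric.sphere (0 : Space n) 1 → ℂ, IsSmoothOnSphere hn f →
          ∃ u : BStar n, (u : Space n → ℂ) =ᵐ[volume] herglotz lam f ∧
            SolvesHelmholtz V lam (u + correction V hV hV' lam u : BStar n)) ∧
      -- and the correction is bounded, uniformly for `⦀V⦀` bounded.
      (∀ δ : ℝ, 0 < δ → ∀ M : ℝ, ∃ C : ℝ, 0 < C ∧
        ∀ (V : Space n → ℂ) (hV : MemLp V ⊤ volume) (hV' : tripleNorm V < ⊤) (lam : ℝ),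
          (tripleNorm V).toReal ≤ M → Cn * (tripleNorm V).toReal + δ ≤ lam →
          ∀ f : Metric.sphere (0 : Space n) 1 → ℂ, IsSmoothOnSphere hn f →
            ∀ u : BStar n, (u : Space n → ℂ) =ᵐ[volume] herglotz lam f →
              ‖correction V hV hV' lam u‖ ≤ C * (Cn * (tripleNorm V).toReal) / lam * ‖u‖)) ∧
    -- Admissible constants exist, and `Cₙ` can be chosen so that `C` depends only on `n`.
    (∃ Cn : ℝ, IsResolventConstant n Cn ∧ ∃ C : ℝ, 0 < C ∧ ∀ δ : ℝ, 0 < δ →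
      ∀ (V : Space n → ℂ) (hV : MemLp V ⊤ volume) (hV' : tripleNorm V < ⊤) (lam : ℝ),
        Cn * (tripleNorm V).toReal + δ ≤ lam →
        ∀ f : Metric.sphere (0 : Space n) 1 → ℂ, IsSmoothOnSphere hn f →
          ∀ u : BStar n, (u : Space n → ℂ) =ᵐ[volume] herglotz lam f →
            ‖correction V hV hV' lam u‖ ≤ C * (Cn * (tripleNorm V).toReal) / lam * ‖u‖) := by
  refine ⟨fun lam hlam => ⟨isResolventExtension_resolventOp hn hlam, fun P hP =>
    hP.unique (isResolventExtension_resolventOp hn hlam)⟩, fun Cn hCn => ⟨?_, ?_⟩, ?_⟩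
  · intro V hV hV' lam hlam
    refine ⟨isUnit_idSubResolventMul hV hV' hn hCn hlam, fun f hf => ?_⟩
    obtain ⟨u, hu⟩ := exists_coeFn_herglotz hn ((mul_tripleNorm_nonneg hCn).trans_lt hlam)
      hf.continuous
    exact ⟨u, hu, solvesHelmholtz_add_correction hV hV' hn hCn hlam hf.continuous hu⟩
  · intro δ hδ M
    have hCn0 : 0 < Cn := hCn.1
    -- The constant bounds λ/(λ - λ_V) = 1 + λ_V/(λ - λ_V), using λ_V ≤ Cₙ|M| and λ - λ_V ≥ δ.
    refine ⟨1 + Cn * |M| / δ, by positivity, fun V hV hV' lam hM hlam f _ u _ => ?_⟩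
    have h := norm_correction_mul_le hV hV' hn hCn (by linarith) u
    have h0 : 0 ≤ Cn * (tripleNorm V).toReal := mul_tripleNorm_nonneg hCn
    have hT : Cn * (tripleNorm V).toReal ≤ Cn * |M| := by
      gcongr
      exact hM.trans (le_abs_self M)
    set q := Cn * (tripleNorm V).toReal with hq
    have hlam0 : 0 < lam := by linarith
    have hd : 0 < lam - q := by linarith
    have h1 : lam ≤ (1 + Cn * |M| / δ) * (lam - q) := by
      have h2 : Cn * |M| ≤ Cn * |M| / δ * (lam - q) := by
        rw [div_mul_eq_mul_div, le_div_iff₀ hδ]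
        have : 0 ≤ Cn * |M| := by positivity
        nlinarith
      linarith
    rw [div_mul_eq_mul_div, le_div_iff₀ hlam0]
    calc ‖correction V hV hV' lam u‖ * lam
        ≤ ‖correction V hV hV' lam u‖ * ((1 + Cn * |M| / δ) * (lam - q)) := by gcongr
      _ = (1 + Cn * |M| / δ) * (‖correction V hV hV' lam u‖ * (lam - q)) := by ring
      _ ≤ (1 + Cn * |M| / δ) * (q * ‖u‖) := by gcongr
      _ = _ := by ring
  · have hK := isResolventConstant hn
    set K : ℝ := n * 30 / Real.pi with hKdef
    have hK0 : 0 < K := hK.1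
    -- Doubling an admissible constant gives the room for uniformity: the correction does not depend
    -- on the constant, so it can be estimated with K, while λ > 2K⦀V⦀ ensures λ ≤ 2(λ - K⦀V⦀). The
    -- doubling inside λ_V then makes C = 1 suffice.
    have hK2 : IsResolventConstant n (2 * K) := by
      refine ⟨by positivity, fun lam hlam φ => (hK.2 lam hlam φ).trans ?_⟩
      gcongr
      linarith
    refine ⟨2 * K, hK2, 1, one_pos, fun δ hδ V hV hV' lam hlam f _ u _ => ?_⟩
    have h0 : 0 ≤ K * (tripleNorm V).toReal := mul_tripleNorm_nonneg hK
    have h := norm_correction_mul_le hV hV' hn hK (by linarith) u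
    have hlam0 : 0 < lam := by linarith
    rw [div_mul_eq_mul_div, le_div_iff₀ hlam0]
    have h1 := mul_le_mul_of_nonneg_left
      (show lam ≤ 2 * (lam - K * (tripleNorm V).toReal) by linarith)
      (norm_nonneg (correction V hV hV' lam u))
    linarith
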